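/- \textbf{Setting.} For $f:\mathbb R^2\to\mathbb R^2$, of class $C^m$ on $\mathbb R^2\setminus\{0\}$, put $\|f\|_{\dot E^m_1}=\max_{|\alpha|\le m}\sup_{x\ne0}|x|^{1+|\alpha|}|\partial^\alpha f(x)|$, and let $\dot E^m_1$ be the space where this is finite. For a measurable $u(x,t)$ on $\mathbb R^2\times(0,\infty)$, of class $C^m$ in $x$ for almost every $t$, put $\|u\|_{X^m_1}=\max_{|\alpha|\le m}\operatorname{ess\,sup}_{x,t}(\sqrt t+|x|)^{1+|\alpha|}|\partial_x^\alpha u(x,t)|$, and let $X^m_1$ be the space where this is finite. Let $g_t(x)=(4\pi t)^{-1}e^{-|x|^2/(4t)}$, $e^{t\Delta}a=g_t*a$, and let $\mathbb P$ be the Leray projector onto divergence-free fields. A solution of the Navier--Stokes equations with datum $a$ is a field $u$ with $$u(t)=e^{t\Delta}a-\int_0^te^{(t-s)\Delta}\mathbb P\nabla\cdot(u\otimes u)(s)\,ds\qquad(t>0),$$ and $u(t)\to a$ in $\mathcal S'(\mathbb R^2)$ as $t\to0$. Let $$\mathfrak F_{j;h,k}(x)=\frac1\pi\,\frac{(\delta_{j,h}x_k+\delta_{h,k}x_j+\delta_{k,j}x_h)|x|^2-4x_jx_hx_k}{|x|^{6}},\qquad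 (\mathfrak F(x):B)_j=\sum_{h,k=1}^2\mathfrak F_{j;h,k}(x)B_{h,k}.$$ \textbf{Theorem.} There are constants $\epsilon>0$ and $M>0$ such that, for every divergence-free (in the sense of distributions on $\mathbb R^2$) field $a\in\dot E^2_1$ with $\|a\|_{\dot E^2_1}<\epsilon$, there is a unique solution $u\in X^2_1$ with datum $a$ and $\|u\|_{X^2_1}\le\epsilon M$, and this solution has the following properties. (i) There is a constant $C$ such that, for all $t>0$ and all $x\in\mathbb R^2$ with $|x|\ge e\sqrt t$, $$\Bigl|u(x,t)-a(x)+\mathfrak F(x):\int_0^t\int_{\sqrt s\le|y|\le|x|}(a\otimes a)(y)\,dy\,ds\Bigr|\le C\,t\,|x|^{-3}.$$ (ii) If moreover $a$ is homogeneous of degree $-1$, then $u$ is self-similar, $u(x,t)=\frac1{\sqrt t}U\bigl(\frac x{\sqrt t}\bigr)$, and $$U(x)=a(x)-\log(|x|)\,\mathfrak F(x):\Bigl(\int_{\mathbb S^1}a\otimes a\Bigr)+\mathcal O(|x|^{-3})\qquad\text{as }|x|\to\infty.$$ -/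

import Mathlib

open MeasureTheory Set Filter Topology
open scoped ENNReal RealInnerProductSpace FourierTransform

namespace NSProfile

/-- The Euclidean plane. -/
abbrev Plane : Type := EuclideanSpace ℝ (Fin 2)

/-- The partial derivative `∂_{i 0} ⋯ ∂_{i (k-1)} f (x)`. As `i` runs over all tuples of length `k`,
these are all the derivatives `∂^α f (x)` with `|α| = k`. -/
noncomputable def partialDeriv {k : ℕ} (i : Fin k → Fin 2) (f : Plane → Plane) (x : Plane) :
    Plane :=
  iteratedFDeriv ℝ k f x (fun l => EuclideanSpace.single (i l) 1)

/-- The norm `max_{|α| ≤ m} sup_{x ≠ 0} |x|^{θ + |α|} |∂^α f (x)|` of the homogeneous space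
`Ė^m_θ`, as an extended nonnegative number. -/
noncomputable def eDotNorm (m : ℕ) (θ : ℝ) (f : Plane → Plane) : ℝ≥0∞ :=
  ⨆ (k : ℕ) (_ : k ≤ m) (i : Fin k → Fin 2) (x : Plane) (_ : x ≠ 0),
    ENNReal.ofReal (‖x‖ ^ (θ + (k : ℝ)) * ‖partialDeriv i f x‖)

/-- Membership in `Ė^m_θ`: `C^m` away from the origin, with finite norm. -/
def MemEDot (m : ℕ) (θ : ℝ) (f : Plane → Plane) : Prop :=
  ContDiffOn ℝ m f {x | x ≠ 0} ∧ eDotNorm m θ f < ⊤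

/-- Lebesgue measure on the space-time `(0, ∞) × ℝ²`. -/
noncomputable def spaceTime : Measure (ℝ × Plane) :=
  (volume : Measure (ℝ × Plane)).restrict (Ioi 0 ×ˢ univ)

/-- The norm `max_{|α| ≤ m} ess sup_{x, t} (√t + |x|)^{θ + |α|} |∂_x^α u (x, t)|` of `X^m_θ`. A
time-dependent vector field is written `u t x`, and only the times `t > 0` matter. -/
noncomputable def xNorm (m : ℕ) (θ : ℝ) (u : ℝ → Plane → Plane) : ℝ≥0∞ :=
  ⨆ (k : ℕ) (_ : k ≤ m) (i : Fin k → Fin 2),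
    essSup (fun p : ℝ × Plane =>
      ENNReal.ofReal ((√p.1 + ‖p.2‖) ^ (θ + (k : ℝ)) * ‖partialDeriv i (u p.1) p.2‖)) spaceTime

/-- Membership in `X^m_θ`: a measurable field, `C^m` in space at almost every time, with finite
norm. (Local integrability in time with values in `C^m` follows from the finiteness of the
norm.) -/
structure MemX (m : ℕ) (θ : ℝ) (u : ℝ → Plane → Plane) : Prop where
  aestronglyMeasurable : AEStronglyMeasurable (fun p : ℝ × Plane => u p.1 p.2) spaceTime
  contDiff : ∀ᵐ t ∂(volume.restrict (Ioi (0 : ℝ))), ContDiff ℝ m (u t)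
  norm_lt_top : xNorm m θ u < ⊤

/-- The divergence of `a` vanishes in the sense of distributions on the whole plane. -/
def IsDivFree (a : Plane → Plane) : Prop :=
  ∀ φ : Plane → ℝ, ContDiff ℝ (⊤ : ℕ∞) φ → HasCompactSupport φ → ∫ x, ⟪a x, gradient φ x⟫ = 0

/-- The heat kernel `g_t` of the plane. -/
noncomputable def heatKernel (t : ℝ) (x : Plane) : ℝ :=
  (4 * Real.pi * t)⁻¹ * Real.exp (-‖x‖ ^ 2 / (4 * t))

/-- The heat flow `e^{tΔ} a = g_t * a`. -/
noncomputable def heatFlow (t : ℝ) (a : Plane → Plane) (x : Plane) : Plane :=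
  ∫ y, heatKernel t (x - y) • a y

/-- The Fourier symbol of `e^{tΔ} ℙ div`, where `ℙ` is the Leray projector: it maps a field of
matrices `w` to the vector field with components `∑_{h,k} e^{tΔ} ℙ_{j,k} ∂_h w_{h,k}`. In Mathlib's
normalization `∂_h` has the symbol `2πi ξ_h` and `e^{tΔ}` has the symbol `exp (-4π² t |ξ|²)`. -/
noncomputable def oseenDivSymbol (j h k : Fin 2) (t : ℝ) (ξ : Plane) : ℂ :=
  (Real.exp (-(4 * Real.pi ^ 2 * t * ‖ξ‖ ^ 2)) : ℂ) *
    (((if j = k then (1 : ℝ) else 0) - ξ j * ξ k / ‖ξ‖ ^ 2 : ℝ) : ℂ) *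
    (2 * Real.pi * Complex.I * (ξ h : ℂ))

/-- The kernel `F_{j;h,k} (x, t)` of `e^{tΔ} ℙ div`: the inverse Fourier transform of the symbol
(this inverse transform is real-valued). -/
noncomputable def oseenDivKernel (j h k : Fin 2) (x : Plane) (t : ℝ) : ℝ :=
  (𝓕⁻ (oseenDivSymbol j h k t) x).re

/-- The bilinear Navier-Stokes operator
`B(u,v)(x,t) = ∫_0^t ∫ F(x-y,t-s) : (u ⊗ v)(y,s) dy ds = ∫_0^t e^{(t-s)Δ} ℙ ∇⋅(u ⊗ v)(s) ds`. -/
noncomputable def nsBilinear (u v : ℝ → Plane → Plane) (t : ℝ) (x : Plane) : Plane :=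
  WithLp.toLp 2 fun j => ∫ s in (0 : ℝ)..t, ∫ y : Plane,
    ∑ h : Fin 2, ∑ k : Fin 2, oseenDivKernel j h k (x - y) (t - s) * (u s y h * v s y k)

/-- `u` solves the Navier-Stokes equations in integral form, `u(t) = e^{tΔ} a - B(u,u)(t)` for
all `t > 0`, and starts from `a`: `u(t) → a` as tempered distributions as `t → 0`. -/
structure IsNSSolution (a : Plane → Plane) (u : ℝ → Plane → Plane) : Prop where
  mild : ∀ t : ℝ, 0 < t → ∀ x : Plane, u t x = heatFlow t a x - nsBilinear u u t x
  initial : ∀ φ : SchwartzMap Plane ℝ,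
    Tendsto (fun t : ℝ => ∫ x, φ x • u t x) (𝓝[>] 0) (𝓝 (∫ x, φ x • a x))

/-- The homogeneous tensor `𝔽_{j;h,k} (x) = π⁻¹ (σ_{j,h,k}(x) |x|² - 4 x_j x_h x_k) / |x|⁶`, with
`σ_{j,h,k}(x) = δ_{j,h} x_k + δ_{h,k} x_j + δ_{k,j} x_h`. -/
noncomputable def profileTensor (x : Plane) (j h k : Fin 2) : ℝ :=
  Real.pi⁻¹ *
    ((((if j = h then x k else 0) + (if h = k then x j else 0) + (if k = j then x h else 0)) *
      ‖x‖ ^ 2 - 4 * x j * x h * x k) / ‖x‖ ^ 6)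

/-- The contraction `𝔽(x) : B`, the vector with components `∑_{h,k} 𝔽_{j;h,k} (x) B_{h,k}`. -/
noncomputable def profileContract (x : Plane) (B : Matrix (Fin 2) (Fin 2) ℝ) : Plane :=
  WithLp.toLp 2 fun j => ∑ h : Fin 2, ∑ k : Fin 2, profileTensor x j h k * B h k

/-- The matrix `∫_0^t ∫_{√s ≤ |y| ≤ r} (a ⊗ a)(y) dy ds`. -/
noncomputable def annulusMatrix (a : Plane → Plane) (t r : ℝ) : Matrix (Fin 2) (Fin 2) ℝ :=
  Matrix.of fun h k =>
    ∫ s in (0 : ℝ)..t, ∫ y in {y : Plane | √s ≤ ‖y‖ ∧ ‖y‖ ≤ r}, a y h * a y k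

/-- The matrix `∫_{S¹} a ⊗ a`, with respect to arc length. -/
noncomputable def circleMatrix (a : Plane → Plane) : Matrix (Fin 2) (Fin 2) ℝ :=
  Matrix.of fun h k =>
    ∫ z : Metric.sphere (0 : Plane) 1, a z h * a z k ∂((volume : Measure Plane).toSphere)

/-- `a` is homogeneous of degree `-1` away from the origin. -/
def IsHomogeneousNegOne (a : Plane → Plane) : Prop :=
  ∀ r : ℝ, 0 < r → ∀ x : Plane, x ≠ 0 → a (r • x) = r⁻¹ • a x

end NSProfile

open NSProfile

/-!
The kernel of `e^{tΔ} ℙ ∇⋅` is given through its Fourier symbol. Since `|ξ|^{-2} e^{-c t |ξ|²}` is an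
integral of `e^{-c s |ξ|²}` over `s > t`, Fubini's theorem (`oseenDivKernel_eq`) identifies the kernel
with `δ_{j,k} ∂_h g_t + ∫_t^∞ ∂_j ∂_h ∂_k g_s ds`. This formula shows at once that the kernel and its
derivatives of order `k ≤ 2` are bounded by `(√t + |x|)^{-3-k}` (`exists_isXField_oseenKernel`), and,
because `∫_0^∞ ∂_j ∂_h ∂_k g_s ds` is exactly `𝔽_{j;h,k}` (`integral_Ioi_zero_heatThird`), that it
differs from `𝔽` by `O(t |x|^{-5})` (`exists_abs_oseenKernel_sub_profileTensor_le`).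

*Existence and uniqueness.* The heat flow maps `Ė^2_1` to `X^2_1` (`exists_isXField_heatField`), and
the Duhamel operator maps sources of degree `2` to fields of degree `1`, both with two derivatives
(`exists_isXField_duhamel`): the source is cut off at the scale `√t + |x|`, and the derivatives fall
on the kernel in the part near the origin and on the source in the other part. Hence the bilinear
operator is bounded on `X^2_1`, and successive approximations converge for small data
(`exists_mild_solution`). Uniqueness is a contraction in the norm `sup (√t + |x|) |u|` alone
(`exists_mild_unique`).

*The profile.* Taylor's formula and the symmetry of `g_t` give `e^{tΔ} a - a = O(t |x|^{-3})`
(`exists_norm_heatFlow_sub_le`). For the Duhamel integral the plane is divided into three zones: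

* near the origin the kernel is replaced by the constant `𝔽(x)`, and the error is controlled by the
  first moments of the source;
* near `x` the source is replaced by its Taylor polynomial at `x`. The constant term integrates to
  zero since the kernel is odd. For the linear term the first moments of the kernel over balls have
  to be bounded (`exists_abs_moment_le`), although those of its absolute value diverge
  logarithmically as `t → 0`. They are, because `z_l 𝔽(z)` only has angular modes of order two and
  four and therefore has mean zero on circles, as an average over the rotations by multiples of
  `π/4` shows;
* elsewhere the sizes of kernel and source suffice.

What remains is `𝔽(x)` times the integral of `u ⊗ u` over a ball of radius comparable to `|x|`.
Replacing it with the integral of `a ⊗ a` over `√s ≤ |y| ≤ |x|` costs `O(1)` at each time `s`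
(`abs_setIntegral_tensorEntry_sub_le`), as `u - a = O(√s |y|^{-2})` on `√s ≤ |y|`, hence
`O(t |x|^{-3})` in all.

*Homogeneous data.* If `a` is homogeneous of degree `-1`, the rescaled fields `c u(c² t, c x)` solve
the same equation with the same bound, so that `u` is self-similar by uniqueness
(`exists_rescale_eq`). In polar coordinates the matrix of the profile at time `1` is
`(log |x| + 1/2) ∫_{S¹} a ⊗ a` (`annulusMatrix_of_homogeneous`), and the term with `1/2` is absorbed
by the remainder `O(|x|^{-3})`.
-/

namespace NSProfile

/-! ### Differentiation of parameter-dependent integrals -/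

/-- The derivative of a family of differentiable functions is measurable in the parameter, being a
limit of difference quotients. -/
theorem aestronglyMeasurable_fderiv_param {α F : Type*} [MeasurableSpace α] {μ : Measure α}
    [NormedAddCommGroup F] [NormedSpace ℝ F] {h : α → Plane → F} (x : Plane)
    (hm : ∀ x, AEStronglyMeasurable (fun p => h p x) μ)
    (hd : ∀ᵐ p ∂μ, DifferentiableAt ℝ (h p) x) :
    AEStronglyMeasurable (fun p => fderiv ℝ (h p) x) μ := by
  have key : ∀ v : Plane, AEStronglyMeasurable (fun p => fderiv ℝ (h p) x v) μ := by
    intro v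
    refine aestronglyMeasurable_of_tendsto_ae (u := atTop)
      (f := fun (n : ℕ) p => (n : ℝ) • (h p (x + (n : ℝ)⁻¹ • v) - h p x)) ?_ ?_
    · intro n
      exact ((hm _).sub (hm _)).const_smul _
    · filter_upwards [hd] with p hp
      exact (hp.hasFDerivAt.lim_real v).comp tendsto_natCast_atTop_atTop
  have h2 : (fun p => fderiv ℝ (h p) x) = fun p => ∑ i : Fin 2,
      ((EuclideanSpace.proj i : Plane →L[ℝ] ℝ).smulRightL ℝ Plane F
        (fderiv ℝ (h p) x (EuclideanSpace.single i 1))) := by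
    funext p
    ext v
    have hv : v = ∑ i : Fin 2, v i • EuclideanSpace.single i (1 : ℝ) := by
      ext j
      fin_cases j <;> simp
    conv_lhs => rw [hv]
    simp
  rw [h2]
  refine Finset.aestronglyMeasurable_fun_sum _ fun i _ => ?_
  exact ((EuclideanSpace.proj i : Plane →L[ℝ] ℝ).smulRightL ℝ Plane F).continuous
    |>.comp_aestronglyMeasurable (key _)

/-- Differentiation under the integral sign, up to any finite order: if the derivatives of order
`k ≤ n` of the integrand are dominated on an open set by integrable functions `b k` of the
parameter, the integral is of class `C^n` there and its derivatives are bounded by `∫ b k`. The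
induction on `n` passes from values in `F` to values in `Plane →L[ℝ] F`, so `F` is quantified inside
the statement. -/
theorem contDiffOn_integral_of_dominated {α : Type*} [MeasurableSpace α] {μ : Measure α}
    {U : Set Plane} (hU : IsOpen U) (n : ℕ) :
    ∀ {F : Type} [NormedAddCommGroup F] [NormedSpace ℝ F] {h : α → Plane → F}
      {b : ℕ → α → ℝ}
      (_ : ∀ x, AEStronglyMeasurable (fun p => h p x) μ)
      (_ : ∀ᵐ p ∂μ, ContDiff ℝ n (h p))
      (_ : ∀ k ≤ n, Integrable (b k) μ)
      (_ : ∀ᵐ p ∂μ, ∀ k ≤ n, ∀ x ∈ U, ‖iteratedFDeriv ℝ k (h p) x‖ ≤ b k p),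
      ContDiffOn ℝ n (fun x => ∫ p, h p x ∂μ) U ∧
        ∀ k ≤ n, ∀ x ∈ U, ‖iteratedFDeriv ℝ k (fun x => ∫ p, h p x ∂μ) x‖ ≤ ∫ p, b k p ∂μ := by
  have zero : ∀ {F : Type} [NormedAddCommGroup F] [NormedSpace ℝ F] {h : α → Plane → F}
      {b : ℕ → α → ℝ} (_ : Integrable (b 0) μ)
      (_ : ∀ᵐ p ∂μ, ∀ x ∈ U, ‖iteratedFDeriv ℝ 0 (h p) x‖ ≤ b 0 p),
      ∀ x ∈ U, ‖iteratedFDeriv ℝ 0 (fun x => ∫ p, h p x ∂μ) x‖ ≤ ∫ p, b 0 p ∂μ := by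
    intro F _ _ h b hb hbound x hx
    rw [norm_iteratedFDeriv_zero]
    refine norm_integral_le_of_norm_le hb ?_
    filter_upwards [hbound] with p hp
    simpa using hp x hx
  induction n with
  | zero =>
    intro F _ _ h b hm hc hb hbound
    refine ⟨?_, ?_⟩
    · have : ContinuousOn (fun x => ∫ p, h p x ∂μ) U := by
        refine continuousOn_of_dominated (bound := b 0) (fun x _ => hm x) ?_ (hb 0 le_rfl) ?_
        · intro x hx
          filter_upwards [hbound] with p hp
          simpa using hp 0 le_rfl x hx
        · filter_upwards [hc] with p hp
          exact hp.continuous.continuousOn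
      simpa [contDiffOn_zero] using this
    · intro k hk
      obtain rfl : k = 0 := by omega
      exact zero (hb 0 le_rfl) (hbound.mono fun p hp => hp 0 le_rfl)
  | succ n ih =>
    intro F _ _ h b hm hc hb hbound
    have hd : ∀ᵐ p ∂μ, Differentiable ℝ (h p) := by
      filter_upwards [hc] with p hp
      exact hp.differentiable (by simp)
    have hm' : ∀ x, AEStronglyMeasurable (fun p => fderiv ℝ (h p) x) μ := fun x =>
      aestronglyMeasurable_fderiv_param x hm (hd.mono fun p hp => hp x)
    obtain ⟨ih1, ih2⟩ := ih (h := fun p => fderiv ℝ (h p)) (b := fun k => b (k + 1)) hm'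
      (hc.mono fun p hp => hp.fderiv_right (by norm_cast))
      (fun k hk => hb (k + 1) (by omega))
      (by
        filter_upwards [hbound] with p hp k hk x hx
        rw [norm_iteratedFDeriv_fderiv]
        exact hp (k + 1) (by omega) x hx)
    have hF : ∀ x ∈ U, HasFDerivAt (fun x => ∫ p, h p x ∂μ) (∫ p, fderiv ℝ (h p) x ∂μ) x := by
      intro x hx
      refine hasFDerivAt_integral_of_dominated_of_fderiv_le (F' := fun x p => fderiv ℝ (h p) x)
        (bound := b 1) (hU.mem_nhds hx)
        (Eventually.of_forall hm) ?_ (hm' x) ?_ (hb 1 (by omega)) ?_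
      · refine (hb 0 (by omega)).mono' (hm x) ?_
        filter_upwards [hbound] with p hp
        simpa using hp 0 (by omega) x hx
      · filter_upwards [hbound] with p hp y hy
        have := hp 1 (by omega) y hy
        rwa [← norm_iteratedFDeriv_fderiv, norm_iteratedFDeriv_zero] at this
      · filter_upwards [hd] with p hp y _
        exact (hp y).hasFDerivAt
    have hfd : ∀ x ∈ U, fderiv ℝ (fun x => ∫ p, h p x ∂μ) x = ∫ p, fderiv ℝ (h p) x ∂μ :=
      fun x hx => (hF x hx).fderiv
    refine ⟨?_, ?_⟩
    · have := (contDiffOn_succ_iff_fderiv_of_isOpen (𝕜 := ℝ) (n := n)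
        (f := fun x => ∫ p, h p x ∂μ) hU).2 ⟨fun x hx =>
          (hF x hx).differentiableAt.differentiableWithinAt, by simp, ih1.congr hfd⟩
      exact_mod_cast this
    · intro k hk x hx
      rcases k with _ | k
      · exact zero (hb 0 (by omega)) (hbound.mono fun p hp => hp 0 (by omega)) x hx
      · rw [← norm_iteratedFDeriv_fderiv]
        have : fderiv ℝ (fun x => ∫ p, h p x ∂μ) =ᶠ[𝓝 x] fun x => ∫ p, fderiv ℝ (h p) x ∂μ := by
          filter_upwards [hU.mem_nhds hx] with y hy using hfd y hy
        rw [(this.iteratedFDeriv ℝ k).eq_of_nhds]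
        exact ih2 k (by omega) x hx


/-! ### The heat kernel and its derivatives -/

/-- The coordinate vectors of the plane. -/
noncomputable abbrev basisVec (i : Fin 2) : Plane := EuclideanSpace.single i 1

theorem norm_basisVec (i : Fin 2) : ‖basisVec i‖ = 1 := by simp [basisVec]

theorem heatKernel_eq_smul_exp (s : ℝ) :
    heatKernel s = fun x => (4 * Real.pi * s)⁻¹ • (Real.exp ∘ fun x => -(4 * s)⁻¹ * ‖x‖ ^ 2) x := by
  funext x
  simp only [heatKernel, smul_eq_mul, Function.comp]
  congr 2
  ring

theorem contDiff_heatKernel (s : ℝ) (n : WithTop ℕ∞) : ContDiff ℝ n (heatKernel s) := by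
  rw [heatKernel_eq_smul_exp]
  exact (Real.contDiff_exp.comp (contDiff_const.mul (contDiff_norm_sq ℝ))).const_smul _

theorem hasFDerivAt_const_mul_norm_sq (c : ℝ) (x : Plane) :
    HasFDerivAt (fun x : Plane => c * ‖x‖ ^ 2) (((2 * c) • innerSL ℝ) x) x := by
  have := (hasStrictFDerivAt_norm_sq x).hasFDerivAt.const_mul c
  refine this.congr_fderiv ?_
  ext v
  simp
  ring

theorem norm_iteratedFDeriv_const_mul_norm_sq_le {s : ℝ} (hs : 0 < s) (x : Plane) (i : ℕ)
    (hi : 1 ≤ i) :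
    ‖iteratedFDeriv ℝ i (fun x : Plane => -(4 * s)⁻¹ * ‖x‖ ^ 2) x‖ ≤ ((√s + ‖x‖) / s) ^ i := by
  have hsq : 0 < √s := Real.sqrt_pos.2 hs
  have hss : √s * √s = s := Real.mul_self_sqrt hs.le
  have h1 : fderiv ℝ (fun x : Plane => -(4 * s)⁻¹ * ‖x‖ ^ 2)
      = ⇑((2 * (-(4 * s)⁻¹)) • innerSL ℝ : Plane →L[ℝ] Plane →L[ℝ] ℝ) :=
    funext fun x => (hasFDerivAt_const_mul_norm_sq _ x).fderiv
  have hc : |2 * (-(4 * s)⁻¹)| ≤ 1 / s := by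
    rw [abs_mul, abs_neg, abs_of_pos (by positivity : (0 : ℝ) < (4 * s)⁻¹),
      abs_of_pos (by norm_num : (0 : ℝ) < 2)]
    rw [mul_inv, one_div]
    have : 0 < s⁻¹ := by positivity
    linarith
  obtain ⟨i, rfl⟩ : ∃ j, i = j + 1 := ⟨i - 1, by omega⟩
  rw [← norm_iteratedFDeriv_fderiv, h1]
  rcases i with _ | i
  · rw [norm_iteratedFDeriv_zero, _root_.smul_apply, norm_smul, Real.norm_eq_abs,
      innerSL_apply_norm, zero_add, pow_one]
    calc _ ≤ 1 / s * ‖x‖ := by gcongr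
      _ ≤ _ := by
        rw [div_mul_eq_mul_div, one_mul]
        gcongr
        linarith
  · rw [← norm_iteratedFDeriv_fderiv]
    have h2 : fderiv ℝ ⇑((2 * (-(4 * s)⁻¹)) • innerSL ℝ : Plane →L[ℝ] Plane →L[ℝ] ℝ)
      = fun _ => ((2 * (-(4 * s)⁻¹)) • innerSL ℝ : Plane →L[ℝ] Plane →L[ℝ] ℝ) := by
      funext x
      exact ContinuousLinearMap.fderiv _
    rw [h2]
    rcases i with _ | i
    · rw [norm_iteratedFDeriv_zero]
      have hT : ‖((2 * (-(4 * s)⁻¹)) • innerSL ℝ : Plane →L[ℝ] Plane →L[ℝ] ℝ)‖ ≤ 1 / s := by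
        refine ContinuousLinearMap.opNorm_le_bound _ (by positivity) fun v => ?_
        rw [_root_.smul_apply, norm_smul, Real.norm_eq_abs, innerSL_apply_norm]
        gcongr
      calc _ ≤ 1 / s * 1 := by rw [mul_one]; exact hT
        _ ≤ _ := by
          rw [div_pow, mul_one]
          rw [div_le_div_iff₀ hs (by positivity)]
          have : s ≤ (√s + ‖x‖) ^ 2 := by nlinarith [norm_nonneg x]
          simp only [zero_add, Nat.reduceAdd]
          nlinarith
    · rw [iteratedFDeriv_succ_const]
      simp only [Pi.zero_apply, norm_zero]
      positivity

theorem one_add_pow_mul_exp_neg_le (M : ℕ) {y : ℝ} (hy : 0 ≤ y) :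
    (1 + y) ^ M * Real.exp (-y) ≤ M.factorial * Real.exp 1 := by
  have h := Real.pow_div_factorial_le_exp (1 + y) (by linarith) M
  rw [div_le_iff₀ (by positivity)] at h
  calc (1 + y) ^ M * Real.exp (-y) ≤ Real.exp (1 + y) * M.factorial * Real.exp (-y) := by gcongr
    _ = M.factorial * (Real.exp (1 + y) * Real.exp (-y)) := by ring
    _ = _ := by rw [← Real.exp_add]; congr 2; ring

/-- The derivatives of the heat kernel, with a gain of two powers over the parabolic scaling. -/
theorem exists_norm_iteratedFDeriv_heatKernel_le (m : ℕ) : ∃ C > 0, ∀ s : ℝ, 0 < s → ∀ x : Plane,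
    ‖iteratedFDeriv ℝ m (heatKernel s) x‖ ≤ C * s / (√s + ‖x‖) ^ (4 + m) := by
  refine ⟨m.factorial * (8 ^ (m + 2) * ((m + 2).factorial * Real.exp 1)), by positivity, ?_⟩
  intro s hs x
  have hsq : 0 < √s := Real.sqrt_pos.2 hs
  have hss : √s ^ 2 = s := Real.sq_sqrt hs.le
  set R := √s + ‖x‖ with hR
  have hRpos : 0 < R := by positivity
  set y := (4 * s)⁻¹ * ‖x‖ ^ 2 with hy
  have hynn : 0 ≤ y := by positivity
  have hyx : ‖x‖ ^ 2 = 4 * s * y := by rw [hy]; field_simp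
  have hR2 : R ^ 2 ≤ 8 * s * (1 + y) := by
    have : R ^ 2 ≤ 2 * (√s ^ 2 + ‖x‖ ^ 2) := by rw [hR]; nlinarith [sq_nonneg (√s - ‖x‖)]
    nlinarith
  have hcomp : ‖iteratedFDeriv ℝ m (Real.exp ∘ fun x : Plane => -(4 * s)⁻¹ * ‖x‖ ^ 2) x‖
      ≤ m.factorial * Real.exp (-y) * (R / s) ^ m := by
    refine norm_iteratedFDeriv_comp_le (N := m) Real.contDiff_exp
      (contDiff_const.mul (contDiff_norm_sq ℝ)) le_rfl x ?_ ?_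
    · intro i _
      rw [norm_iteratedFDeriv_eq_norm_iteratedDeriv, iteratedDeriv_eq_iterate, Real.iter_deriv_exp,
        Real.norm_eq_abs, abs_of_pos (Real.exp_pos _), hy, neg_mul]
    · intro i hi _
      exact norm_iteratedFDeriv_const_mul_norm_sq_le hs x i hi
  have hpi : (4 * Real.pi * s)⁻¹ ≤ s⁻¹ := by
    apply inv_anti₀ hs
    nlinarith [Real.pi_gt_three]
  rw [heatKernel_eq_smul_exp, iteratedFDeriv_const_smul_apply', norm_smul, Real.norm_eq_abs,
    abs_of_pos (by positivity)]
  · calc _ ≤ s⁻¹ * (m.factorial * Real.exp (-y) * (R / s) ^ m) := by gcongr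
      _ = m.factorial * ((R ^ 2 / s) ^ (m + 2) * Real.exp (-y)) * s / R ^ (4 + m) := by
        have e : R ^ (4 + m) ≠ 0 := by positivity
        rw [div_pow, div_pow, eq_div_iff e]
        field_simp
        ring_nf
      _ ≤ m.factorial * ((8 * (1 + y)) ^ (m + 2) * Real.exp (-y)) * s / R ^ (4 + m) := by
        have : R ^ 2 / s ≤ 8 * (1 + y) := by
          rw [div_le_iff₀ hs]; linarith
        gcongr
      _ = m.factorial * (8 ^ (m + 2) * ((1 + y) ^ (m + 2) * Real.exp (-y))) * s / R ^ (4 + m) := by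
        rw [mul_pow]; ring
      _ ≤ _ := by
        have := one_add_pow_mul_exp_neg_le (m + 2) hynn
        gcongr ?_ * (?_ * ?_) * _ / _
  · exact (Real.contDiff_exp.comp (contDiff_const.mul (contDiff_norm_sq ℝ))).contDiffAt

/-- The directional derivative `∂_v f`. -/
noncomputable def dirDeriv (v : Plane) (f : Plane → ℝ) (x : Plane) : ℝ := fderiv ℝ f x v

theorem contDiff_dirDeriv {f : Plane → ℝ} (hf : ∀ n : ℕ, ContDiff ℝ n f) (v : Plane) (n : ℕ) :
    ContDiff ℝ n (dirDeriv v f) :=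
  ((hf (n + 1)).fderiv_right (by norm_cast)).clm_apply contDiff_const

theorem norm_iteratedFDeriv_dirDeriv_le {f : Plane → ℝ} (hf : ∀ n : ℕ, ContDiff ℝ n f) (i : Fin 2)
    (m : ℕ) (x : Plane) :
    ‖iteratedFDeriv ℝ m (dirDeriv (basisVec i) f) x‖ ≤ ‖iteratedFDeriv ℝ (m + 1) f x‖ := by
  have := norm_iteratedFDeriv_clm_apply_const (𝕜 := ℝ) (f := fderiv ℝ f) (c := basisVec i) (x := x)
    (N := m) (n := m) ((hf (m + 1)).fderiv_right (by norm_cast)).contDiffAt le_rfl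
  rwa [norm_basisVec, one_mul, norm_iteratedFDeriv_fderiv] at this

theorem hasFDerivAt_heatKernel (s : ℝ) (x : Plane) :
    HasFDerivAt (heatKernel s) ((-(2 * s)⁻¹ * heatKernel s x) • innerSL ℝ x) x := by
  have h := ((hasFDerivAt_const_mul_norm_sq (-(4 * s)⁻¹) x).exp).const_mul ((4 * Real.pi * s)⁻¹)
  have e : heatKernel s = fun x => (4 * Real.pi * s)⁻¹ * Real.exp (-(4 * s)⁻¹ * ‖x‖ ^ 2) :=
    heatKernel_eq_smul_exp s
  rw [e]
  refine h.congr_fderiv ?_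
  ext v
  simp only [_root_.smul_apply, innerSL_apply_apply, smul_eq_mul]
  rw [mul_inv, mul_inv]
  ring

theorem dirDeriv_heatKernel (s : ℝ) (h : Fin 2) :
    dirDeriv (basisVec h) (heatKernel s) = fun x => -(2 * s)⁻¹ * x h * heatKernel s x := by
  funext x
  rw [dirDeriv, (hasFDerivAt_heatKernel s x).fderiv]
  simp [basisVec, EuclideanSpace.inner_single_right]
  ring

/-- The third derivatives `∂_j ∂_h ∂_k g_s` of the heat kernel, in closed form. -/
noncomputable def heatThird (j h k : Fin 2) (s : ℝ) (x : Plane) : ℝ :=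
  (((if j = h then x k else 0) + (if h = k then x j else 0) + (if k = j then x h else 0)) *
    (4 * s ^ 2)⁻¹ - x j * x h * x k * (8 * s ^ 3)⁻¹) * heatKernel s x

theorem dirDeriv_eq_of_hasFDerivAt {f : Plane → ℝ} {f' : Plane →L[ℝ] ℝ} {v x : Plane}
    (h : HasFDerivAt f f' x) : dirDeriv v f x = f' v := by rw [dirDeriv, h.fderiv]

theorem hasFDerivAt_coord (i : Fin 2) (x : Plane) :
    HasFDerivAt (fun x : Plane => x i) (EuclideanSpace.proj i : Plane →L[ℝ] ℝ) x :=
  (EuclideanSpace.proj i : Plane →L[ℝ] ℝ).hasFDerivAt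

theorem heatThird_eq_dirDeriv (j h k : Fin 2) {s : ℝ} (hs : 0 < s) :
    heatThird j h k s =
      dirDeriv (basisVec j) (dirDeriv (basisVec h) (dirDeriv (basisVec k) (heatKernel s))) := by
  have h2 : dirDeriv (basisVec h) (dirDeriv (basisVec k) (heatKernel s)) = fun x =>
      (-(2 * s)⁻¹ * (if h = k then 1 else 0) + (4 * s ^ 2)⁻¹ * (x h * x k)) * heatKernel s x := by
    rw [dirDeriv_heatKernel]
    funext x
    rw [dirDeriv_eq_of_hasFDerivAt
      (((hasFDerivAt_coord k x).const_mul (-(2 * s)⁻¹)).fun_mul (hasFDerivAt_heatKernel s x))]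
    fin_cases h <;> fin_cases k <;> simp [EuclideanSpace.inner_single_right] <;> field_simp <;> ring_nf
  rw [h2]
  funext x
  rw [dirDeriv_eq_of_hasFDerivAt ((((hasFDerivAt_coord h x).fun_mul
    (hasFDerivAt_coord k x)).const_mul _ |>.const_add _).fun_mul (hasFDerivAt_heatKernel s x))]
  fin_cases j <;> fin_cases h <;> fin_cases k <;>
    simp [EuclideanSpace.inner_single_right, heatThird] <;> field_simp <;> ring_nf

theorem heatThird_neg (j h k : Fin 2) (s : ℝ) (x : Plane) :
    heatThird j h k s (-x) = -heatThird j h k s x := by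
  simp only [heatThird, heatKernel, norm_neg, PiLp.neg_apply]
  split_ifs <;> ring

theorem contDiff_heatThird (j h k : Fin 2) {s : ℝ} (hs : 0 < s) (n : ℕ) :
    ContDiff ℝ n (heatThird j h k s) := by
  rw [heatThird_eq_dirDeriv j h k hs]
  exact contDiff_dirDeriv (contDiff_dirDeriv (contDiff_dirDeriv
    (fun n => contDiff_heatKernel s n) _) _) _ _

theorem exists_norm_iteratedFDeriv_heatThird_le (m : ℕ) : ∃ C > 0, ∀ (j h k : Fin 2) (s : ℝ),
    0 < s → ∀ x : Plane,
    ‖iteratedFDeriv ℝ m (heatThird j h k s) x‖ ≤ C / (√s + ‖x‖) ^ (5 + m) := by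
  obtain ⟨C, hC, hb⟩ := exists_norm_iteratedFDeriv_heatKernel_le (m + 3)
  refine ⟨C, hC, fun j h k s hs x => ?_⟩
  have hg := fun n : ℕ => contDiff_heatKernel s n
  have hsq : 0 < √s := Real.sqrt_pos.2 hs
  have hss : √s ^ 2 = s := Real.sq_sqrt hs.le
  rw [heatThird_eq_dirDeriv j h k hs]
  refine (norm_iteratedFDeriv_dirDeriv_le (contDiff_dirDeriv (contDiff_dirDeriv hg _) _)
    _ _ _).trans ?_
  refine (norm_iteratedFDeriv_dirDeriv_le (contDiff_dirDeriv hg _) _ _ _).trans ?_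
  refine (norm_iteratedFDeriv_dirDeriv_le hg _ _ _).trans ?_
  refine (hb s hs x).trans ?_
  have h1 : s ≤ (√s + ‖x‖) ^ 2 := by nlinarith [norm_nonneg x]
  rw [div_le_div_iff₀ (by positivity) (by positivity)]
  calc C * s * (√s + ‖x‖) ^ (5 + m) ≤ C * (√s + ‖x‖) ^ 2 * (√s + ‖x‖) ^ (5 + m) := by gcongr
    _ = _ := by ring


/-! ### The Oseen kernel -/

theorem hasDerivAt_sqrt_add_pow_neg (r : ℝ) (hr : 0 ≤ r) (n : ℕ) (hn : 1 ≤ n) {s : ℝ} (hs : 0 < s) :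
    HasDerivAt (fun s => -(2 / n) * ((√s + r) ^ n)⁻¹) (√s * (√s + r) ^ (n + 1))⁻¹ s := by
  have hsq : 0 < √s := Real.sqrt_pos.2 hs
  obtain ⟨m, rfl⟩ : ∃ m, n = m + 1 := ⟨n - 1, by omega⟩
  have h := ((((Real.hasDerivAt_sqrt hs.ne').add_const r).fun_pow (m + 1)).fun_inv
    (by positivity)).const_mul (-(2 / ((m + 1 : ℕ) : ℝ)))
  refine h.congr_deriv ?_
  have : ((m + 1 : ℕ) : ℝ) ≠ 0 := by positivity
  rw [Nat.add_sub_cancel]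
  field_simp
  try ring

theorem tendsto_sqrt_add_pow_neg (r : ℝ) (n : ℕ) (hn : 1 ≤ n) :
    Tendsto (fun s => -(2 / n) * ((√s + r) ^ n)⁻¹) atTop (𝓝 0) := by
  have : Tendsto (fun s => (√s + r) ^ n) atTop atTop :=
    (tendsto_pow_atTop (by omega)).comp (tendsto_atTop_add_const_right _ _ Real.tendsto_sqrt_atTop)
  simpa using this.inv_tendsto_atTop.const_mul (-(2 / (n : ℝ)))

theorem integrableOn_Ioi_inv_sqrt_mul_pow (r : ℝ) (hr : 0 ≤ r) (n : ℕ) (hn : 1 ≤ n) {t : ℝ}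
    (ht : 0 < t) : IntegrableOn (fun s => (√s * (√s + r) ^ (n + 1))⁻¹) (Ioi t) :=
  integrableOn_Ioi_deriv_of_nonneg' (fun s hs => hasDerivAt_sqrt_add_pow_neg r hr n hn
    (ht.trans_le hs)) (fun s _ => by positivity) (tendsto_sqrt_add_pow_neg r n hn)

theorem integral_Ioi_inv_sqrt_mul_pow (r : ℝ) (hr : 0 ≤ r) (n : ℕ) (hn : 1 ≤ n) {t : ℝ}
    (ht : 0 < t) : ∫ s in Ioi t, (√s * (√s + r) ^ (n + 1))⁻¹ = 2 / n * ((√t + r) ^ n)⁻¹ := by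
  rw [integral_Ioi_of_hasDerivAt_of_nonneg' (fun s hs => hasDerivAt_sqrt_add_pow_neg r hr n hn
    (ht.trans_le hs)) (fun s _ => by positivity) (tendsto_sqrt_add_pow_neg r n hn)]
  ring

/-- A space-time field with the size and smoothness of the space `X^2_θ`, everywhere: its spatial
derivatives of order `k ≤ 2` are bounded by `A (√t + |x|)^{-θ-k}` at all positive times. -/
structure IsXField {F : Type*} [NormedAddCommGroup F] [NormedSpace ℝ F] (θ : ℕ) (A : ℝ)
    (u : ℝ → Plane → F) : Prop where
  stronglyMeasurable : StronglyMeasurable (Function.uncurry u)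
  contDiff : ∀ t, 0 < t → ContDiff ℝ 2 (u t)
  bound : ∀ t, 0 < t → ∀ k ≤ 2, ∀ x, ‖iteratedFDeriv ℝ k (u t) x‖ ≤ A / (√t + ‖x‖) ^ (θ + k)

theorem IsXField.norm_le {F : Type*} [NormedAddCommGroup F] [NormedSpace ℝ F] {θ : ℕ} {A : ℝ}
    {u : ℝ → Plane → F} (hu : IsXField θ A u) {t : ℝ} (ht : 0 < t) (x : Plane) :
    ‖u t x‖ ≤ A / (√t + ‖x‖) ^ θ := by
  simpa using hu.bound t ht 0 (by omega) x

/-- The kernel of `e^{tΔ} ℙ div` in physical space: since `|ξ|^{-2} e^{-t|ξ|²}` is the integral of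
`e^{-s|ξ|²}` over `s > t`, the nonlocal part is the integral of the third derivatives of the heat
kernel over later times. -/
noncomputable def oseenKernel (j h k : Fin 2) (t : ℝ) (x : Plane) : ℝ :=
  (if j = k then dirDeriv (basisVec h) (heatKernel t) x else 0) +
    ∫ s in Ioi t, heatThird j h k s x

theorem measurable_heatKernel : Measurable (Function.uncurry heatKernel) := by
  unfold heatKernel Function.uncurry
  fun_prop

theorem measurable_coord (i : Fin 2) : Measurable (fun x : Plane => x i) :=
  (EuclideanSpace.proj i : Plane →L[ℝ] ℝ).continuous.measurable

theorem measurable_heatThird (j h k : Fin 2) : Measurable (Function.uncurry (heatThird j h k)) := by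
  have h1 := fun i : Fin 2 => (measurable_coord i).comp (measurable_snd : Measurable
    (Prod.snd : ℝ × Plane → Plane))
  have h2 : ∀ (i : Fin 2) (P : Prop) [Decidable P],
      Measurable fun p : ℝ × Plane => if P then p.2 i else 0 := by
    intro i P _
    split_ifs
    · exact h1 i
    · exact measurable_const
  have h3 := measurable_heatKernel
  have h4 : Measurable (fun p : ℝ × Plane => (4 * p.1 ^ 2)⁻¹) := by fun_prop
  have h5 : Measurable (fun p : ℝ × Plane => (8 * p.1 ^ 3)⁻¹) := by fun_prop
  exact ((((((h2 k _).add (h2 j _)).add (h2 h _)).mul h4).sub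
    ((((h1 j).mul (h1 h)).mul (h1 k)).mul h5)).mul h3)

theorem stronglyMeasurable_oseenKernel (j h k : Fin 2) :
    StronglyMeasurable (Function.uncurry (oseenKernel j h k)) := by
  have h1 : StronglyMeasurable fun p : ℝ × Plane => ∫ s in Ioi p.1, heatThird j h k s p.2 := by
    have : (fun p : ℝ × Plane => ∫ s in Ioi p.1, heatThird j h k s p.2) = fun p : ℝ × Plane =>
        ∫ s, {q : (ℝ × Plane) × ℝ | q.1.1 < q.2}.indicator
          (fun q => heatThird j h k q.2 q.1.2) (p, s) := by
      funext p
      rw [← integral_indicator measurableSet_Ioi]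
      rfl
    rw [this]
    refine StronglyMeasurable.integral_prod_right' (f := fun q : (ℝ × Plane) × ℝ =>
      {q : (ℝ × Plane) × ℝ | q.1.1 < q.2}.indicator (fun q => heatThird j h k q.2 q.1.2) q) ?_
    refine Measurable.stronglyMeasurable ?_
    refine Measurable.indicator ?_ (measurableSet_lt (by fun_prop) (by fun_prop))
    exact (measurable_heatThird j h k).comp (by fun_prop : Measurable fun q : (ℝ × Plane) × ℝ =>
      (q.2, q.1.2))
  have h2 : StronglyMeasurable fun p : ℝ × Plane =>
      if j = k then dirDeriv (basisVec h) (heatKernel p.1) p.2 else 0 := by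
    split_ifs
    · simp only [dirDeriv_heatKernel]
      exact ((((measurable_fst.const_mul 2).inv.neg).mul ((measurable_coord h).comp
        measurable_snd)).mul measurable_heatKernel).stronglyMeasurable
    · exact stronglyMeasurable_const
  exact h2.add h1

theorem exists_norm_iteratedFDeriv_dirDeriv_heatKernel_le (m : ℕ) : ∃ C > 0, ∀ (h : Fin 2) (s : ℝ),
    0 < s → ∀ x : Plane, ‖iteratedFDeriv ℝ m (dirDeriv (basisVec h) (heatKernel s)) x‖
      ≤ C * s / (√s + ‖x‖) ^ (5 + m) := by
  obtain ⟨C, hC, hb⟩ := exists_norm_iteratedFDeriv_heatKernel_le (m + 1)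
  refine ⟨C, hC, fun h s hs x => ?_⟩
  refine (norm_iteratedFDeriv_dirDeriv_le (fun n => contDiff_heatKernel s n) _ _ _).trans ?_
  exact (hb s hs x).trans (le_of_eq (by ring))

theorem le_sq_sqrt_add {s : ℝ} (hs : 0 < s) {r : ℝ} (hr : 0 ≤ r) : s ≤ (√s + r) ^ 2 := by
  have hss : √s ^ 2 = s := Real.sq_sqrt hs.le
  nlinarith [Real.sqrt_nonneg s]

/-- Constants depending on an order `m` can be replaced by a single one for all `m ≤ n`. -/
theorem exists_forall_le_of_forall_exists {P : ℕ → ℝ → Prop} (n : ℕ) (h : ∀ m, ∃ C > 0, P m C)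
    (mono : ∀ m C C', C ≤ C' → P m C → P m C') : ∃ C > 0, ∀ m ≤ n, P m C := by
  choose C hC hP using h
  refine ⟨∑ m ∈ Finset.range (n + 1), C m, Finset.sum_pos (fun m _ => hC m) (by simp), ?_⟩
  intro m hm
  refine mono m (C m) _ ?_ (hP m)
  exact Finset.single_le_sum (f := C) (fun i _ => (hC i).le) (by simp; omega)

/-- The Oseen kernel belongs to the scale-invariant class of degree `3`. -/
theorem exists_isXField_oseenKernel : ∃ C > 0, ∀ j h k, IsXField 3 C (oseenKernel j h k) := by
  obtain ⟨C₁, hC₁, hb₁⟩ := exists_forall_le_of_forall_exists 2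
    exists_norm_iteratedFDeriv_dirDeriv_heatKernel_le (by
      intro m C C' hCC h i s hs x
      exact (h i s hs x).trans (by gcongr))
  obtain ⟨C₂, hC₂, hb₂⟩ := exists_forall_le_of_forall_exists 2
    exists_norm_iteratedFDeriv_heatThird_le (by
      intro m C C' hCC h i j k s hs x
      exact (h i j k s hs x).trans (by gcongr))
  refine ⟨C₁ + C₂ * 2 ^ 7, by positivity, fun j h k => ?_⟩
  have main : ∀ t, 0 < t → ∀ x₀ : Plane, ∃ U ∈ 𝓝 x₀, IsOpen U ∧
      ContDiffOn ℝ 2 (fun x => ∫ s in Ioi t, heatThird j h k s x) U ∧ ∀ m ≤ 2, ∀ x ∈ U,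
      ‖iteratedFDeriv ℝ m (fun x => ∫ s in Ioi t, heatThird j h k s x) x‖
        ≤ C₂ * 2 ^ 7 / (√t + ‖x₀‖) ^ (3 + m) := by
    intro t ht x₀
    have hst : 0 < √t := Real.sqrt_pos.2 ht
    refine ⟨Metric.ball x₀ ((√t + ‖x₀‖) / 2), Metric.ball_mem_nhds _ (by positivity),
      Metric.isOpen_ball, ?_⟩
    have := contDiffOn_integral_of_dominated (μ := volume.restrict (Ioi t))
      (U := Metric.ball x₀ ((√t + ‖x₀‖) / 2)) Metric.isOpen_ball 2 (h := heatThird j h k)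
      (b := fun m s => C₂ * 2 ^ (5 + m) * (√s * (√s + ‖x₀‖) ^ (3 + m + 1))⁻¹)
      (fun x => ((measurable_heatThird j h k).comp
        (measurable_id.prodMk measurable_const)).aestronglyMeasurable)
      ((ae_restrict_iff' measurableSet_Ioi).2 (.of_forall fun s hs =>
        contDiff_heatThird j h k (ht.trans hs) 2))
      (fun m hm => (integrableOn_Ioi_inv_sqrt_mul_pow _ (norm_nonneg _) _ (by omega) ht).const_mul _)
      ((ae_restrict_iff' measurableSet_Ioi).2 (.of_forall fun s (hs : t < s) m hm x hx => ?_))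
    · refine ⟨this.1, fun m hm x hx => (this.2 m hm x hx).trans ?_⟩
      rw [integral_const_mul, integral_Ioi_inv_sqrt_mul_pow _ (norm_nonneg _) _ (by omega) ht]
      have e1 : (2 : ℝ) / ((3 + m : ℕ) : ℝ) ≤ 1 := by
        rw [div_le_one (by positivity)]; push_cast; linarith [(Nat.cast_nonneg m : (0 : ℝ) ≤ m)]
      have e2 : (2 : ℝ) ^ (5 + m) ≤ 2 ^ 7 := pow_le_pow_right₀ (by norm_num) (by omega)
      calc _ ≤ C₂ * 2 ^ 7 * (1 * ((√t + ‖x₀‖) ^ (3 + m))⁻¹) := by gcongr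
        _ = _ := by ring
    · have hs0 : 0 < s := ht.trans hs
      have hss : 0 < √s := Real.sqrt_pos.2 hs0
      refine (hb₂ m hm j h k s hs0 x).trans ?_
      have h1 : ‖x₀‖ ≤ ‖x‖ + (√t + ‖x₀‖) / 2 := by
        rw [Metric.mem_ball, dist_eq_norm] at hx
        have : ‖x₀‖ ≤ ‖x‖ + ‖x - x₀‖ := by
          rw [norm_sub_rev]; exact norm_le_norm_add_norm_sub' x₀ x
        linarith
      have h2 : √t ≤ √s := Real.sqrt_le_sqrt hs.le
      have h3 : (√s + ‖x₀‖) / 2 ≤ √s + ‖x‖ := by linarith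
      have h4 : √s * (√s + ‖x₀‖) ^ (3 + m + 1) ≤ (√s + ‖x₀‖) ^ (5 + m) := by
        calc _ ≤ (√s + ‖x₀‖) * (√s + ‖x₀‖) ^ (3 + m + 1) := by
              gcongr; linarith [norm_nonneg x₀]
          _ = _ := by ring
      calc C₂ / (√s + ‖x‖) ^ (5 + m) ≤ C₂ / ((√s + ‖x₀‖) / 2) ^ (5 + m) := by gcongr
        _ = C₂ * 2 ^ (5 + m) * ((√s + ‖x₀‖) ^ (5 + m))⁻¹ := by rw [div_pow]; field_simp
        _ ≤ _ := by gcongr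
  have hcd1 : ∀ t, ContDiff ℝ 2 (fun x => if j = k then dirDeriv (basisVec h) (heatKernel t) x
      else 0) := by
    intro t
    split_ifs
    · exact_mod_cast contDiff_dirDeriv (fun n => contDiff_heatKernel t n) _ 2
    · exact contDiff_const
  have hcd2 : ∀ t, 0 < t → ContDiff ℝ 2 (fun x => ∫ s in Ioi t, heatThird j h k s x) := by
    intro t ht
    rw [contDiff_iff_contDiffAt]
    intro x
    obtain ⟨U, hU, _, hc, _⟩ := main t ht x
    exact hc.contDiffAt hU
  refine ⟨stronglyMeasurable_oseenKernel j h k, fun t ht => (hcd1 t).add (hcd2 t ht), ?_⟩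
  intro t ht m hm x
  have hst : 0 < √t := Real.sqrt_pos.2 ht
  have hm' : (m : WithTop ℕ∞) ≤ 2 := by exact_mod_cast hm
  have e : oseenKernel j h k t = (fun x => if j = k then dirDeriv (basisVec h) (heatKernel t) x
      else 0) + fun x => ∫ s in Ioi t, heatThird j h k s x := rfl
  rw [e, iteratedFDeriv_add_apply (((hcd1 t).of_le hm').contDiffAt)
    (((hcd2 t ht).of_le hm').contDiffAt), add_div]
  refine (norm_add_le _ _).trans (add_le_add ?_ ?_)
  · split_ifs
    · refine (hb₁ m hm h t ht x).trans ?_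
      rw [div_le_div_iff₀ (by positivity) (by positivity)]
      calc _ ≤ C₁ * (√t + ‖x‖) ^ 2 * (√t + ‖x‖) ^ (3 + m) := by
            gcongr; exact le_sq_sqrt_add ht (norm_nonneg x)
        _ = _ := by ring
    · have : iteratedFDeriv ℝ m (fun _ : Plane => (0 : ℝ)) x = 0 := by
        simp
      rw [this, norm_zero]
      positivity
  · obtain ⟨U, hU, _, _, hb⟩ := main t ht x
    exact hb m hm x (mem_of_mem_nhds hU)

theorem oseenKernel_neg (j h k : Fin 2) (t : ℝ) (x : Plane) :
    oseenKernel j h k t (-x) = -oseenKernel j h k t x := by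
  simp only [oseenKernel, heatThird_neg, integral_neg, dirDeriv_heatKernel, PiLp.neg_apply,
    heatKernel, norm_neg]
  split_ifs <;> ring


/-! ### Radial integrals in the plane -/

theorem volume_real_ball_plane {R : ℝ} (hR : 0 ≤ R) :
    (volume : Measure Plane).real (Metric.ball 0 R) = R ^ 2 * Real.pi := by
  rw [Measure.real, EuclideanSpace.volume_ball_fin_two, ENNReal.toReal_mul, ENNReal.toReal_pow,
    ENNReal.toReal_ofReal hR]
  simp [Real.pi_nonneg]

theorem integral_fun_norm_plane (f : ℝ → ℝ) :
    ∫ x : Plane, f ‖x‖ = 2 * Real.pi * ∫ y in Ioi (0 : ℝ), y * f y := by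
  rw [integral_fun_norm_addHaar volume f, volume_real_ball_plane zero_le_one]
  simp
  ring

theorem integrable_fun_norm_plane (f : ℝ → ℝ) :
    Integrable (fun x : Plane => f ‖x‖) ↔ IntegrableOn (fun y => y * f y) (Ioi 0) := by
  rw [integrable_fun_norm_addHaar volume (f := f)]
  simp

theorem integrableOn_ball_norm_inv (R : ℝ) :
    IntegrableOn (fun y : Plane => ‖y‖⁻¹) (Metric.ball 0 R) := by
  rw [integrableOn_fun_norm_addHaar volume (f := fun r => r⁻¹)]
  have : IntegrableOn (fun _ : ℝ => (1 : ℝ)) (Ioo 0 R) := by simp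
  refine this.congr_fun ?_ measurableSet_Ioo
  intro y hy
  have : y ≠ 0 := hy.1.ne'
  simp [this]

theorem setIntegral_ball_norm_inv {R : ℝ} (hR : 0 ≤ R) :
    ∫ y : Plane in Metric.ball 0 R, ‖y‖⁻¹ = 2 * Real.pi * R := by
  rw [← integral_indicator measurableSet_ball]
  have : (Metric.ball (0 : Plane) R).indicator (fun y : Plane => ‖y‖⁻¹)
      = fun y => (Iio R).indicator (fun r => r⁻¹) ‖y‖ := by
    funext y
    simp [indicator]
  rw [this, integral_fun_norm_plane]
  congr 1
  have : ∫ y in Ioi (0 : ℝ), y * (Iio R).indicator (fun r => r⁻¹) y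
      = ∫ y in Ioi (0 : ℝ), (Iio R).indicator (fun _ => (1 : ℝ)) y := by
    refine setIntegral_congr_fun measurableSet_Ioi fun y (hy : 0 < y) => ?_
    by_cases h : y < R
    · simp [h, hy.ne']
    · simp [h]
  rw [this, setIntegral_indicator measurableSet_Iio, Ioi_inter_Iio]
  simp [hR]

theorem hasDerivAt_neg_pow_inv (n : ℕ) (hn : 1 ≤ n) {c r : ℝ} (hr : 0 < c + r) :
    HasDerivAt (fun r => -(1 / n) * ((c + r) ^ n)⁻¹) ((c + r) ^ (n + 1))⁻¹ r := by
  obtain ⟨m, rfl⟩ : ∃ m, n = m + 1 := ⟨n - 1, by omega⟩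
  have h := ((((hasDerivAt_id r).const_add c).fun_pow (m + 1)).fun_inv
    (pow_pos hr _).ne').const_mul (-(1 / ((m + 1 : ℕ) : ℝ)))
  refine h.congr_deriv ?_
  have : ((m + 1 : ℕ) : ℝ) ≠ 0 := by positivity
  have h2 : c + r ≠ 0 := hr.ne'
  rw [Nat.add_sub_cancel]
  simp only [id]
  field_simp
  ring

theorem tendsto_neg_pow_inv (n : ℕ) (hn : 1 ≤ n) (c : ℝ) :
    Tendsto (fun r => -(1 / n) * ((c + r) ^ n)⁻¹) atTop (𝓝 (0 : ℝ)) := by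
  have : Tendsto (fun r => (c + r) ^ n) atTop (atTop : Filter ℝ) :=
    (tendsto_pow_atTop (by omega)).comp (tendsto_atTop_add_const_left _ _ tendsto_id)
  simpa using this.inv_tendsto_atTop.const_mul (-(1 / (n : ℝ)))

theorem integrableOn_Ioi_add_pow_inv (n : ℕ) (hn : 1 ≤ n) {c a : ℝ} (h : 0 < c + a) :
    IntegrableOn (fun r => ((c + r) ^ (n + 1))⁻¹) (Ioi a) :=
  integrableOn_Ioi_deriv_of_nonneg' (fun r hr => hasDerivAt_neg_pow_inv n hn
    (by have : a ≤ r := hr; linarith)) (fun r hr => by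
      have : a < r := hr
      have : 0 < c + r := by linarith
      positivity) (tendsto_neg_pow_inv n hn c)

theorem integral_Ioi_add_pow_inv (n : ℕ) (hn : 1 ≤ n) {c a : ℝ} (h : 0 < c + a) :
    ∫ r in Ioi a, ((c + r) ^ (n + 1))⁻¹ = 1 / n * ((c + a) ^ n)⁻¹ := by
  rw [integral_Ioi_of_hasDerivAt_of_nonneg' (fun r hr => hasDerivAt_neg_pow_inv n hn
    (by have : a ≤ r := hr; linarith)) (fun r hr => by
      have : a < r := hr
      have : 0 < c + r := by linarith
      positivity) (tendsto_neg_pow_inv n hn c)]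
  ring

theorem integrable_add_norm_pow_inv (n : ℕ) (hn : 1 ≤ n) {c : ℝ} (hc : 0 < c) :
    Integrable (fun y : Plane => ((c + ‖y‖) ^ (n + 2))⁻¹) := by
  rw [integrable_fun_norm_plane (fun r => ((c + r) ^ (n + 2))⁻¹)]
  refine (integrableOn_Ioi_add_pow_inv n hn (c := c) (a := 0) (by linarith)).mono' ?_ ?_
  · exact (by fun_prop : Measurable fun y : ℝ => y * ((c + y) ^ (n + 2))⁻¹).aestronglyMeasurable
  · refine (ae_restrict_iff' measurableSet_Ioi).2 (.of_forall fun r (hr : 0 < r) => ?_)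
    rw [Real.norm_of_nonneg (by positivity), ← div_eq_mul_inv, ← one_div,
      div_le_div_iff₀ (by positivity) (by positivity)]
    calc r * (c + r) ^ (n + 1) ≤ (c + r) * (c + r) ^ (n + 1) := by gcongr; linarith
      _ = _ := by ring

theorem integral_add_norm_pow_inv_le (n : ℕ) (hn : 1 ≤ n) {c : ℝ} (hc : 0 < c) :
    ∫ y : Plane, ((c + ‖y‖) ^ (n + 2))⁻¹ ≤ 2 * Real.pi * (c ^ n)⁻¹ := by
  rw [integral_fun_norm_plane (fun r => ((c + r) ^ (n + 2))⁻¹)]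
  have h1 := (integrable_fun_norm_plane (fun r => ((c + r) ^ (n + 2))⁻¹)).1
    (integrable_add_norm_pow_inv n hn hc)
  have h2 : ∫ y in Ioi (0 : ℝ), y * ((c + y) ^ (n + 2))⁻¹
      ≤ ∫ r in Ioi (0 : ℝ), ((c + r) ^ (n + 1))⁻¹ := by
    refine setIntegral_mono_on h1 (integrableOn_Ioi_add_pow_inv n hn (by linarith))
      measurableSet_Ioi fun r (hr : 0 < r) => ?_
    rw [← div_eq_mul_inv, ← one_div, div_le_div_iff₀ (by positivity) (by positivity)]
    calc r * (c + r) ^ (n + 1) ≤ (c + r) * (c + r) ^ (n + 1) := by gcongr; linarith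
      _ = _ := by ring
  rw [integral_Ioi_add_pow_inv n hn (by linarith), add_zero] at h2
  have h3 : (1 : ℝ) / n ≤ 1 := by
    rw [div_le_one (by positivity)]; exact_mod_cast hn
  calc _ ≤ 2 * Real.pi * (1 / n * (c ^ n)⁻¹) := by gcongr
    _ ≤ 2 * Real.pi * (1 * (c ^ n)⁻¹) := by gcongr
    _ = _ := by ring

theorem integrableOn_compl_ball_norm_pow_inv (n : ℕ) (hn : 1 ≤ n) {R : ℝ} (hR : 0 < R) :
    IntegrableOn (fun y : Plane => (‖y‖ ^ (n + 2))⁻¹) (Metric.ball 0 R)ᶜ := by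
  refine Integrable.mono' (((integrable_add_norm_pow_inv n hn hR).const_mul
    (2 ^ (n + 2))).integrableOn) ?_ ?_
  · exact (by fun_prop : Measurable fun y : Plane => (‖y‖ ^ (n + 2))⁻¹).aestronglyMeasurable
  · refine (ae_restrict_iff' measurableSet_ball.compl).2 (.of_forall fun y hy => ?_)
    have hy' : R ≤ ‖y‖ := by simpa using hy
    have : 0 < ‖y‖ := hR.trans_le hy'
    rw [Real.norm_of_nonneg (by positivity), ← div_eq_mul_inv, ← one_div,
      div_le_div_iff₀ (by positivity) (by positivity), ← mul_pow, one_mul]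
    gcongr
    linarith

theorem setIntegral_compl_ball_norm_pow_inv_le (n : ℕ) (hn : 1 ≤ n) {R : ℝ} (hR : 0 < R) :
    ∫ y : Plane in (Metric.ball 0 R)ᶜ, (‖y‖ ^ (n + 2))⁻¹ ≤
      2 ^ (n + 2) * (2 * Real.pi) * (R ^ n)⁻¹ := by
  calc _ ≤ ∫ y : Plane in (Metric.ball 0 R)ᶜ, 2 ^ (n + 2) * ((R + ‖y‖) ^ (n + 2))⁻¹ := by
        refine setIntegral_mono_on (integrableOn_compl_ball_norm_pow_inv n hn hR)
          ((integrable_add_norm_pow_inv n hn hR).const_mul (2 ^ (n + 2))).integrableOn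
          measurableSet_ball.compl fun y hy => ?_
        have hy' : R ≤ ‖y‖ := by simpa using hy
        have : 0 < ‖y‖ := hR.trans_le hy'
        rw [← div_eq_mul_inv, ← one_div,
          div_le_div_iff₀ (by positivity) (by positivity), ← mul_pow, one_mul]
        gcongr
        linarith
    _ ≤ ∫ y : Plane, 2 ^ (n + 2) * ((R + ‖y‖) ^ (n + 2))⁻¹ :=
        setIntegral_le_integral ((integrable_add_norm_pow_inv n hn hR).const_mul (2 ^ (n + 2)))
          (.of_forall fun y => by positivity)
    _ ≤ _ := by
        rw [integral_const_mul, mul_assoc]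
        gcongr
        exact integral_add_norm_pow_inv_le n hn hR

/-! ### The profile tensor -/

theorem aestronglyMeasurable_heatThird (j h k : Fin 2) (x : Plane) (μ : Measure ℝ) :
    AEStronglyMeasurable (fun s => heatThird j h k s x) μ :=
  ((measurable_heatThird j h k).comp (measurable_id.prodMk measurable_const)).aestronglyMeasurable

theorem exists_abs_heatThird_le : ∃ C > 0, ∀ (j h k : Fin 2) (s : ℝ), 0 < s → ∀ x : Plane,
    |heatThird j h k s x| ≤ C / (√s + ‖x‖) ^ 5 := by
  obtain ⟨C, hC, hb⟩ := exists_norm_iteratedFDeriv_heatThird_le 0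
  exact ⟨C, hC, fun j h k s hs x => by simpa using hb j h k s hs x⟩

theorem integrableOn_Ioi_heatThird (j h k : Fin 2) (x : Plane) {t : ℝ} (ht : 0 < t) :
    IntegrableOn (fun s => heatThird j h k s x) (Ioi t) := by
  obtain ⟨C, hC, hb⟩ := exists_abs_heatThird_le
  refine Integrable.mono' ((integrableOn_Ioi_inv_sqrt_mul_pow ‖x‖ (norm_nonneg _) 3 (by omega)
    ht).const_mul C) (aestronglyMeasurable_heatThird j h k x _) ?_
  refine (ae_restrict_iff' measurableSet_Ioi).2 (.of_forall fun s (hs : t < s) => ?_)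
  have hss : 0 < √s := Real.sqrt_pos.2 (ht.trans hs)
  refine (hb j h k s (ht.trans hs) x).trans ?_
  rw [← div_eq_mul_inv]
  gcongr
  calc √s * (√s + ‖x‖) ^ (3 + 1) ≤ (√s + ‖x‖) * (√s + ‖x‖) ^ (3 + 1) := by
        gcongr; linarith [norm_nonneg x]
    _ = _ := by ring

theorem exists_abs_heatThird_le' : ∃ C > 0, ∀ (j h k : Fin 2) (s : ℝ), 0 < s → ∀ x : Plane, x ≠ 0 →
    |heatThird j h k s x| ≤ C / ‖x‖ ^ 5 := by
  obtain ⟨C, hC, hb⟩ := exists_abs_heatThird_le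
  refine ⟨C, hC, fun j h k s hs x hx => (hb j h k s hs x).trans ?_⟩
  have : 0 < ‖x‖ := norm_pos_iff.2 hx
  gcongr
  linarith [Real.sqrt_nonneg s]

theorem integrableOn_Ioc_heatThird (j h k : Fin 2) {x : Plane} (hx : x ≠ 0) (t : ℝ) :
    IntegrableOn (fun s => heatThird j h k s x) (Ioc 0 t) := by
  obtain ⟨C, hC, hb⟩ := exists_abs_heatThird_le'
  refine Measure.integrableOn_of_bounded (M := C / ‖x‖ ^ 5) (by simp)
    (aestronglyMeasurable_heatThird j h k x _) ?_
  exact (ae_restrict_iff' measurableSet_Ioc).2 (.of_forall fun s hs => hb j h k s hs.1 x hx)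

theorem integrableOn_Ioi_zero_heatThird (j h k : Fin 2) {x : Plane} (hx : x ≠ 0) :
    IntegrableOn (fun s => heatThird j h k s x) (Ioi 0) := by
  rw [← Ioc_union_Ioi_eq_Ioi (zero_le_one (α := ℝ))]
  exact (integrableOn_Ioc_heatThird j h k hx 1).union (integrableOn_Ioi_heatThird j h k x one_pos)

theorem tendsto_pow_mul_exp_neg_const_mul {c : ℝ} (hc : 0 < c) (n : ℕ) :
    Tendsto (fun w : ℝ => w ^ n * Real.exp (-(c * w))) atTop (𝓝 0) := by
  have h := ((Real.tendsto_pow_mul_exp_neg_atTop_nhds_zero n).comp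
    (tendsto_id.const_mul_atTop hc)).const_mul ((c ^ n)⁻¹)
  rw [mul_zero] at h
  refine h.congr fun w => ?_
  simp only [Function.comp, id, mul_pow]
  field_simp

theorem tendsto_quadratic_inv_mul_exp {c : ℝ} (hc : 0 < c) (α β γ : ℝ) :
    Tendsto (fun s : ℝ => (α + β * s⁻¹ + γ * s⁻¹ ^ 2) * Real.exp (-(c * s⁻¹))) (𝓝[>] 0) (𝓝 0) := by
  have h : Tendsto (fun w : ℝ => (α + β * w + γ * w ^ 2) * Real.exp (-(c * w))) atTop (𝓝 0) := by
    have := (((tendsto_pow_mul_exp_neg_const_mul hc 0).const_mul α).add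
      ((tendsto_pow_mul_exp_neg_const_mul hc 1).const_mul β)).add
      ((tendsto_pow_mul_exp_neg_const_mul hc 2).const_mul γ)
    simp only [mul_zero, add_zero] at this
    refine this.congr fun w => ?_
    ring
  exact h.comp tendsto_inv_nhdsGT_zero

theorem tendsto_quadratic_inv_mul_exp_atTop (c : ℝ) (α β γ : ℝ) :
    Tendsto (fun s : ℝ => (α + β * s⁻¹ + γ * s⁻¹ ^ 2) * Real.exp (-(c * s⁻¹))) atTop (𝓝 α) := by
  have h : Continuous (fun w : ℝ => (α + β * w + γ * w ^ 2) * Real.exp (-(c * w))) := by fun_prop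
  have := (h.tendsto 0).comp tendsto_inv_atTop_zero
  simpa [Function.comp_def] using this

theorem hasDerivAt_quadratic_inv_mul_exp (c α β γ : ℝ) {s : ℝ} (hs : s ≠ 0) :
    HasDerivAt (fun s : ℝ => (α + β * s⁻¹ + γ * s⁻¹ ^ 2) * Real.exp (-(c * s⁻¹)))
      (((-(β * s⁻¹ ^ 2) - 2 * γ * s⁻¹ ^ 3) + (α + β * s⁻¹ + γ * s⁻¹ ^ 2) * (c * s⁻¹ ^ 2)) *
        Real.exp (-(c * s⁻¹))) s := by
  have h0 : HasDerivAt (fun s : ℝ => s⁻¹) (-(s ^ 2)⁻¹) s := hasDerivAt_inv hs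
  have h := (((h0.const_mul β).const_add α).fun_add ((h0.fun_pow 2).const_mul γ)).fun_mul
    ((h0.const_mul c).fun_neg.exp)
  refine h.congr_deriv ?_
  rw [show 2 - 1 = 1 from rfl, pow_one, Nat.cast_ofNat]
  field_simp
  ring

/-- The antiderivative in `s` of the third derivatives of the heat kernel is elementary; its total
variation over `s > 0` is the homogeneous tensor `𝔽`. -/
theorem integral_Ioi_zero_heatThird (j h k : Fin 2) {x : Plane} (hx : x ≠ 0) :
    ∫ s in Ioi 0, heatThird j h k s x = profileTensor x j h k := by
  have hr : 0 < ‖x‖ := norm_pos_iff.2 hx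
  set σ := ((if j = h then x k else 0) + (if h = k then x j else 0) + (if k = j then x h else 0))
    with hσ
  set p := x j * x h * x k with hp
  set c := ‖x‖ ^ 2 / 4 with hc
  have hcpos : 0 < c := by positivity
  have hpi : Real.pi ≠ 0 := Real.pi_ne_zero
  set a := σ / (16 * Real.pi) with ha
  set b := p / (32 * Real.pi) with hb
  let Φ : ℝ → ℝ := fun s => ((a / c ^ 2 - 2 * b / c ^ 3) + (a / c - 2 * b / c ^ 2) * s⁻¹ +
    (-b / c) * s⁻¹ ^ 2) * Real.exp (-(c * s⁻¹))
  have hexpr : ∀ s, 0 < s → heatThird j h k s x =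
      (a * s⁻¹ ^ 3 - b * s⁻¹ ^ 4) * Real.exp (-(c * s⁻¹)) := by
    intro s hs
    simp only [heatThird, heatKernel, ← hσ, ← hp, ha, hb, hc]
    have : -‖x‖ ^ 2 / (4 * s) = -(‖x‖ ^ 2 / 4 * s⁻¹) := by field_simp
    rw [this]
    field_simp
    ring
  have hderiv : ∀ s, 0 < s → HasDerivAt Φ (heatThird j h k s x) s := by
    intro s hs
    refine (hasDerivAt_quadratic_inv_mul_exp c _ _ _ hs.ne').congr_deriv ?_
    rw [hexpr s hs]
    congr 1
    field_simp
    ring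
  have h0 := tendsto_quadratic_inv_mul_exp hcpos (a / c ^ 2 - 2 * b / c ^ 3)
    (a / c - 2 * b / c ^ 2) (-b / c)
  -- the antiderivative is extended by its limit `0` at the origin
  let Ψ : ℝ → ℝ := fun s => if s ≤ 0 then 0 else Φ s
  have hΨ : ∀ s, 0 < s → Ψ =ᶠ[𝓝 s] Φ := by
    intro s hs
    filter_upwards [lt_mem_nhds hs] with y hy
    simp [Ψ, not_le.2 hy]
  have hcont : ContinuousWithinAt Ψ (Ici 0) 0 := by
    rw [continuousWithinAt_Ioi_iff_Ici.symm, ContinuousWithinAt]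
    have : Ψ 0 = 0 := by simp [Ψ]
    rw [this]
    refine h0.congr' ?_
    filter_upwards [self_mem_nhdsWithin] with y (hy : 0 < y)
    simp [Ψ, Φ, not_le.2 hy]
  have htop : Tendsto Ψ atTop (𝓝 (a / c ^ 2 - 2 * b / c ^ 3)) := by
    refine (tendsto_quadratic_inv_mul_exp_atTop c (a / c ^ 2 - 2 * b / c ^ 3)
      (a / c - 2 * b / c ^ 2) (-b / c)).congr' ?_
    filter_upwards [Ioi_mem_atTop 0] with y (hy : 0 < y)
    simp [Ψ, Φ, not_le.2 hy]
  rw [integral_Ioi_of_hasDerivAt_of_tendsto hcont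
    (fun s hs => (hderiv s hs).congr_of_eventuallyEq (hΨ s hs))
    (integrableOn_Ioi_zero_heatThird j h k hx) htop]
  have : Ψ 0 = 0 := by simp [Ψ]
  rw [this, sub_zero, profileTensor, ← hσ, ha, hb, hc]
  have e : 4 * x j * x h * x k = 4 * p := by rw [hp]; ring
  rw [e]
  field_simp
  ring

/-- The Oseen kernel is close to its homogeneous limit as `t → 0`. -/
theorem exists_abs_oseenKernel_sub_profileTensor_le : ∃ C > 0, ∀ (j h k : Fin 2) (t : ℝ), 0 < t →
    ∀ x : Plane, x ≠ 0 → |oseenKernel j h k t x - profileTensor x j h k| ≤ C * t / ‖x‖ ^ 5 := by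
  obtain ⟨C₁, hC₁, hb₁⟩ := exists_norm_iteratedFDeriv_dirDeriv_heatKernel_le 0
  obtain ⟨C₂, hC₂, hb₂⟩ := exists_abs_heatThird_le'
  refine ⟨C₁ + C₂, by positivity, fun j h k t ht x hx => ?_⟩
  have hr : 0 < ‖x‖ := norm_pos_iff.2 hx
  have hsplit : profileTensor x j h k = (∫ s in Ioc 0 t, heatThird j h k s x) +
      ∫ s in Ioi t, heatThird j h k s x := by
    rw [← integral_Ioi_zero_heatThird j h k hx, ← Ioc_union_Ioi_eq_Ioi ht.le]
    exact setIntegral_union (Ioc_disjoint_Ioi le_rfl) measurableSet_Ioi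
      (integrableOn_Ioc_heatThird j h k hx t) (integrableOn_Ioi_heatThird j h k x ht)
  have e : oseenKernel j h k t x - profileTensor x j h k =
      (if j = k then dirDeriv (basisVec h) (heatKernel t) x else 0) -
        ∫ s in Ioc 0 t, heatThird j h k s x := by
    rw [hsplit, oseenKernel]; ring
  rw [e, add_mul, add_div]
  refine (abs_sub _ _).trans (add_le_add ?_ ?_)
  · split_ifs
    · have := hb₁ h t ht x
      rw [norm_iteratedFDeriv_zero, Real.norm_eq_abs] at this
      refine this.trans ?_
      gcongr
      linarith [Real.sqrt_nonneg t]
    · rw [abs_zero]; positivity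
  · have := norm_setIntegral_le_of_norm_le_const (μ := volume) (s := Ioc 0 t)
      (C := C₂ / ‖x‖ ^ 5) (f := fun s => heatThird j h k s x) (by simp)
      (fun s hs => hb₂ j h k s hs.1 x hx)
    simp only [Real.norm_eq_abs, Real.volume_real_Ioc, sub_zero, max_eq_left ht.le] at this
    refine this.trans (le_of_eq (by ring))

theorem exists_abs_profileTensor_le : ∃ C > 0, ∀ (j h k : Fin 2) (x : Plane), x ≠ 0 →
    |profileTensor x j h k| ≤ C / ‖x‖ ^ 3 := by
  obtain ⟨C₁, hC₁, hb₁⟩ := exists_abs_oseenKernel_sub_profileTensor_le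
  obtain ⟨C₂, hC₂, hb₂⟩ := exists_isXField_oseenKernel
  refine ⟨C₁ + C₂, by positivity, fun j h k x hx => ?_⟩
  have hr : 0 < ‖x‖ := norm_pos_iff.2 hx
  have h1 := hb₁ j h k (‖x‖ ^ 2) (by positivity) x hx
  have h2 := (hb₂ j h k).norm_le (t := ‖x‖ ^ 2) (by positivity) x
  rw [Real.norm_eq_abs] at h2
  have h3 : C₁ * ‖x‖ ^ 2 / ‖x‖ ^ 5 = C₁ / ‖x‖ ^ 3 := by field_simp
  have h4 : C₂ / (√(‖x‖ ^ 2) + ‖x‖) ^ 3 ≤ C₂ / ‖x‖ ^ 3 := by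
    gcongr
    linarith [Real.sqrt_nonneg (‖x‖ ^ 2)]
  rw [add_div]
  have h5 := abs_sub_abs_le_abs_sub (profileTensor x j h k) (oseenKernel j h k (‖x‖ ^ 2) x)
  rw [abs_sub_comm] at h5
  linarith


/-! ### The Fourier symbol of the Oseen kernel -/

theorem integrable_norm_pow_mul_exp (n : ℕ) {c : ℝ} (hc : 0 < c) :
    Integrable (fun ξ : Plane => ‖ξ‖ ^ n * Real.exp (-c * ‖ξ‖ ^ 2)) := by
  rw [integrable_fun_norm_plane (fun r => r ^ n * Real.exp (-c * r ^ 2))]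
  refine (integrableOn_rpow_mul_exp_neg_mul_sq hc (s := (n + 1 : ℕ))
    (by have : (0 : ℝ) ≤ ((n + 1 : ℕ) : ℝ) := Nat.cast_nonneg _
        linarith)).congr_fun (fun y _ => ?_) measurableSet_Ioi
  simp only [Real.rpow_natCast]
  ring

/-- A continuous function dominated by a power times a Gaussian. -/
def GaussianDominated (f : Plane → ℂ) : Prop :=
  Continuous f ∧ ∃ (C : ℝ) (n : ℕ) (c : ℝ), 0 < c ∧ ∀ ξ, ‖f ξ‖ ≤ C * (‖ξ‖ ^ n * Real.exp (-c * ‖ξ‖ ^ 2))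

/-- The Fourier multiplier of `∂_h`, applied to `f`. -/
noncomputable def freqMul (h : Fin 2) (f : Plane → ℂ) (ξ : Plane) : ℂ :=
  2 * Real.pi * Complex.I * (ξ h : ℂ) * f ξ

theorem norm_freqMul_le (h : Fin 2) (f : Plane → ℂ) (ξ : Plane) :
    ‖freqMul h f ξ‖ ≤ 2 * Real.pi * ‖ξ‖ * ‖f ξ‖ := by
  have h1 : ‖ξ h‖ ≤ ‖ξ‖ := PiLp.norm_apply_le ξ h
  rw [freqMul, norm_mul, norm_mul, norm_mul, norm_mul]
  simp only [Complex.norm_ofNat, Complex.norm_real, Complex.norm_I, mul_one,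
    Real.norm_of_nonneg Real.pi_nonneg]
  gcongr

theorem GaussianDominated.freqMul {f : Plane → ℂ} (hf : GaussianDominated f) (h : Fin 2) :
    GaussianDominated (freqMul h f) := by
  obtain ⟨hc, C, n, c, hc0, hb⟩ := hf
  refine ⟨?_, 2 * Real.pi * C, n + 1, c, hc0, fun ξ => ?_⟩
  · have : Continuous fun ξ : Plane => ((ξ h : ℝ) : ℂ) :=
      Complex.continuous_ofReal.comp (EuclideanSpace.proj h : Plane →L[ℝ] ℝ).continuous
    exact (continuous_const.mul this).mul hc
  · refine (norm_freqMul_le h f ξ).trans ?_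
    calc _ ≤ 2 * Real.pi * ‖ξ‖ * (C * (‖ξ‖ ^ n * Real.exp (-c * ‖ξ‖ ^ 2))) := by
          gcongr; exact hb ξ
      _ = _ := by ring

theorem GaussianDominated.integrable {f : Plane → ℂ} (hf : GaussianDominated f) :
    Integrable f := by
  obtain ⟨hc, C, n, c, hc0, hb⟩ := hf
  exact ((integrable_norm_pow_mul_exp n hc0).const_mul C).mono' hc.aestronglyMeasurable
    (.of_forall hb)

theorem GaussianDominated.integrable_norm_mul {f : Plane → ℂ} (hf : GaussianDominated f) :
    Integrable (fun v => ‖v‖ * ‖f v‖) := by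
  obtain ⟨hc, C, n, c, hc0, hb⟩ := hf
  refine ((integrable_norm_pow_mul_exp (n + 1) hc0).const_mul C).mono'
    (continuous_norm.mul hc.norm).aestronglyMeasurable (.of_forall fun ξ => ?_)
  rw [norm_mul, norm_norm, norm_norm]
  calc _ ≤ ‖ξ‖ * (C * (‖ξ‖ ^ n * Real.exp (-c * ‖ξ‖ ^ 2))) := by gcongr; exact hb ξ
    _ = _ := by ring

/-- Differentiation becomes multiplication by the frequency. -/
theorem fourierInv_freqMul {f : Plane → ℂ} (hf : GaussianDominated f) {a : Plane → ℝ}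
    (ha : ∀ x, 𝓕⁻ f x = (a x : ℂ)) (had : Differentiable ℝ a) (h : Fin 2) (x : Plane) :
    𝓕⁻ (freqMul h f) x = (dirDeriv (basisVec h) a x : ℂ) := by
  have h1 := (Real.hasFDerivAt_fourier hf.integrable hf.integrable_norm_mul (-x)).comp x
    (hasFDerivAt_id x).fun_neg
  have h2 : (𝓕 f ∘ fun x : Plane => -x) = fun x => ((a x : ℝ) : ℂ) := by
    funext y
    rw [← ha, Real.fourierInv_eq_fourier_neg]
    rfl
  have h3 : HasFDerivAt (fun x => ((a x : ℝ) : ℂ)) (Complex.ofRealCLM.comp (fderiv ℝ a x)) x :=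
    Complex.ofRealCLM.hasFDerivAt.comp x (had x).hasFDerivAt
  have h1' : HasFDerivAt (fun x => ((a x : ℝ) : ℂ)) _ x := h2 ▸ h1
  have h4 := h1'.unique h3
  have h5 := congrArg (fun T : Plane →L[ℝ] ℂ => T (basisVec h)) h4
  simp only [ContinuousLinearMap.comp_apply, Complex.ofRealCLM_apply] at h5
  rw [dirDeriv, ← h5, Real.fourierInv_eq_fourier_neg]
  have h6 : Integrable (VectorFourier.fourierSMulRight (innerSL ℝ) f) := by
    refine (hf.integrable_norm_mul.const_mul (2 * Real.pi * ‖(innerSL ℝ : Plane →L[ℝ] Plane →L[ℝ] ℝ)‖)).mono'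
      hf.1.aestronglyMeasurable.fourierSMulRight (.of_forall fun v => ?_)
    refine (VectorFourier.norm_fourierSMulRight_le _ _ _).trans (le_of_eq (by ring))
  rw [Real.fourier_continuousLinearMap_apply h6]
  simp only [neg_apply, ContinuousLinearMap.id_apply, VectorFourier.fourierSMulRight_apply]
  refine congrFun (congrArg (fun g : Plane → ℂ => 𝓕 g) (funext fun v => ?_)) (-x)
  have : inner ℝ v (-basisVec h) = -v h := by
    simp [basisVec, EuclideanSpace.inner_single_right]
  change freqMul h f v = -(2 * ↑Real.pi * Complex.I) • (inner ℝ v (-basisVec h)) • f v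
  rw [this, freqMul]
  simp only [Complex.real_smul, smul_eq_mul, Complex.ofReal_neg]
  ring

/-- The Fourier symbol of `e^{sΔ}`. -/
noncomputable def heatSymbol (s : ℝ) (ξ : Plane) : ℂ :=
  (Real.exp (-(4 * Real.pi ^ 2 * s * ‖ξ‖ ^ 2)) : ℂ)

theorem gaussianDominated_heatSymbol {s : ℝ} (hs : 0 < s) : GaussianDominated (heatSymbol s) := by
  refine ⟨by unfold heatSymbol; fun_prop, 1, 0, 4 * Real.pi ^ 2 * s, by positivity, fun ξ => ?_⟩
  rw [heatSymbol, Complex.norm_real, Real.norm_of_nonneg (Real.exp_pos _).le, pow_zero, one_mul,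
    one_mul, neg_mul]

theorem fourierInv_heatSymbol {s : ℝ} (hs : 0 < s) (x : Plane) :
    𝓕⁻ (heatSymbol s) x = (heatKernel s x : ℂ) := by
  have hb : (0 : ℝ) < ((4 * Real.pi ^ 2 * s : ℝ) : ℂ).re := by
    rw [Complex.ofReal_re]; positivity
  have e : heatSymbol s = fun v : Plane => Complex.exp (-((4 * Real.pi ^ 2 * s : ℝ) : ℂ) * ‖v‖ ^ 2) := by
    funext v
    rw [heatSymbol]
    push_cast
    ring_nf
  rw [Real.fourierInv_eq_fourier_neg, e, fourier_gaussian_innerProductSpace hb]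
  have hd : ((Module.finrank ℝ Plane : ℕ) : ℂ) / 2 = 1 := by
    simp
  rw [hd, Complex.cpow_one, norm_neg, heatKernel]
  push_cast
  have hpi : (Real.pi : ℂ) ≠ 0 := by exact_mod_cast Real.pi_ne_zero
  have hs' : (s : ℂ) ≠ 0 := by exact_mod_cast hs.ne'
  congr 1
  · field_simp
  · congr 1
    field_simp

/-- The third derivatives of the heat kernel have the symbol `(2πi)³ ξ_j ξ_h ξ_k e^{-4π²s|ξ|²}`. -/
theorem fourierInv_heatThird (j h k : Fin 2) {s : ℝ} (hs : 0 < s) (x : Plane) :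
    𝓕⁻ (freqMul j (freqMul h (freqMul k (heatSymbol s)))) x = (heatThird j h k s x : ℂ) := by
  have hg := fun n : ℕ => contDiff_heatKernel s n
  have hG := gaussianDominated_heatSymbol hs
  have d : ∀ {f : Plane → ℝ}, (∀ n : ℕ, ContDiff ℝ n f) → Differentiable ℝ f := fun hf =>
    (hf 1).differentiable (by simp)
  rw [heatThird_eq_dirDeriv j h k hs]
  exact fourierInv_freqMul ((hG.freqMul k).freqMul h)
    (fun x => fourierInv_freqMul (hG.freqMul k)
      (fun x => fourierInv_freqMul hG (fourierInv_heatSymbol hs) (d hg) k x)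
      (d (contDiff_dirDeriv hg _)) h x)
    (d (contDiff_dirDeriv (contDiff_dirDeriv hg _) _)) j x

theorem integral_Ioi_exp_neg_mul {c : ℝ} (hc : 0 < c) (t : ℝ) :
    ∫ s in Ioi t, Real.exp (-(c * s)) = Real.exp (-(c * t)) / c := by
  have := integral_exp_mul_Ioi (a := -c) (by linarith) t
  simp only [neg_mul] at this
  rw [this, neg_div_neg_eq]

theorem integrableOn_Ioi_exp_neg_mul {c : ℝ} (hc : 0 < c) (t : ℝ) :
    IntegrableOn (fun s => Real.exp (-(c * s))) (Ioi t) := by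
  simpa only [neg_mul] using integrableOn_exp_mul_Ioi (a := -c) (by linarith) t

theorem freqMul_three_heatSymbol (j h k : Fin 2) (s : ℝ) (ξ : Plane) :
    freqMul j (freqMul h (freqMul k (heatSymbol s))) ξ =
      ((2 * Real.pi * Complex.I) ^ 3 * ((ξ j * ξ h * ξ k : ℝ) : ℂ)) *
        ((Real.exp (-(4 * Real.pi ^ 2 * ‖ξ‖ ^ 2 * s)) : ℝ) : ℂ) := by
  simp only [freqMul, heatSymbol]
  rw [show 4 * Real.pi ^ 2 * s * ‖ξ‖ ^ 2 = 4 * Real.pi ^ 2 * ‖ξ‖ ^ 2 * s by ring]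
  push_cast
  ring

theorem abs_coord_three_le (j h k : Fin 2) (ξ : Plane) : |ξ j * ξ h * ξ k| ≤ ‖ξ‖ ^ 3 := by
  have h1 : ∀ i, |ξ i| ≤ ‖ξ‖ := fun i => PiLp.norm_apply_le ξ i
  rw [abs_mul, abs_mul]
  calc _ ≤ ‖ξ‖ * ‖ξ‖ * ‖ξ‖ := by gcongr <;> exact h1 _
    _ = _ := by ring

/-- Absolute convergence, jointly in the frequency and in the time `s > t`: the singularity `|ξ|^{-2}`
created by the integration in `s` is compensated by the three factors of order one. -/
theorem integrable_prod_freqMul_three (j h k : Fin 2) {t : ℝ} (ht : 0 < t) :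
    Integrable (Function.uncurry fun (ξ : Plane) (s : ℝ) =>
      freqMul j (freqMul h (freqMul k (heatSymbol s))) ξ)
      ((volume : Measure Plane).prod (volume.restrict (Ioi t))) := by
  have hm : AEStronglyMeasurable (Function.uncurry fun (ξ : Plane) (s : ℝ) =>
      freqMul j (freqMul h (freqMul k (heatSymbol s))) ξ)
      ((volume : Measure Plane).prod (volume.restrict (Ioi t))) := by
    refine Measurable.aestronglyMeasurable ?_
    simp only [freqMul_three_heatSymbol, Function.uncurry_def]
    have h1 := fun i : Fin 2 => (measurable_coord i).comp (measurable_fst : Measurable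
      (Prod.fst : Plane × ℝ → Plane))
    have h2 : Measurable fun p : Plane × ℝ => (((p.1 j * p.1 h * p.1 k : ℝ)) : ℂ) :=
      Complex.measurable_ofReal.comp (((h1 j).mul (h1 h)).mul (h1 k))
    have h3 : Measurable fun p : Plane × ℝ =>
        ((Real.exp (-(4 * Real.pi ^ 2 * ‖p.1‖ ^ 2 * p.2)) : ℝ) : ℂ) :=
      Complex.measurable_ofReal.comp (by fun_prop)
    exact (measurable_const.mul h2).mul h3
  have hnorm : ∀ (ξ : Plane) (s : ℝ), ‖freqMul j (freqMul h (freqMul k (heatSymbol s))) ξ‖ =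
      ((2 * Real.pi) ^ 3 * |ξ j * ξ h * ξ k|) * Real.exp (-(4 * Real.pi ^ 2 * ‖ξ‖ ^ 2 * s)) := by
    intro ξ s
    rw [freqMul_three_heatSymbol, norm_mul, norm_mul, norm_pow, norm_mul, norm_mul]
    simp only [Complex.norm_ofNat, Complex.norm_real, Complex.norm_I, mul_one,
      Real.norm_of_nonneg Real.pi_nonneg, Real.norm_of_nonneg (Real.exp_pos _).le,
      Real.norm_eq_abs]
  have hpos : ∀ ξ : Plane, ξ ≠ 0 → 0 < 4 * Real.pi ^ 2 * ‖ξ‖ ^ 2 := fun ξ hξ => by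
    have := norm_pos_iff.2 hξ
    positivity
  have hne : ∀ᵐ ξ : Plane, ξ ≠ 0 := by
    simp [ae_iff, measure_singleton]
  rw [integrable_prod_iff hm]
  constructor
  · filter_upwards [hne] with ξ hξ
    simp only [Function.uncurry_apply_pair, freqMul_three_heatSymbol]
    exact ((integrableOn_Ioi_exp_neg_mul (hpos ξ hξ) t).ofReal).const_mul _
  · have h2 := (integrable_norm_pow_mul_exp 1 (c := 4 * Real.pi ^ 2 * t) (by positivity)).const_mul
      (2 * Real.pi)
    refine h2.mono' hm.norm.integral_prod_right' ?_
    filter_upwards [hne] with ξ hξ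
    have hr := norm_pos_iff.2 hξ
    simp only [Function.uncurry_apply_pair, hnorm]
    rw [integral_const_mul, integral_Ioi_exp_neg_mul (hpos ξ hξ), Real.norm_of_nonneg (by positivity)]
    calc (2 * Real.pi) ^ 3 * |ξ j * ξ h * ξ k| * (Real.exp (-(4 * Real.pi ^ 2 * ‖ξ‖ ^ 2 * t)) /
          (4 * Real.pi ^ 2 * ‖ξ‖ ^ 2))
        ≤ (2 * Real.pi) ^ 3 * ‖ξ‖ ^ 3 * (Real.exp (-(4 * Real.pi ^ 2 * ‖ξ‖ ^ 2 * t)) /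
          (4 * Real.pi ^ 2 * ‖ξ‖ ^ 2)) := by
          gcongr; exact abs_coord_three_le j h k ξ
      _ = 2 * Real.pi * (‖ξ‖ ^ 1 * Real.exp (-(4 * Real.pi ^ 2 * t) * ‖ξ‖ ^ 2)) := by
          have : -(4 * Real.pi ^ 2 * ‖ξ‖ ^ 2 * t) = -(4 * Real.pi ^ 2 * t) * ‖ξ‖ ^ 2 := by ring
          rw [this]
          have := Real.pi_pos
          field_simp
          ring

/-- The Oseen kernel is the inverse Fourier transform of its symbol: `|ξ|^{-2} e^{-4π²t|ξ|²}` is the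
integral of `4π² e^{-4π²s|ξ|²}` over `s > t`, and this integral can be exchanged with the Fourier
inversion integral. -/
theorem oseenDivKernel_eq (j h k : Fin 2) {t : ℝ} (ht : 0 < t) (x : Plane) :
    oseenDivKernel j h k x t = oseenKernel j h k t x := by
  set m : Plane → ℂ := fun ξ => ∫ s in Ioi t, freqMul j (freqMul h (freqMul k (heatSymbol s))) ξ
    with hm
  have hint := integrable_prod_freqMul_three j h k ht
  have hmint : Integrable m := hint.integral_prod_left
  have hsym : oseenDivSymbol j h k t = fun ξ =>
      (if j = k then (1 : ℂ) else 0) * freqMul h (heatSymbol t) ξ + m ξ := by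
    funext ξ
    have hmξ : m ξ = ((2 * Real.pi * Complex.I) ^ 3 * ((ξ j * ξ h * ξ k : ℝ) : ℂ)) *
        ((∫ s in Ioi t, Real.exp (-(4 * Real.pi ^ 2 * ‖ξ‖ ^ 2 * s)) : ℝ) : ℂ) := by
      simp only [hm, freqMul_three_heatSymbol]
      rw [integral_const_mul, integral_complex_ofReal]
    rw [hmξ]
    -- at `ξ = 0` the quotient by `|ξ|²` in the symbol is a junk value, multiplied by `ξ_h = 0`
    by_cases hξ : ξ = 0
    · subst hξ
      simp [oseenDivSymbol, freqMul]
    · have hr := norm_pos_iff.2 hξ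
      rw [integral_Ioi_exp_neg_mul (by positivity)]
      simp only [oseenDivSymbol, freqMul, heatSymbol]
      rw [show 4 * Real.pi ^ 2 * ‖ξ‖ ^ 2 * t = 4 * Real.pi ^ 2 * t * ‖ξ‖ ^ 2 by ring]
      have hr' : (‖ξ‖ : ℂ) ≠ 0 := by exact_mod_cast hr.ne'
      have hpi : (Real.pi : ℂ) ≠ 0 := by exact_mod_cast Real.pi_ne_zero
      have hI3 : Complex.I ^ 3 = -Complex.I := Complex.I_pow_three
      set E := Real.exp (-(4 * Real.pi ^ 2 * t * ‖ξ‖ ^ 2))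
      rw [mul_pow, hI3]
      split_ifs <;> push_cast <;> field_simp <;> ring
  have hF : 𝓕⁻ m x = ((∫ s in Ioi t, heatThird j h k s x : ℝ) : ℂ) := by
    rw [Real.fourierInv_eq']
    have h1 : ∀ ξ : Plane, Complex.exp ((↑(2 * Real.pi * ⟪ξ, x⟫) * Complex.I)) • m ξ =
        ∫ s in Ioi t, Complex.exp ((↑(2 * Real.pi * ⟪ξ, x⟫) * Complex.I)) •
          freqMul j (freqMul h (freqMul k (heatSymbol s))) ξ := fun ξ => by
      rw [hm, ← integral_smul]
    simp only [h1]
    rw [integral_integral_swap]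
    · rw [← integral_complex_ofReal]
      refine setIntegral_congr_fun measurableSet_Ioi fun s (hs : t < s) => ?_
      rw [← fourierInv_heatThird j h k (ht.trans hs) x, Real.fourierInv_eq']
    · refine hint.norm.mono' ?_ ?_
      · refine AEStronglyMeasurable.smul (f := fun p : Plane × ℝ =>
          Complex.exp ((↑(2 * Real.pi * ⟪p.1, x⟫) * Complex.I))) ?_ hint.aestronglyMeasurable
        exact (by fun_prop : Continuous fun p : Plane × ℝ =>
          Complex.exp ((↑(2 * Real.pi * ⟪p.1, x⟫) * Complex.I))).aestronglyMeasurable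
      · refine .of_forall fun p => ?_
        simp only [Function.uncurry_def, norm_smul, Complex.norm_exp_ofReal_mul_I, one_mul, le_refl]
  have hG := (gaussianDominated_heatSymbol ht).freqMul h
  have hsum : 𝓕⁻ (oseenDivSymbol j h k t) x =
      (if j = k then (1 : ℂ) else 0) * 𝓕⁻ (freqMul h (heatSymbol t)) x + 𝓕⁻ m x := by
    have hexp : ∀ {f : Plane → ℂ}, Integrable f → Integrable fun ξ =>
        Complex.exp ((↑(2 * Real.pi * ⟪ξ, x⟫) * Complex.I)) • f ξ := by
      intro f hf
      refine hf.norm.mono' (AEStronglyMeasurable.smul (by fun_prop : Continuous fun ξ : Plane =>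
          Complex.exp ((↑(2 * Real.pi * ⟪ξ, x⟫) * Complex.I))).aestronglyMeasurable
          hf.aestronglyMeasurable) (.of_forall fun p => ?_)
      simp only [norm_smul, Complex.norm_exp_ofReal_mul_I, one_mul, le_refl]
    rw [hsym, Real.fourierInv_eq', Real.fourierInv_eq', Real.fourierInv_eq', ← integral_const_mul,
      ← integral_add ((hexp hG.integrable).const_mul _) (hexp hmint)]
    refine integral_congr_ae (.of_forall fun ξ => ?_)
    simp only [smul_eq_mul]
    ring
  rw [oseenDivKernel, hsum, hF, fourierInv_freqMul (gaussianDominated_heatSymbol ht)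
    (fourierInv_heatSymbol ht) ((contDiff_heatKernel t 1).differentiable (by simp)), oseenKernel]
  split_ifs <;> simp


/-! ### Cutting off near the origin -/

/-- Cutoffs away from the origin at every scale `ρ`, with derivatives bounded scale-invariantly. -/
theorem exists_cutoff : ∃ C > 0, ∀ ρ : ℝ, 0 < ρ → ∃ χ : Plane → ℝ, ContDiff ℝ 2 χ ∧
    (∀ y, 0 ≤ χ y ∧ χ y ≤ 1) ∧ (∀ y, ‖y‖ ≤ ρ / 8 → χ y = 0) ∧ (∀ y, ρ / 4 ≤ ‖y‖ → χ y = 1) ∧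
    ∀ k ≤ 2, ∀ y, ‖iteratedFDeriv ℝ k χ y‖ ≤ C / ρ ^ k := by
  let φ : ContDiffBump (0 : Plane) := ⟨1 / 8, 1 / 4, by norm_num, by norm_num⟩
  have hφ : ContDiff ℝ 2 φ := φ.contDiff
  have hbd : ∀ k : ℕ, ∃ C > 0, ∀ y, k ≤ 2 → ‖iteratedFDeriv ℝ k φ y‖ ≤ C := by
    intro k
    by_cases hk : k ≤ 2
    · obtain ⟨C, hC⟩ := (hφ.continuous_iteratedFDeriv (m := k) (by exact_mod_cast hk)
        ).bounded_above_of_compact_support (φ.hasCompactSupport.iteratedFDeriv k)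
      exact ⟨max C 1, by positivity, fun y _ => (hC y).trans (le_max_left _ _)⟩
    · exact ⟨1, one_pos, fun y h => absurd h hk⟩
  obtain ⟨C, hC, hb⟩ := exists_forall_le_of_forall_exists 2 hbd
    (fun m C C' h1 h2 y hm => (h2 y hm).trans h1)
  refine ⟨1 + C, by positivity, fun ρ hρ => ?_⟩
  have hψ : ContDiff ℝ 2 (fun y : Plane => 1 - φ y) := contDiff_const.sub hφ
  have hψb : ∀ k ≤ 2, ∀ y, ‖iteratedFDeriv ℝ k (fun y : Plane => 1 - φ y) y‖ ≤ 1 + C := by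
    intro k hk y
    have hk' : (k : WithTop ℕ∞) ≤ 2 := by exact_mod_cast hk
    have : (fun y : Plane => 1 - φ y) = (fun _ => (1 : ℝ)) - (φ : Plane → ℝ) := rfl
    rw [this, iteratedFDeriv_sub_apply contDiff_const.contDiffAt (hφ.of_le hk').contDiffAt]
    refine (norm_sub_le _ _).trans (add_le_add ?_ (hb k hk y hk))
    rcases k with _ | k
    · simp
    · rw [iteratedFDeriv_succ_const]
      simp
  refine ⟨fun y => 1 - φ (ρ⁻¹ • y), hψ.comp (contDiff_const_smul _), ?_, ?_, ?_, ?_⟩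
  · intro y
    have h1 := φ.nonneg (x := ρ⁻¹ • y)
    have h2 := φ.le_one (x := ρ⁻¹ • y)
    constructor <;> linarith
  · intro y hy
    have : φ (ρ⁻¹ • y) = 1 := by
      apply φ.one_of_mem_closedBall
      rw [mem_closedBall_zero_iff, norm_smul, norm_inv, Real.norm_of_nonneg hρ.le, inv_mul_le_iff₀ hρ]
      change ‖y‖ ≤ ρ * (1 / 8)
      linarith
    simp only [this, sub_self]
  · intro y hy
    have : φ (ρ⁻¹ • y) = 0 := by
      apply φ.zero_of_le_dist
      rw [dist_zero_right, norm_smul, norm_inv, Real.norm_of_nonneg hρ.le, le_inv_mul_iff₀ hρ]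
      change ρ * (1 / 4) ≤ ‖y‖
      linarith
    simp only [this, sub_zero]
  · intro k hk y
    have hk' : (k : WithTop ℕ∞) ≤ 2 := by exact_mod_cast hk
    rw [iteratedFDeriv_comp_const_smul (f := fun y : Plane => 1 - φ y) ρ⁻¹ (hψ.of_le hk')]
    rw [norm_smul, norm_pow, norm_inv, Real.norm_of_nonneg hρ.le, inv_pow, div_eq_inv_mul]
    gcongr
    exact hψb k hk _

/-- A function of class `C^2` off the origin becomes globally `C^2` once multiplied by a cutoff at
scale `ρ`, and keeps its scale-invariant bounds. -/
theorem contDiff_cutoff_smul {F : Type*} [NormedAddCommGroup F] [NormedSpace ℝ F] {C ρ B : ℝ}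
    (hρ : 0 < ρ) (hC : 0 < C) {χ : Plane → ℝ} (hχ : ContDiff ℝ 2 χ)
    (hχ0 : ∀ y, ‖y‖ ≤ ρ / 8 → χ y = 0)
    (hχb : ∀ k ≤ 2, ∀ y, ‖iteratedFDeriv ℝ k χ y‖ ≤ C / ρ ^ k)
    {f : Plane → F} (hf : ContDiffOn ℝ 2 f {x | x ≠ 0})
    (hfb : ∀ k ≤ 2, ∀ y, ρ / 8 ≤ ‖y‖ → ‖iteratedFDeriv ℝ k f y‖ ≤ B / ρ ^ k) :
    ContDiff ℝ 2 (fun y => χ y • f y) ∧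
      ∀ k ≤ 2, ∀ y, ‖iteratedFDeriv ℝ k (fun y => χ y • f y) y‖ ≤ 4 * C * B / ρ ^ k := by
  have hB : 0 ≤ B := by
    have h := hfb 0 (by omega) ((ρ / 8) • basisVec 0) (by
      rw [norm_smul, norm_basisVec, mul_one, Real.norm_of_nonneg (by positivity)])
    rw [pow_zero, div_one] at h
    exact (norm_nonneg _).trans h
  have hopen : IsOpen {x : Plane | x ≠ 0} := isOpen_ne
  have hzero : ∀ y, ‖y‖ < ρ / 8 → (fun y => χ y • f y) =ᶠ[𝓝 y] fun _ => 0 := by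
    intro y hy
    filter_upwards [(continuous_norm.isOpen_preimage _ isOpen_Iio).mem_nhds
      (show y ∈ norm ⁻¹' Iio (ρ / 8) from hy)] with z hz
    rw [hχ0 z (le_of_lt hz), zero_smul]
  constructor
  · rw [contDiff_iff_contDiffAt]
    intro y
    by_cases hy : ‖y‖ < ρ / 8
    · exact contDiffAt_const.congr_of_eventuallyEq (hzero y hy)
    · have hy0 : y ≠ 0 := by
        rintro rfl
        rw [norm_zero] at hy
        exact hy (by positivity)
      exact hχ.contDiffAt.smul (hf.contDiffAt (hopen.mem_nhds hy0))
  · intro k hk y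
    have hk' : (k : WithTop ℕ∞) ≤ 2 := by exact_mod_cast hk
    by_cases hy : ‖y‖ < ρ / 8
    · rw [((hzero y hy).iteratedFDeriv ℝ k).eq_of_nhds]
      have : iteratedFDeriv ℝ k (fun _ : Plane => (0 : F)) y = 0 := by simp
      rw [this, norm_zero]
      positivity
    · have hy0 : y ≠ 0 := by
        rintro rfl
        rw [norm_zero] at hy
        exact hy (by positivity)
      have h := norm_iteratedFDerivWithin_smul_le (𝕜 := ℝ) (f := χ) (g := f) (N := 2)
        hχ.contDiffOn hf hopen.uniqueDiffOn (x := y) hy0 hk'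
      simp only [iteratedFDerivWithin_of_isOpen _ hopen hy0] at h
      refine h.trans ?_
      calc _ ≤ ∑ i ∈ Finset.range (k + 1), (k.choose i : ℝ) * (C * B / ρ ^ k) := by
            refine Finset.sum_le_sum fun i hi => ?_
            have hik : i ≤ k := by simp at hi; omega
            rw [mul_assoc]
            gcongr
            calc _ ≤ (C / ρ ^ i) * (B / ρ ^ (k - i)) := by
                  gcongr
                  · exact hχb i (by omega) y
                  · exact hfb (k - i) (by omega) y (not_lt.1 hy)
              _ = C * B / (ρ ^ i * ρ ^ (k - i)) := by rw [div_mul_div_comm]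
              _ = _ := by rw [← pow_add, Nat.add_sub_cancel' hik]
        _ = 2 ^ k * (C * B / ρ ^ k) := by
            rw [← Finset.sum_mul]
            congr 1
            exact_mod_cast Nat.sum_range_choose k
        _ ≤ 2 ^ 2 * (C * B / ρ ^ k) := by
            gcongr
            norm_num
        _ = _ := by ring

/-! ### Integrals over space-time slabs -/

/-- Lebesgue measure on the slab `(0, t) × ℝ²`. -/
noncomputable abbrev slab (t : ℝ) : Measure (ℝ × Plane) :=
  (volume.restrict (Ioo 0 t)).prod (volume : Measure Plane)

theorem ae_slab {t : ℝ} {P : ℝ × Plane → Prop} (h : ∀ s ∈ Ioo 0 t, ∀ y, P (s, y)) :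
    ∀ᵐ p ∂slab t, P p := by
  have : slab t = volume.restrict (Ioo 0 t ×ˢ univ) := by
    rw [slab, Measure.volume_eq_prod, ← Measure.prod_restrict, Measure.restrict_univ]
  rw [this]
  refine (ae_restrict_iff' (measurableSet_Ioo.prod .univ)).2 (.of_forall fun p hp => ?_)
  exact h p.1 hp.1 p.2

theorem integrableOn_Ioo_sqrt_inv (t : ℝ) : IntegrableOn (fun s => (√s)⁻¹) (Ioo 0 t) := by
  rcases le_or_gt t 0 with ht | ht
  · simp [Ioo_eq_empty_of_le ht]
  have h := (intervalIntegral.intervalIntegrable_rpow' (a := 0) (b := t) (r := -(1 / 2))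
    (by norm_num)).1
  refine (h.mono_set Ioo_subset_Ioc_self).congr_fun (fun s hs => ?_) measurableSet_Ioo
  rw [Real.sqrt_eq_rpow, ← Real.rpow_neg hs.1.le]

theorem setIntegral_Ioo_sqrt_inv {t : ℝ} (ht : 0 < t) : ∫ s in Ioo 0 t, (√s)⁻¹ = 2 * √t := by
  rw [← integral_Ioc_eq_integral_Ioo, ← intervalIntegral.integral_of_le ht.le]
  have : ∫ s in (0 : ℝ)..t, (√s)⁻¹ = ∫ s in (0 : ℝ)..t, s ^ (-(1 / 2) : ℝ) := by
    refine intervalIntegral.integral_congr fun s hs => ?_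
    rw [uIcc_of_le ht.le] at hs
    rw [Real.sqrt_eq_rpow, ← Real.rpow_neg hs.1]
  rw [this, integral_rpow (Or.inl (by norm_num)), Real.sqrt_eq_rpow]
  norm_num
  ring

/-- Kernels of degree `3` are integrable over the slab of height `t`, with an integral `O(√t)`. -/
theorem integrable_slab_kernel {t : ℝ} (ht : 0 < t) :
    Integrable (fun p : ℝ × Plane => ((√p.1 + ‖p.2‖) ^ 3)⁻¹) (slab t) ∧
      ∫ p, ((√p.1 + ‖p.2‖) ^ 3)⁻¹ ∂slab t ≤ 4 * Real.pi * √t := by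
  have hm : AEStronglyMeasurable (fun p : ℝ × Plane => ((√p.1 + ‖p.2‖) ^ 3)⁻¹) (slab t) :=
    (by fun_prop : Measurable fun p : ℝ × Plane => ((√p.1 + ‖p.2‖) ^ 3)⁻¹).aestronglyMeasurable
  have hb : ∀ s ∈ Ioo 0 t, ∫ y : Plane, ((√s + ‖y‖) ^ 3)⁻¹ ≤ 2 * Real.pi * (√s)⁻¹ := fun s hs => by
    simpa using integral_add_norm_pow_inv_le 1 le_rfl (Real.sqrt_pos.2 hs.1)
  have hI : Integrable (fun p : ℝ × Plane => ((√p.1 + ‖p.2‖) ^ 3)⁻¹) (slab t) := by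
    rw [integrable_prod_iff hm]
    constructor
    · refine (ae_restrict_iff' measurableSet_Ioo).2 (.of_forall fun s hs => ?_)
      exact integrable_add_norm_pow_inv 1 le_rfl (Real.sqrt_pos.2 hs.1)
    · refine ((integrableOn_Ioo_sqrt_inv t).const_mul (2 * Real.pi)).mono'
        hm.norm.integral_prod_right' ?_
      refine (ae_restrict_iff' measurableSet_Ioo).2 (.of_forall fun s hs => ?_)
      have e : ∀ y : Plane, ‖((√s + ‖y‖) ^ 3)⁻¹‖ = ((√s + ‖y‖) ^ 3)⁻¹ := fun y =>
        Real.norm_of_nonneg (by positivity)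
      simp only [e]
      rw [Real.norm_of_nonneg (integral_nonneg fun y => by positivity)]
      exact hb s hs
  refine ⟨hI, ?_⟩
  rw [integral_prod _ hI]
  calc _ ≤ ∫ s in Ioo 0 t, 2 * Real.pi * (√s)⁻¹ :=
        setIntegral_mono_on hI.integral_prod_left ((integrableOn_Ioo_sqrt_inv t).const_mul _)
          measurableSet_Ioo hb
    _ = _ := by rw [integral_const_mul, setIntegral_Ioo_sqrt_inv ht]; ring

/-- Near the origin, a source bounded by `(√s + |y|)^{-2}` is dominated by the integrable function
`s^{-1/2} |y|^{-1}`. -/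
theorem integrable_slab_source (t R : ℝ) :
    Integrable (fun p : ℝ × Plane => (√p.1)⁻¹ * (Metric.ball 0 R).indicator (fun y => ‖y‖⁻¹) p.2)
      (slab t) :=
  Integrable.mul_prod (integrableOn_Ioo_sqrt_inv t)
    ((integrable_indicator_iff measurableSet_ball).2 (integrableOn_ball_norm_inv R))

theorem integral_slab_source {t R : ℝ} (ht : 0 < t) (hR : 0 ≤ R) :
    ∫ p : ℝ × Plane, (√p.1)⁻¹ * (Metric.ball 0 R).indicator (fun y => ‖y‖⁻¹) p.2 ∂slab t
      = 4 * Real.pi * R * √t := by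
  rw [integral_prod_mul (fun s : ℝ => (√s)⁻¹)
    (fun y : Plane => (Metric.ball 0 R).indicator (fun y => ‖y‖⁻¹) y),
    setIntegral_Ioo_sqrt_inv ht, integral_indicator measurableSet_ball,
    setIntegral_ball_norm_inv hR]
  ring

/-- The change of variables `(s, y) ↦ (t - s, x - y)` of space-time convolutions. -/
theorem measurePreserving_slab_reflect (t : ℝ) (x : Plane) :
    MeasurePreserving (fun p : ℝ × Plane => (t - p.1, x - p.2)) (slab t) (slab t) := by
  have h1 : MeasurePreserving (fun s : ℝ => t - s) (volume.restrict (Ioo 0 t))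
      (volume.restrict (Ioo 0 t)) := by
    have := ((volume : Measure ℝ).measurePreserving_sub_left t).restrict_preimage
      (measurableSet_Ioo (a := (0 : ℝ)) (b := t))
    simpa using this
  exact h1.prod ((volume : Measure Plane).measurePreserving_sub_left x)

theorem measurableEmbedding_reflect (t : ℝ) (x : Plane) :
    MeasurableEmbedding (fun p : ℝ × Plane => (t - p.1, x - p.2)) :=
  ((MeasurableEquiv.subLeft t).prodCongr (MeasurableEquiv.subLeft x)).measurableEmbedding

theorem integral_slab_reflect {F : Type*} [NormedAddCommGroup F] [NormedSpace ℝ F] (t : ℝ)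
    (x : Plane) (f : ℝ × Plane → F) :
    ∫ p, f (t - p.1, x - p.2) ∂slab t = ∫ p, f p ∂slab t :=
  (measurePreserving_slab_reflect t x).integral_comp (measurableEmbedding_reflect t x) f

theorem integrable_slab_reflect {F : Type*} [NormedAddCommGroup F] (t : ℝ)
    (x : Plane) (f : ℝ × Plane → F) :
    Integrable (fun p => f (t - p.1, x - p.2)) (slab t) ↔ Integrable f (slab t) :=
  (measurePreserving_slab_reflect t x).integrable_comp_emb (measurableEmbedding_reflect t x)


/-! ### The scalar Duhamel operator -/

/-- The Duhamel integral `∫_0^t ∫ K(x - y, t - s) w(y, s) dy ds` of a scalar source `w`. -/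
noncomputable def duhamel (K w : ℝ → Plane → ℝ) (t : ℝ) (x : Plane) : ℝ :=
  ∫ p, K (t - p.1) (x - p.2) * w p.1 p.2 ∂slab t

theorem sqrt_le_sqrt_add_sqrt_sub {s t : ℝ} (hs : 0 ≤ s) (hst : s ≤ t) : √t ≤ √s + √(t - s) := by
  rw [Real.sqrt_le_left (by positivity)]
  have h1 := Real.sq_sqrt hs
  have h2 := Real.sq_sqrt (sub_nonneg.2 hst)
  nlinarith [Real.sqrt_nonneg s, Real.sqrt_nonneg (t - s),
    mul_nonneg (Real.sqrt_nonneg s) (Real.sqrt_nonneg (t - s))]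

theorem ae_slab_ne_zero {t : ℝ} {P : ℝ × Plane → Prop}
    (h : ∀ s ∈ Ioo 0 t, ∀ y, y ≠ 0 → P (s, y)) : ∀ᵐ p ∂slab t, P p := by
  have h1 : ∀ᵐ p ∂slab t, p.2 ≠ 0 :=
    Measure.quasiMeasurePreserving_snd.ae (p := fun y : Plane => y ≠ 0) (by
      simp [ae_iff, measure_singleton])
  have h2 : ∀ᵐ p ∂slab t, p.2 ≠ 0 → P p := ae_slab fun s hs y hy => h s hs y hy
  filter_upwards [h1, h2] with p hp1 hp2 using hp2 hp1

theorem inv_sq_sqrt_add_norm_le {s : ℝ} (hs : 0 < s) {y : Plane} (hy : y ≠ 0) :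
    ((√s + ‖y‖) ^ 2)⁻¹ ≤ (√s)⁻¹ * ‖y‖⁻¹ := by
  have h1 : 0 < √s := Real.sqrt_pos.2 hs
  have h2 : 0 < ‖y‖ := norm_pos_iff.2 hy
  rw [← mul_inv]
  apply inv_anti₀ (by positivity)
  nlinarith

/-- The basic estimate of the Duhamel integral. Far from the parabolic origin the source is of size
`ρ^{-2}` and the kernel is integrable; near the origin the kernel is of size `ρ^{-3}` and the source
is integrable. Here `ρ = √t + |x|`. -/
theorem integrable_duhamel {K w : ℝ → Plane → ℝ} {C A t : ℝ}
    (hK : StronglyMeasurable (Function.uncurry K))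
    (hKb : ∀ τ, 0 < τ → ∀ z, |K τ z| ≤ C / (√τ + ‖z‖) ^ 3) (hC : 0 ≤ C)
    (hw : AEStronglyMeasurable (Function.uncurry w) (slab t)) (hA : 0 ≤ A)
    (hwb : ∀ᵐ p ∂slab t, |w p.1 p.2| ≤ A / (√p.1 + ‖p.2‖) ^ 2) (ht : 0 < t) (x : Plane) :
    Integrable (fun p : ℝ × Plane => K (t - p.1) (x - p.2) * w p.1 p.2) (slab t) ∧
      |duhamel K w t x| ≤ 32 * Real.pi * C * A * √t / (√t + ‖x‖) ^ 2 := by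
  have hst : 0 < √t := Real.sqrt_pos.2 ht
  set ρ := √t + ‖x‖ with hρ
  have hρ0 : 0 < ρ := by positivity
  let g : ℝ × Plane → ℝ := fun p =>
    4 * C * A / ρ ^ 2 * ((√(t - p.1) + ‖x - p.2‖) ^ 3)⁻¹ +
    8 * C * A / ρ ^ 3 * ((√p.1)⁻¹ * (Metric.ball 0 (ρ / 2)).indicator (fun y => ‖y‖⁻¹) p.2)
  have hI1 := integrable_slab_kernel ht
  have hI1' : Integrable (fun p : ℝ × Plane => ((√(t - p.1) + ‖x - p.2‖) ^ 3)⁻¹) (slab t) :=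
    (integrable_slab_reflect t x (fun p : ℝ × Plane => ((√p.1 + ‖p.2‖) ^ 3)⁻¹)).2 hI1.1
  have hI1'' : ∫ p : ℝ × Plane, ((√(t - p.1) + ‖x - p.2‖) ^ 3)⁻¹ ∂slab t ≤ 4 * Real.pi * √t := by
    rw [integral_slab_reflect t x (fun p : ℝ × Plane => ((√p.1 + ‖p.2‖) ^ 3)⁻¹)]
    exact hI1.2
  have hI2 := integrable_slab_source t (ρ / 2)
  have hg : Integrable g (slab t) := (hI1'.const_mul _).add (hI2.const_mul _)
  have hgi : ∫ p, g p ∂slab t ≤ 32 * Real.pi * C * A * √t / ρ ^ 2 := by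
    rw [integral_add (hI1'.const_mul _) (hI2.const_mul _), integral_const_mul, integral_const_mul,
      integral_slab_source ht (by positivity)]
    calc _ ≤ 4 * C * A / ρ ^ 2 * (4 * Real.pi * √t) +
          8 * C * A / ρ ^ 3 * (4 * Real.pi * (ρ / 2) * √t) := by gcongr
      _ = _ := by field_simp; ring
  have hm : AEStronglyMeasurable (fun p : ℝ × Plane => K (t - p.1) (x - p.2) * w p.1 p.2)
      (slab t) := by
    refine AEStronglyMeasurable.mul ?_ hw
    exact (hK.comp_measurable (by fun_prop : Measurable fun p : ℝ × Plane =>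
      (t - p.1, x - p.2))).aestronglyMeasurable
  have hle : ∀ᵐ p ∂slab t, ‖K (t - p.1) (x - p.2) * w p.1 p.2‖ ≤ g p := by
    have h0 : ∀ᵐ p ∂slab t, |w p.1 p.2| ≤ A / (√p.1 + ‖p.2‖) ^ 2 →
        ‖K (t - p.1) (x - p.2) * w p.1 p.2‖ ≤ g p := by
      refine ae_slab_ne_zero fun s hs y hy hwsy => ?_
      simp only at hwsy ⊢
      have hs1 : 0 < √s := Real.sqrt_pos.2 hs.1
      have hs2 : 0 < √(t - s) := Real.sqrt_pos.2 (sub_pos.2 hs.2)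
      have hy0 : 0 < ‖y‖ := norm_pos_iff.2 hy
      have hKs := hKb (t - s) (sub_pos.2 hs.2) (x - y)
      have hsum : ρ ≤ (√s + ‖y‖) + (√(t - s) + ‖x - y‖) := by
        have h1 := sqrt_le_sqrt_add_sqrt_sub hs.1.le hs.2.le
        have h2 : ‖x‖ ≤ ‖y‖ + ‖x - y‖ := norm_le_norm_add_norm_sub' x y
        rw [hρ]; linarith
      rw [norm_mul, Real.norm_eq_abs, Real.norm_eq_abs]
      have ha : 0 ≤ 4 * C * A / ρ ^ 2 * ((√(t - s) + ‖x - y‖) ^ 3)⁻¹ := by positivity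
      have hb : 0 ≤ 8 * C * A / ρ ^ 3 * ((√s)⁻¹ *
          (Metric.ball 0 (ρ / 2)).indicator (fun y => ‖y‖⁻¹) y) := by
        have : 0 ≤ (Metric.ball (0 : Plane) (ρ / 2)).indicator (fun y => ‖y‖⁻¹) y :=
          indicator_nonneg (fun y _ => by positivity) y
        positivity
      by_cases hcase : ρ / 2 ≤ √s + ‖y‖
      · refine le_add_of_le_of_nonneg ?_ hb
        calc _ ≤ C / (√(t - s) + ‖x - y‖) ^ 3 * (A / (√s + ‖y‖) ^ 2) := by gcongr
          _ ≤ C / (√(t - s) + ‖x - y‖) ^ 3 * (A / (ρ / 2) ^ 2) := by gcongr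
          _ = _ := by field_simp; norm_num
      · rw [not_le] at hcase
        refine le_add_of_nonneg_of_le ha ?_
        have hyb : y ∈ Metric.ball (0 : Plane) (ρ / 2) := by
          rw [mem_ball_zero_iff]; linarith
        rw [indicator_of_mem hyb]
        calc _ ≤ C / (√(t - s) + ‖x - y‖) ^ 3 * (A / (√s + ‖y‖) ^ 2) := by gcongr
          _ ≤ C / (ρ / 2) ^ 3 * (A / (√s + ‖y‖) ^ 2) := by
              gcongr; linarith
          _ = 8 * C * A / ρ ^ 3 * ((√s + ‖y‖) ^ 2)⁻¹ := by field_simp; norm_num; ring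
          _ ≤ _ := by
              gcongr
              exact inv_sq_sqrt_add_norm_le hs.1 hy
    filter_upwards [h0, hwb] with p hp1 hp2 using hp1 hp2
  exact ⟨hg.mono' hm hle, (norm_integral_le_of_norm_le hg hle).trans hgi⟩

theorem stronglyMeasurable_duhamel {K w : ℝ → Plane → ℝ}
    (hK : StronglyMeasurable (Function.uncurry K)) (hw : StronglyMeasurable (Function.uncurry w)) :
    StronglyMeasurable (Function.uncurry (duhamel K w)) := by
  have e : Function.uncurry (duhamel K w) = fun q : ℝ × Plane =>
      ∫ p : ℝ × Plane, {r : (ℝ × Plane) × (ℝ × Plane) | 0 < r.2.1 ∧ r.2.1 < r.1.1}.indicator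
        (fun r => K (r.1.1 - r.2.1) (r.1.2 - r.2.2) * w r.2.1 r.2.2) (q, p) := by
    funext q
    have h1 : slab q.1 = volume.restrict (Ioo 0 q.1 ×ˢ univ) := by
      rw [slab, Measure.volume_eq_prod, ← Measure.prod_restrict, Measure.restrict_univ]
    rw [Function.uncurry, duhamel, h1, ← integral_indicator (measurableSet_Ioo.prod .univ)]
    congr 1
    funext p
    simp only [indicator, mem_prod, mem_Ioo, mem_univ, and_true, mem_ofPred_eq]
  rw [e]
  refine StronglyMeasurable.integral_prod_right' ?_
  refine StronglyMeasurable.indicator ?_ ?_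
  · refine StronglyMeasurable.mul ?_ ?_
    · exact hK.comp_measurable (by fun_prop : Measurable fun r : (ℝ × Plane) × (ℝ × Plane) =>
        (r.1.1 - r.2.1, r.1.2 - r.2.2))
    · exact hw.comp_measurable (measurable_snd : Measurable fun r : (ℝ × Plane) × (ℝ × Plane) => r.2)
  · exact (measurableSet_lt measurable_const
      (measurable_fst.comp measurable_snd)).inter
      (measurableSet_lt (measurable_fst.comp measurable_snd) (measurable_fst.comp measurable_fst))

theorem IsXField.abs_le {θ : ℕ} {A : ℝ} {u : ℝ → Plane → ℝ} (hu : IsXField θ A u) {t : ℝ}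
    (ht : 0 < t) (x : Plane) : |u t x| ≤ A / (√t + ‖x‖) ^ θ := hu.norm_le ht x

theorem IsXField.nonneg {F : Type*} [NormedAddCommGroup F] [NormedSpace ℝ F] {θ : ℕ} {A : ℝ}
    {u : ℝ → Plane → F} (hu : IsXField θ A u) : 0 ≤ A := by
  have := (norm_nonneg _).trans (hu.norm_le one_pos 0)
  simpa using this

/-- Smoothness of the part of the Duhamel integral where the source is cut off near the parabolic
origin: all derivatives fall on the source. -/
theorem contDiff_duhamel_far {K W : ℝ → Plane → ℝ} {C t : ℝ} {b : ℕ → ℝ} (ht : 0 < t)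
    (hK : IsXField 3 C K) (hW : StronglyMeasurable (Function.uncurry W))
    (hWc : ∀ s, 0 < s → ContDiff ℝ 2 (W s))
    (hWb : ∀ s, 0 < s → ∀ k ≤ 2, ∀ y, ‖iteratedFDeriv ℝ k (W s) y‖ ≤ b k) :
    ContDiff ℝ 2 (duhamel K W t) ∧
      ∀ k ≤ 2, ∀ x, ‖iteratedFDeriv ℝ k (duhamel K W t) x‖ ≤ C * b k * (4 * Real.pi * √t) := by
  have e : duhamel K W t = fun x => ∫ p, K p.1 p.2 * W (t - p.1) (x - p.2) ∂slab t := by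
    funext x
    rw [← integral_slab_reflect t x (fun p => K p.1 p.2 * W (t - p.1) (x - p.2))]
    simp only [sub_sub_cancel, duhamel]
  have hI := integrable_slab_kernel ht
  have hb0 : ∀ k ≤ 2, 0 ≤ b k := fun k hk => (norm_nonneg _).trans (hWb 1 one_pos k hk 0)
  have hsh : ∀ s, 0 < s → ∀ z : Plane, ContDiff ℝ 2 (fun x => W s (x - z)) := fun s hs z =>
    (hWc s hs).comp (contDiff_id.sub contDiff_const)
  have := contDiffOn_integral_of_dominated (μ := slab t) (U := univ) isOpen_univ 2
    (h := fun p x => K p.1 p.2 * W (t - p.1) (x - p.2))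
    (b := fun k p => C * b k * ((√p.1 + ‖p.2‖) ^ 3)⁻¹)
    (fun x => by
      refine (StronglyMeasurable.mul hK.stronglyMeasurable ?_).aestronglyMeasurable
      exact hW.comp_measurable (by fun_prop : Measurable fun p : ℝ × Plane => (t - p.1, x - p.2)))
    (ae_slab fun s hs z => contDiff_const.mul (hsh (t - s) (sub_pos.2 hs.2) z))
    (fun k hk => hI.1.const_mul _)
    (ae_slab fun s hs z k hk x _ => by
      have hk' : (k : WithTop ℕ∞) ≤ 2 := by exact_mod_cast hk
      have h1 : (fun x => K s z * W (t - s) (x - z)) = (K s z) • fun x => W (t - s) (x - z) := rfl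
      simp only
      rw [h1, iteratedFDeriv_const_smul_apply
        (((hsh (t - s) (sub_pos.2 hs.2) z).of_le hk').contDiffAt), norm_smul,
        iteratedFDeriv_comp_sub]
      calc _ ≤ C / (√s + ‖z‖) ^ 3 * b k := by
            gcongr
            · have := hK.nonneg
              have := Real.sqrt_pos.2 hs.1
              positivity
            · exact hK.norm_le hs.1 z
            · exact hWb _ (sub_pos.2 hs.2) k hk _
        _ = _ := by ring)
  rw [← e] at this
  refine ⟨contDiffOn_univ.1 this.1, fun k hk x => (this.2 k hk x (mem_univ x)).trans ?_⟩
  rw [integral_const_mul]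
  have := hK.nonneg
  have := hb0 k hk
  gcongr
  exact hI.2

/-- Smoothness of the part of the Duhamel integral with a source located near the parabolic origin:
all derivatives fall on the kernel. -/
theorem contDiffOn_duhamel_near {K V : ℝ → Plane → ℝ} {C A t : ℝ} {x₀ : Plane} (ht : 0 < t)
    (hK : IsXField 3 C K) (hA : 0 ≤ A) (hV : StronglyMeasurable (Function.uncurry V))
    (hVb : ∀ s, 0 < s → ∀ y, |V s y| ≤ A / (√s + ‖y‖) ^ 2)
    (hVs : ∀ s, 0 < s → ∀ y, V s y ≠ 0 →
      √s ≤ (√t + ‖x₀‖) / 8 ∧ ‖y‖ ≤ (√t + ‖x₀‖) / 4) :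
    ContDiffOn ℝ 2 (duhamel K V t) (Metric.ball x₀ ((√t + ‖x₀‖) / 8)) ∧
      ∀ k ≤ 2, ∀ x ∈ Metric.ball x₀ ((√t + ‖x₀‖) / 8), ‖iteratedFDeriv ℝ k (duhamel K V t) x‖ ≤
        64 * Real.pi * C * A / (√t + ‖x₀‖) ^ (1 + k) := by
  have hst : 0 < √t := Real.sqrt_pos.2 ht
  set ρ := √t + ‖x₀‖ with hρ
  have hρ0 : 0 < ρ := by positivity
  have hC := hK.nonneg
  have hI := integrable_slab_source t (ρ / 2)
  have hsh : ∀ s, 0 < s → ∀ y : Plane, ContDiff ℝ 2 (fun x => K s (x - y)) := fun s hs y =>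
    (hK.contDiff s hs).comp (contDiff_id.sub contDiff_const)
  have := contDiffOn_integral_of_dominated (μ := slab t) (U := Metric.ball x₀ (ρ / 8))
    Metric.isOpen_ball 2
    (h := fun p x => K (t - p.1) (x - p.2) * V p.1 p.2)
    (b := fun k p => C * (2 / ρ) ^ (3 + k) * A *
      ((√p.1)⁻¹ * (Metric.ball 0 (ρ / 2)).indicator (fun y => ‖y‖⁻¹) p.2))
    (fun x => by
      refine (StronglyMeasurable.mul ?_ hV).aestronglyMeasurable
      exact hK.stronglyMeasurable.comp_measurable
        (by fun_prop : Measurable fun p : ℝ × Plane => (t - p.1, x - p.2)))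
    (ae_slab fun s hs y => (hsh (t - s) (sub_pos.2 hs.2) y).mul contDiff_const)
    (fun k hk => hI.const_mul _)
    (ae_slab_ne_zero fun s hs y hy k hk x hx => by
      have hk' : (k : WithTop ℕ∞) ≤ 2 := by exact_mod_cast hk
      have hy0 : 0 < ‖y‖ := norm_pos_iff.2 hy
      have hs1 : 0 < √s := Real.sqrt_pos.2 hs.1
      have h1 : (fun x => K (t - s) (x - y) * V s y) = (V s y) • fun x => K (t - s) (x - y) := by
        funext x; simp [mul_comm]
      simp only
      rw [h1, iteratedFDeriv_const_smul_apply
        (((hsh (t - s) (sub_pos.2 hs.2) y).of_le hk').contDiffAt), norm_smul,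
        iteratedFDeriv_comp_sub]
      by_cases hV0 : V s y = 0
      · rw [hV0, norm_zero, zero_mul]
        have : 0 ≤ (Metric.ball (0 : Plane) (ρ / 2)).indicator (fun y => ‖y‖⁻¹) y :=
          indicator_nonneg (fun y _ => by positivity) y
        positivity
      · obtain ⟨h2, h3⟩ := hVs s hs.1 y hV0
        have hyb : y ∈ Metric.ball (0 : Plane) (ρ / 2) := by
          rw [mem_ball_zero_iff]; linarith
        rw [indicator_of_mem hyb]
        have h4 : ρ / 2 ≤ √(t - s) + ‖x - y‖ := by
          have h5 := sqrt_le_sqrt_add_sqrt_sub hs.1.le hs.2.le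
          have h6 : ‖x₀‖ ≤ ‖y‖ + ‖x - y‖ + ρ / 8 := by
            rw [Metric.mem_ball, dist_eq_norm] at hx
            have e : x₀ = y + (x - y) - (x - x₀) := by abel
            calc ‖x₀‖ = ‖y + (x - y) - (x - x₀)‖ := by rw [← e]
              _ ≤ ‖y + (x - y)‖ + ‖x - x₀‖ := norm_sub_le _ _
              _ ≤ ‖y‖ + ‖x - y‖ + ρ / 8 := add_le_add (norm_add_le _ _) hx.le
          linarith
        calc _ ≤ A / (√s + ‖y‖) ^ 2 * (C / (√(t - s) + ‖x - y‖) ^ (3 + k)) := by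
              gcongr
              · exact hVb s hs.1 y
              · exact hK.bound _ (sub_pos.2 hs.2) k hk _
          _ ≤ A / (√s + ‖y‖) ^ 2 * (C / (ρ / 2) ^ (3 + k)) := by gcongr
          _ = C * (2 / ρ) ^ (3 + k) * A * ((√s + ‖y‖) ^ 2)⁻¹ := by
              rw [div_pow, div_pow]; field_simp
          _ ≤ _ := by
              gcongr
              exact inv_sq_sqrt_add_norm_le hs.1 hy)
  refine ⟨this.1, fun k hk x hx => (this.2 k hk x hx).trans ?_⟩
  rw [integral_const_mul, integral_slab_source ht (by positivity)]
  have h2 : (2 : ℝ) ^ (3 + k) ≤ 2 ^ 5 := pow_le_pow_right₀ (by norm_num) (by omega)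
  have h3 : √t ≤ ρ := by rw [hρ]; linarith [norm_nonneg x₀]
  calc C * (2 / ρ) ^ (3 + k) * A * (4 * Real.pi * (ρ / 2) * √t)
      = 2 ^ (3 + k) * (2 * Real.pi * C * A * √t) * ρ / ρ ^ (3 + k) := by rw [div_pow]; ring
    _ ≤ 2 ^ 5 * (2 * Real.pi * C * A * ρ) * ρ / ρ ^ (3 + k) := by gcongr
    _ = 64 * Real.pi * C * A / ρ ^ (1 + k) := by
      rw [show 3 + k = (1 + k) + 2 by ring, pow_add]
      field_simp
      norm_num
      ring

/-- The Duhamel operator with a kernel of degree `3` maps sources of degree `2` to fields of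
degree `1`, with two derivatives. -/
theorem exists_isXField_duhamel : ∃ D > 0, ∀ {K w : ℝ → Plane → ℝ} {C A : ℝ},
    IsXField 3 C K → IsXField 2 A w → IsXField 1 (D * C * A) (duhamel K w) := by
  obtain ⟨Cχ, hCχ, hcut⟩ := exists_cutoff
  have hpi := Real.pi_pos
  refine ⟨(4 * Cχ + 1) * 8 ^ 4 * (4 * Real.pi) + 64 * Real.pi, by positivity, ?_⟩
  intro K w C A hK hw
  have hC := hK.nonneg
  have hA := hw.nonneg
  have main : ∀ t, 0 < t → ∀ x₀ : Plane, ContDiffAt ℝ 2 (duhamel K w t) x₀ ∧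
      ∀ k ≤ 2, ‖iteratedFDeriv ℝ k (duhamel K w t) x₀‖ ≤
        ((4 * Cχ + 1) * 8 ^ 4 * (4 * Real.pi) + 64 * Real.pi) * C * A / (√t + ‖x₀‖) ^ (1 + k) := by
    intro t ht x₀
    have hst : 0 < √t := Real.sqrt_pos.2 ht
    set ρ := √t + ‖x₀‖ with hρ
    have hρ0 : 0 < ρ := by positivity
    obtain ⟨χ, hχ, hχ01, hχ0, hχ1, hχb⟩ := hcut ρ hρ0
    let W : ℝ → Plane → ℝ := fun s y => if s < (ρ / 8) ^ 2 then χ y * w s y else w s y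
    let V : ℝ → Plane → ℝ := fun s y => if s < (ρ / 8) ^ 2 then (1 - χ y) * w s y else 0
    have hset : MeasurableSet {p : ℝ × Plane | p.1 < (ρ / 8) ^ 2} :=
      measurableSet_lt (by fun_prop) (by fun_prop)
    have hχm : StronglyMeasurable fun p : ℝ × Plane => χ p.2 :=
      (hχ.continuous.comp continuous_snd).stronglyMeasurable
    have hWm : StronglyMeasurable (Function.uncurry W) :=
      StronglyMeasurable.ite hset (hχm.mul hw.stronglyMeasurable) hw.stronglyMeasurable
    have hVm : StronglyMeasurable (Function.uncurry V) :=
      StronglyMeasurable.ite hset ((stronglyMeasurable_const.sub hχm).mul hw.stronglyMeasurable)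
        stronglyMeasurable_const
    have hwb := fun s (hs : 0 < s) y => hw.abs_le hs y
    have hWle : ∀ s, 0 < s → ∀ y, |W s y| ≤ A / (√s + ‖y‖) ^ 2 := by
      intro s hs y
      refine le_trans ?_ (hwb s hs y)
      simp only [W]
      split_ifs
      · rw [abs_mul, abs_of_nonneg (hχ01 y).1]
        exact mul_le_of_le_one_left (abs_nonneg _) (hχ01 y).2
      · exact le_rfl
    have hVle : ∀ s, 0 < s → ∀ y, |V s y| ≤ A / (√s + ‖y‖) ^ 2 := by
      intro s hs y
      refine le_trans ?_ (hwb s hs y)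
      simp only [V]
      split_ifs
      · rw [abs_mul, abs_of_nonneg (sub_nonneg.2 (hχ01 y).2)]
        exact mul_le_of_le_one_left (abs_nonneg _) (by linarith [(hχ01 y).1])
      · rw [abs_zero]; positivity
    have hVs : ∀ s, 0 < s → ∀ y, V s y ≠ 0 → √s ≤ ρ / 8 ∧ ‖y‖ ≤ ρ / 4 := by
      intro s hs y hV
      simp only [V] at hV
      split_ifs at hV with h1
      · refine ⟨(Real.sqrt_le_left (by positivity)).2 h1.le, ?_⟩
        by_contra h2
        rw [not_le] at h2
        rw [hχ1 y h2.le] at hV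
        simp at hV
      · simp at hV
    have hbd : ∀ s, 0 < s → ∀ k ≤ 2, ∀ y : Plane, ρ / 8 ≤ √s + ‖y‖ →
        ‖iteratedFDeriv ℝ k (w s) y‖ ≤ 8 ^ 4 * A / ρ ^ 2 / ρ ^ k := by
      intro s hs k hk y hy
      refine (hw.bound s hs k hk y).trans ?_
      calc _ ≤ A / (ρ / 8) ^ (2 + k) := by gcongr
        _ = 8 ^ (2 + k) * A / ρ ^ (2 + k) := by rw [div_pow]; field_simp
        _ ≤ 8 ^ 4 * A / ρ ^ (2 + k) := by
          have : (8 : ℝ) ^ (2 + k) ≤ 8 ^ 4 := pow_le_pow_right₀ (by norm_num) (by omega)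
          gcongr
        _ = _ := by rw [pow_add, div_div]
    have hW : ∀ s, 0 < s → ContDiff ℝ 2 (W s) ∧ ∀ k ≤ 2, ∀ y, ‖iteratedFDeriv ℝ k (W s) y‖ ≤
        (4 * Cχ + 1) * (8 ^ 4 * A / ρ ^ 2) / ρ ^ k := by
      intro s hs
      by_cases h1 : s < (ρ / 8) ^ 2
      · have e : W s = fun y => χ y • w s y := by
          funext y; simp only [W, if_pos h1, smul_eq_mul]
        rw [e]
        have h2 := contDiff_cutoff_smul hρ0 hCχ hχ hχ0 hχb (hw.contDiff s hs).contDiffOn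
          (B := 8 ^ 4 * A / ρ ^ 2) (fun k hk y hy => hbd s hs k hk y (by
            linarith [Real.sqrt_nonneg s]))
        refine ⟨h2.1, fun k hk y => (h2.2 k hk y).trans ?_⟩
        gcongr
        linarith
      · have e : W s = w s := by
          funext y; simp only [W, if_neg h1]
        rw [e]
        refine ⟨hw.contDiff s hs, fun k hk y => (hbd s hs k hk y ?_).trans ?_⟩
        · have : ρ / 8 ≤ √s := Real.le_sqrt_of_sq_le (not_lt.1 h1)
          linarith [norm_nonneg y]
        · gcongr
          exact le_mul_of_one_le_left (by positivity) (by linarith)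
    have hsplit : duhamel K w t = duhamel K W t + duhamel K V t := by
      funext x
      have i1 := (integrable_duhamel (A := A) hK.stronglyMeasurable (fun τ hτ z => hK.abs_le hτ z)
        hC hWm.aestronglyMeasurable hA (ae_slab fun s hs y => hWle s hs.1 y) ht x).1
      have i2 := (integrable_duhamel (A := A) hK.stronglyMeasurable (fun τ hτ z => hK.abs_le hτ z)
        hC hVm.aestronglyMeasurable hA (ae_slab fun s hs y => hVle s hs.1 y) ht x).1
      rw [Pi.add_apply, duhamel, duhamel, duhamel, ← integral_add i1 i2]
      congr 1
      funext p
      simp only [W, V]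
      split_ifs <;> ring
    have hf := contDiff_duhamel_far ht hK hWm (fun s hs => (hW s hs).1)
      (b := fun k => (4 * Cχ + 1) * (8 ^ 4 * A / ρ ^ 2) / ρ ^ k) (fun s hs => (hW s hs).2)
    have hn := contDiffOn_duhamel_near (x₀ := x₀) ht hK hA hVm hVle hVs
    have hmem : x₀ ∈ Metric.ball x₀ (ρ / 8) := Metric.mem_ball_self (by positivity)
    have hnc : ContDiffAt ℝ 2 (duhamel K V t) x₀ :=
      hn.1.contDiffAt (Metric.isOpen_ball.mem_nhds hmem)
    rw [hsplit]
    refine ⟨hf.1.contDiffAt.add hnc, fun k hk => ?_⟩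
    have hk' : (k : WithTop ℕ∞) ≤ 2 := by exact_mod_cast hk
    rw [iteratedFDeriv_add_apply (hf.1.of_le hk').contDiffAt (hnc.of_le hk'), add_mul, add_mul,
      add_div]
    refine (norm_add_le _ _).trans (add_le_add ?_ (hn.2 k hk x₀ hmem))
    refine (hf.2 k hk x₀).trans ?_
    have h3 : √t ≤ ρ := by rw [hρ]; linarith [norm_nonneg x₀]
    calc C * ((4 * Cχ + 1) * (8 ^ 4 * A / ρ ^ 2) / ρ ^ k) * (4 * Real.pi * √t)
        ≤ C * ((4 * Cχ + 1) * (8 ^ 4 * A / ρ ^ 2) / ρ ^ k) * (4 * Real.pi * ρ) := by gcongr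
      _ = _ := by rw [pow_add]; field_simp
  exact ⟨stronglyMeasurable_duhamel hK.stronglyMeasurable hw.stronglyMeasurable,
    fun t ht => contDiff_iff_contDiffAt.2 fun x => (main t ht x).1,
    fun t ht k hk x => (main t ht x).2 k hk⟩


/-! ### The heat flow of the datum -/

/-- A vector field of class `C^2` off the origin with `|∂^α a| ≤ A |x|^{-1-|α|}` for `|α| ≤ 2`. -/
structure IsDatum (A : ℝ) (a : Plane → Plane) : Prop where
  contDiffOn : ContDiffOn ℝ 2 a {x | x ≠ 0}
  bound : ∀ k ≤ 2, ∀ x, x ≠ 0 → ‖iteratedFDeriv ℝ k a x‖ ≤ A / ‖x‖ ^ (1 + k)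

theorem IsDatum.norm_le {A : ℝ} {a : Plane → Plane} (ha : IsDatum A a) {x : Plane} (hx : x ≠ 0) :
    ‖a x‖ ≤ A / ‖x‖ := by
  simpa using ha.bound 0 (by omega) x hx

theorem basisVec_ne_zero (i : Fin 2) : basisVec i ≠ 0 := by
  rw [← norm_pos_iff, norm_basisVec]; exact one_pos

theorem IsDatum.nonneg {A : ℝ} {a : Plane → Plane} (ha : IsDatum A a) : 0 ≤ A := by
  have := (norm_nonneg _).trans (ha.norm_le (basisVec_ne_zero 0))
  rwa [norm_basisVec, div_one] at this

theorem IsDatum.stronglyMeasurable {A : ℝ} {a : Plane → Plane} (ha : IsDatum A a) :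
    StronglyMeasurable a :=
  (measurable_of_continuousOn_compl_singleton 0 (by
    have := ha.contDiffOn.continuousOn
    exact this)).stronglyMeasurable

/-- The heat flow of `a`, extended by zero to nonpositive times. -/
noncomputable def heatField (a : Plane → Plane) (t : ℝ) (x : Plane) : Plane :=
  if 0 < t then heatFlow t a x else 0

theorem stronglyMeasurable_heatField {a : Plane → Plane} (ha : StronglyMeasurable a) :
    StronglyMeasurable (Function.uncurry (heatField a)) := by
  have h : StronglyMeasurable (Function.uncurry fun t x => heatFlow t a x) := by
    refine StronglyMeasurable.integral_prod_right' (f := fun r : (ℝ × Plane) × Plane =>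
      heatKernel r.1.1 (r.1.2 - r.2) • a r.2) ?_
    have h1 : StronglyMeasurable fun r : (ℝ × Plane) × Plane => heatKernel r.1.1 (r.1.2 - r.2) :=
      (measurable_heatKernel.comp (by fun_prop : Measurable fun r : (ℝ × Plane) × Plane =>
        (r.1.1, r.1.2 - r.2))).stronglyMeasurable
    exact h1.smul (ha.comp_measurable measurable_snd)
  exact StronglyMeasurable.ite (measurableSet_lt measurable_const measurable_fst) h
    stronglyMeasurable_const

theorem exists_heatKernel_bounds : ∃ C > 0, ∀ k ≤ 2, ∀ s : ℝ, 0 < s → ∀ x : Plane,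
    ‖iteratedFDeriv ℝ k (heatKernel s) x‖ ≤ C * s / (√s + ‖x‖) ^ (4 + k) :=
  exists_forall_le_of_forall_exists 2 exists_norm_iteratedFDeriv_heatKernel_le (by
    intro m C C' hCC h s hs x
    exact (h s hs x).trans (by gcongr))

theorem heatKernel_nonneg {t : ℝ} (ht : 0 < t) (x : Plane) : 0 ≤ heatKernel t x := by
  unfold heatKernel
  have := Real.pi_pos
  positivity

theorem measurable_heatKernel_apply (t : ℝ) : Measurable (heatKernel t) :=
  measurable_heatKernel.comp (measurable_const.prodMk measurable_id)

theorem integrable_weight {t : ℝ} (ht : 0 < t) :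
    Integrable (fun z : Plane => t * ((√t + ‖z‖) ^ 4)⁻¹) ∧
      ∫ z : Plane, t * ((√t + ‖z‖) ^ 4)⁻¹ ≤ 2 * Real.pi := by
  have hst : 0 < √t := Real.sqrt_pos.2 ht
  refine ⟨(integrable_add_norm_pow_inv 2 (by omega) hst).const_mul t, ?_⟩
  rw [integral_const_mul]
  have := integral_add_norm_pow_inv_le 2 (by omega) hst
  rw [Real.sq_sqrt ht.le] at this
  calc _ ≤ t * (2 * Real.pi * t⁻¹) := by gcongr
    _ = _ := by field_simp

theorem heatFlow_eq_integral_sub (t : ℝ) (a : Plane → Plane) (x : Plane) :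
    heatFlow t a x = ∫ z, heatKernel t z • a (x - z) := by
  rw [heatFlow, ← integral_sub_left_eq_self (fun z => heatKernel t z • a (x - z)) volume x]
  simp only [sub_sub_cancel]

/-- The heat flow of a datum of degree `1` is a field of degree `1`. -/
theorem exists_isXField_heatField : ∃ D > 0, ∀ {a : Plane → Plane} {A : ℝ}, IsDatum A a →
    IsXField 1 (D * A) (heatField a) := by
  obtain ⟨Cχ, hCχ, hcut⟩ := exists_cutoff
  obtain ⟨C, hC, hg⟩ := exists_heatKernel_bounds
  have hpi := Real.pi_pos
  refine ⟨C * (4 * Cχ * 8 ^ 3) * (2 * Real.pi) + 16 * Real.pi * C, by positivity, ?_⟩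
  intro a A ha
  have hA := ha.nonneg
  have main : ∀ t, 0 < t → ∀ x₀ : Plane, ContDiffAt ℝ 2 (heatFlow t a) x₀ ∧
      ∀ k ≤ 2, ‖iteratedFDeriv ℝ k (heatFlow t a) x₀‖ ≤
        (C * (4 * Cχ * 8 ^ 3) * (2 * Real.pi) + 16 * Real.pi * C) * A / (√t + ‖x₀‖) ^ (1 + k) := by
    intro t ht x₀
    have hst : 0 < √t := Real.sqrt_pos.2 ht
    set ρ := √t + ‖x₀‖ with hρ
    have hρ0 : 0 < ρ := by positivity
    obtain ⟨χ, hχ, hχ01, hχ0, hχ1, hχb⟩ := hcut ρ hρ0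
    have hgm := measurable_heatKernel_apply t
    have hw := integrable_weight ht
    have hg0 : ∀ z, ‖heatKernel t z‖ ≤ C * (t * ((√t + ‖z‖) ^ 4)⁻¹) := fun z => by
      have := hg 0 (by omega) t ht z
      rw [norm_iteratedFDeriv_zero, add_zero] at this
      exact this.trans (le_of_eq (by ring))
    have hgk : ∀ k ≤ 2, ∀ z, ‖iteratedFDeriv ℝ k (heatKernel t) z‖ ≤ C / (√t + ‖z‖) ^ (2 + k) := by
      intro k hk z
      refine (hg k hk t ht z).trans ?_
      rw [div_le_div_iff₀ (by positivity) (by positivity)]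
      calc _ ≤ C * (√t + ‖z‖) ^ 2 * (√t + ‖z‖) ^ (2 + k) := by
            gcongr; exact le_sq_sqrt_add ht (norm_nonneg z)
        _ = _ := by ring
    let W : Plane → Plane := fun y => χ y • a y
    let V : Plane → Plane := fun y => (1 - χ y) • a y
    have hWm : StronglyMeasurable W := hχ.continuous.stronglyMeasurable.smul ha.stronglyMeasurable
    have hVm : StronglyMeasurable V :=
      (stronglyMeasurable_const.sub hχ.continuous.stronglyMeasurable).smul ha.stronglyMeasurable
    have hW := contDiff_cutoff_smul hρ0 hCχ hχ hχ0 hχb ha.contDiffOn (B := 8 ^ 3 * A / ρ)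
      (fun k hk y hy => by
        have hy0 : 0 < ‖y‖ := lt_of_lt_of_le (by positivity) hy
        refine (ha.bound k hk y (norm_pos_iff.1 hy0)).trans ?_
        calc _ ≤ A / (ρ / 8) ^ (1 + k) := by gcongr
          _ = 8 ^ (1 + k) * A / ρ ^ (1 + k) := by rw [div_pow]; field_simp
          _ ≤ 8 ^ 3 * A / ρ ^ (1 + k) := by
            have : (8 : ℝ) ^ (1 + k) ≤ 8 ^ 3 := pow_le_pow_right₀ (by norm_num) (by omega)
            gcongr
          _ = _ := by rw [pow_add, pow_one, div_div])
    have hWc : ContDiff ℝ 2 W := hW.1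
    have hWb : ∀ k ≤ 2, ∀ y, ‖iteratedFDeriv ℝ k W y‖ ≤ 4 * Cχ * (8 ^ 3 * A / ρ) / ρ ^ k := hW.2
    have hV0 : ∀ y, ρ / 4 < ‖y‖ → V y = 0 := fun y hy => by
      simp only [V, hχ1 y hy.le, sub_self, zero_smul]
    have hVb : ∀ y, y ≠ 0 → ‖V y‖ ≤ A * (Metric.ball 0 (ρ / 2)).indicator (fun y => ‖y‖⁻¹) y := by
      intro y hy
      by_cases h1 : ρ / 4 < ‖y‖
      · rw [hV0 y h1, norm_zero]
        have : 0 ≤ (Metric.ball (0 : Plane) (ρ / 2)).indicator (fun y => ‖y‖⁻¹) y :=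
          indicator_nonneg (fun y _ => by positivity) y
        positivity
      · have hyb : y ∈ Metric.ball (0 : Plane) (ρ / 2) := by
          rw [mem_ball_zero_iff]; linarith
        rw [indicator_of_mem hyb, norm_smul, Real.norm_of_nonneg (sub_nonneg.2 (hχ01 y).2)]
        calc _ ≤ 1 * (A / ‖y‖) := by
              gcongr
              · linarith [(hχ01 y).1]
              · exact ha.norm_le hy
          _ = _ := by rw [one_mul, div_eq_mul_inv]
    have hne : ∀ᵐ y : Plane, y ≠ 0 := by simp [ae_iff, measure_singleton]
    have hIball : Integrable ((Metric.ball (0 : Plane) (ρ / 2)).indicator fun y => ‖y‖⁻¹) :=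
      (integrable_indicator_iff measurableSet_ball).2 (integrableOn_ball_norm_inv _)
    have hIballv : ∫ y, (Metric.ball (0 : Plane) (ρ / 2)).indicator (fun y => ‖y‖⁻¹) y
        = Real.pi * ρ := by
      rw [integral_indicator measurableSet_ball, setIntegral_ball_norm_inv (by positivity)]
      ring
    -- the far part: derivatives fall on the datum
    have hfar := contDiffOn_integral_of_dominated (μ := (volume : Measure Plane)) (U := univ)
      isOpen_univ 2 (h := fun z x => heatKernel t z • W (x - z))
      (b := fun k z => C * (4 * Cχ * (8 ^ 3 * A / ρ) / ρ ^ k) * (t * ((√t + ‖z‖) ^ 4)⁻¹))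
      (fun x => (hgm.stronglyMeasurable.smul (hWm.comp_measurable
        (by fun_prop : Measurable fun z : Plane => x - z))).aestronglyMeasurable)
      (.of_forall fun z => (hWc.comp (contDiff_id.sub contDiff_const)).const_smul _)
      (fun k hk => hw.1.const_mul _)
      (.of_forall fun z k hk x _ => by
        have hk' : (k : WithTop ℕ∞) ≤ 2 := by exact_mod_cast hk
        have hsh : ContDiff ℝ 2 fun x => W (x - z) := hWc.comp (contDiff_id.sub contDiff_const)
        rw [iteratedFDeriv_const_smul_apply' (hsh.of_le hk').contDiffAt, norm_smul,
          iteratedFDeriv_comp_sub]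
        calc _ ≤ C * (t * ((√t + ‖z‖) ^ 4)⁻¹) * (4 * Cχ * (8 ^ 3 * A / ρ) / ρ ^ k) := by
              gcongr
              · exact hg0 z
              · exact hWb k hk _
          _ = _ := by ring)
    -- the near part: derivatives fall on the kernel
    have hnear := contDiffOn_integral_of_dominated (μ := (volume : Measure Plane))
      (U := Metric.ball x₀ (ρ / 8)) Metric.isOpen_ball 2
      (h := fun y x => heatKernel t (x - y) • V y)
      (b := fun k y => C * (2 / ρ) ^ (2 + k) * A *
        (Metric.ball 0 (ρ / 2)).indicator (fun y => ‖y‖⁻¹) y)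
      (fun x => ((hgm.comp (by fun_prop : Measurable fun y : Plane => x - y)
        ).stronglyMeasurable.smul hVm).aestronglyMeasurable)
      (.of_forall fun y => ((contDiff_heatKernel t 2).comp
        (contDiff_id.sub contDiff_const)).smul contDiff_const)
      (fun k hk => hIball.const_mul _)
      (by
        filter_upwards [hne] with y hy k hk x hx
        have hk' : (k : WithTop ℕ∞) ≤ 2 := by exact_mod_cast hk
        have hsh : ContDiff ℝ 2 fun x => heatKernel t (x - y) :=
          (contDiff_heatKernel t 2).comp (contDiff_id.sub contDiff_const)
        have h1 : ‖iteratedFDeriv ℝ k (fun x => heatKernel t (x - y) • V y) x‖ ≤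
            ‖iteratedFDeriv ℝ k (heatKernel t) (x - y)‖ * ‖V y‖ := by
          have := ((ContinuousLinearMap.id ℝ ℝ).smulRight (V y)).norm_iteratedFDeriv_comp_left
            (f := fun x => heatKernel t (x - y)) (x := x) (hsh.of_le hk').contDiffAt le_rfl
          rw [iteratedFDeriv_comp_sub] at this
          refine this.trans ?_
          rw [mul_comm]
          gcongr
          refine ContinuousLinearMap.opNorm_le_bound _ (norm_nonneg _) fun c => ?_
          simp [norm_smul, mul_comm]
        refine h1.trans ?_
        by_cases h2 : ρ / 4 < ‖y‖
        · rw [hV0 y h2, norm_zero, mul_zero]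
          have : 0 ≤ (Metric.ball (0 : Plane) (ρ / 2)).indicator (fun y => ‖y‖⁻¹) y :=
            indicator_nonneg (fun y _ => by positivity) y
          positivity
        · have h4 : ρ / 2 ≤ √t + ‖x - y‖ := by
            have h6 : ‖x₀‖ ≤ ‖y‖ + ‖x - y‖ + ρ / 8 := by
              rw [Metric.mem_ball, dist_eq_norm] at hx
              have e : x₀ = y + (x - y) - (x - x₀) := by abel
              calc ‖x₀‖ = ‖y + (x - y) - (x - x₀)‖ := by rw [← e]
                _ ≤ ‖y + (x - y)‖ + ‖x - x₀‖ := norm_sub_le _ _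
                _ ≤ ‖y‖ + ‖x - y‖ + ρ / 8 := add_le_add (norm_add_le _ _) hx.le
            linarith
          calc _ ≤ C / (ρ / 2) ^ (2 + k) *
                (A * (Metric.ball 0 (ρ / 2)).indicator (fun y => ‖y‖⁻¹) y) := by
                gcongr
                · exact (hgk k hk (x - y)).trans (by gcongr)
                · exact hVb y hy
            _ = _ := by rw [div_pow, div_pow]; field_simp)
    have efar : ∀ x, ∫ z, heatKernel t z • W (x - z) = heatFlow t W x := fun x =>
      (heatFlow_eq_integral_sub t W x).symm
    have hsplit : heatFlow t a = heatFlow t W + heatFlow t V := by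
      funext x
      have hsub : Integrable fun y => C * (t * ((√t + ‖x - y‖) ^ 4)⁻¹) :=
        ((integrable_comp_sub_left (fun z : Plane => t * ((√t + ‖z‖) ^ 4)⁻¹) x).2 hw.1).const_mul C
      have hgxm : StronglyMeasurable fun y : Plane => heatKernel t (x - y) :=
        (hgm.comp (by fun_prop : Measurable fun y : Plane => x - y)).stronglyMeasurable
      have i1 : Integrable fun y => heatKernel t (x - y) • W y := by
        refine (hsub.mul_const (4 * Cχ * (8 ^ 3 * A / ρ))).mono'
          (hgxm.smul hWm).aestronglyMeasurable (.of_forall fun y => ?_)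
        rw [norm_smul]
        have := hWb 0 (by omega) y
        rw [norm_iteratedFDeriv_zero, pow_zero, div_one] at this
        gcongr
        exact hg0 _
      have i2 : Integrable fun y => heatKernel t (x - y) • V y := by
        refine ((hIball.const_mul A).const_mul (C / √t ^ 2)).mono'
          (hgxm.smul hVm).aestronglyMeasurable ?_
        filter_upwards [hne] with y hy
        rw [norm_smul]
        gcongr
        · have := hgk 0 (by omega) (x - y)
          rw [norm_iteratedFDeriv_zero, add_zero] at this
          refine this.trans ?_
          gcongr
          linarith [norm_nonneg (x - y)]
        · exact hVb y hy
      rw [Pi.add_apply, heatFlow, heatFlow, heatFlow, ← integral_add i1 i2]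
      congr 1
      funext y
      simp only [W, V]
      module
    simp only [efar] at hfar
    have hmem : x₀ ∈ Metric.ball x₀ (ρ / 8) := Metric.mem_ball_self (by positivity)
    have hfc : ContDiffAt ℝ 2 (heatFlow t W) x₀ := (contDiffOn_univ.1 hfar.1).contDiffAt
    have hnc : ContDiffAt ℝ 2 (heatFlow t V) x₀ :=
      hnear.1.contDiffAt (Metric.isOpen_ball.mem_nhds hmem)
    rw [hsplit]
    refine ⟨hfc.add hnc, fun k hk => ?_⟩
    have hk' : (k : WithTop ℕ∞) ≤ 2 := by exact_mod_cast hk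
    rw [iteratedFDeriv_add_apply (hfc.of_le hk') (hnc.of_le hk'), add_mul, add_div]
    refine (norm_add_le _ _).trans (add_le_add ?_ ?_)
    · refine (hfar.2 k hk x₀ (mem_univ _)).trans ?_
      rw [integral_const_mul]
      calc _ ≤ C * (4 * Cχ * (8 ^ 3 * A / ρ) / ρ ^ k) * (2 * Real.pi) := by gcongr; exact hw.2
        _ = _ := by rw [pow_add, pow_one]; field_simp
    · refine (hnear.2 k hk x₀ hmem).trans ?_
      rw [integral_const_mul, hIballv]
      have h2 : (2 : ℝ) ^ (2 + k) ≤ 2 ^ 4 := pow_le_pow_right₀ (by norm_num) (by omega)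
      calc _ = 2 ^ (2 + k) * (Real.pi * C * A) * ρ / ρ ^ (2 + k) := by rw [div_pow]; ring
        _ ≤ 2 ^ 4 * (Real.pi * C * A) * ρ / ρ ^ (2 + k) := by gcongr
        _ = _ := by
          rw [show 2 + k = (1 + k) + 1 by ring, pow_succ]
          field_simp
          norm_num
          ring
  have e : ∀ t, 0 < t → heatField a t = heatFlow t a := fun t ht => by
    funext x; rw [heatField, if_pos ht]
  refine ⟨stronglyMeasurable_heatField ha.stronglyMeasurable, fun t ht => ?_, fun t ht k hk x => ?_⟩
  · rw [e t ht]
    exact contDiff_iff_contDiffAt.2 fun x => (main t ht x).1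
  · rw [e t ht]
    exact (main t ht x).2 k hk


/-! ### Operations on fields -/

section Operations

variable {F G : Type*} [NormedAddCommGroup F] [NormedSpace ℝ F] [NormedAddCommGroup G]
  [NormedSpace ℝ G] {θ : ℕ} {A B : ℝ}

theorem IsXField.mono {u : ℝ → Plane → F} (hu : IsXField θ A u) (h : A ≤ B) : IsXField θ B u :=
  ⟨hu.stronglyMeasurable, hu.contDiff, fun t ht k hk x => (hu.bound t ht k hk x).trans (by gcongr)⟩

theorem IsXField.add {u v : ℝ → Plane → F} (hu : IsXField θ A u) (hv : IsXField θ B v) :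
    IsXField θ (A + B) (fun t x => u t x + v t x) := by
  refine ⟨hu.stronglyMeasurable.add hv.stronglyMeasurable,
    fun t ht => (hu.contDiff t ht).add (hv.contDiff t ht), fun t ht k hk x => ?_⟩
  have hk' : (k : WithTop ℕ∞) ≤ 2 := by exact_mod_cast hk
  have e : (fun x => u t x + v t x) = u t + v t := rfl
  rw [e, iteratedFDeriv_add_apply ((hu.contDiff t ht).of_le hk').contDiffAt
    ((hv.contDiff t ht).of_le hk').contDiffAt, add_div]
  exact (norm_add_le _ _).trans (add_le_add (hu.bound t ht k hk x) (hv.bound t ht k hk x))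

theorem IsXField.clm_comp {u : ℝ → Plane → F} (hu : IsXField θ A u) (L : F →L[ℝ] G)
    (hL : ‖L‖ ≤ 1) : IsXField θ A (fun t x => L (u t x)) := by
  refine ⟨L.continuous.comp_stronglyMeasurable hu.stronglyMeasurable,
    fun t ht => L.contDiff.comp (hu.contDiff t ht), fun t ht k hk x => ?_⟩
  have hk' : (k : WithTop ℕ∞) ≤ 2 := by exact_mod_cast hk
  refine (L.norm_iteratedFDeriv_comp_left (hu.contDiff t ht).contDiffAt hk').trans ?_
  exact (mul_le_of_le_one_left (norm_nonneg _) hL).trans (hu.bound t ht k hk x)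

theorem IsXField.neg {u : ℝ → Plane → F} (hu : IsXField θ A u) :
    IsXField θ A (fun t x => - u t x) := by
  have := hu.clm_comp (-ContinuousLinearMap.id ℝ F) (by
    rw [norm_neg]; exact ContinuousLinearMap.norm_id_le)
  simpa using this

theorem IsXField.sub {u v : ℝ → Plane → F} (hu : IsXField θ A u) (hv : IsXField θ B v) :
    IsXField θ (A + B) (fun t x => u t x - v t x) := by
  simpa only [sub_eq_add_neg] using hu.add hv.neg

theorem isXField_zero (θ : ℕ) : IsXField θ 0 (fun (_ : ℝ) (_ : Plane) => (0 : F)) :=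
  ⟨stronglyMeasurable_const, fun t _ => contDiff_const, fun t ht k hk x => by
    rw [iteratedFDeriv_fun_zero]; simp⟩

theorem IsXField.finset_sum {ι : Type*} (s : Finset ι) {c : ι → ℝ} {u : ι → ℝ → Plane → F}
    (hu : ∀ i, IsXField θ (c i) (u i)) :
    IsXField θ (∑ i ∈ s, c i) (fun t x => ∑ i ∈ s, u i t x) := by
  classical
  induction s using Finset.induction_on with
  | empty => simpa using isXField_zero θ
  | insert i s hi ih =>
    simp only [Finset.sum_insert hi]
    exact (hu i).add ih

theorem IsXField.mul {f g : ℝ → Plane → ℝ} (hf : IsXField 1 A f) (hg : IsXField 1 B g) :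
    IsXField 2 (4 * A * B) (fun t x => f t x * g t x) := by
  have hA := hf.nonneg
  have hB := hg.nonneg
  refine ⟨hf.stronglyMeasurable.mul hg.stronglyMeasurable,
    fun t ht => (hf.contDiff t ht).mul (hg.contDiff t ht), fun t ht k hk x => ?_⟩
  have hk' : (k : WithTop ℕ∞) ≤ 2 := by exact_mod_cast hk
  have hst : 0 < √t := Real.sqrt_pos.2 ht
  have hρ : 0 < √t + ‖x‖ := by positivity
  refine (norm_iteratedFDeriv_mul_le (hf.contDiff t ht) (hg.contDiff t ht) x hk').trans ?_
  have h1 : ∀ i ∈ Finset.range (k + 1), (k.choose i : ℝ) * ‖iteratedFDeriv ℝ i (f t) x‖ *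
      ‖iteratedFDeriv ℝ (k - i) (g t) x‖ ≤ (k.choose i : ℝ) * (A * B / (√t + ‖x‖) ^ (2 + k)) := by
    intro i hi
    have hi' : i ≤ k := Nat.lt_succ_iff.1 (Finset.mem_range.1 hi)
    calc _ ≤ (k.choose i : ℝ) * (A / (√t + ‖x‖) ^ (1 + i)) *
          (B / (√t + ‖x‖) ^ (1 + (k - i))) := by
          gcongr
          · exact hf.bound t ht i (hi'.trans hk) x
          · exact hg.bound t ht (k - i) (by omega) x
      _ = _ := by
          rw [show 2 + k = (1 + i) + (1 + (k - i)) by omega, pow_add _ (1 + i)]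
          field_simp
  refine (Finset.sum_le_sum h1).trans ?_
  rw [← Finset.sum_mul, ← Nat.cast_sum, Nat.sum_range_choose, mul_assoc 4 A B, mul_div_assoc 4]
  have h2 : ((2 ^ k : ℕ) : ℝ) ≤ 4 := by
    interval_cases k <;> norm_num
  exact mul_le_mul_of_nonneg_right h2 (by positivity)

/-- A series of fields whose norms are summable. -/
theorem isXField_tsum {c : ℕ → ℝ} {u : ℕ → ℝ → Plane → F} [CompleteSpace F]
    (hu : ∀ n, IsXField θ (c n) (u n)) (hc : Summable c) :
    IsXField θ (∑' n, c n) (fun t x => if 0 < t then ∑' n, u n t x else 0) := by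
  have hsum : ∀ t, 0 < t → ∀ x, Summable fun n => u n t x := fun t ht x =>
    Summable.of_norm_bounded (hc.div_const _) fun n => (hu n).norm_le ht x
  have hder : ∀ t, 0 < t → ContDiff ℝ 2 (fun x => ∑' n, u n t x) ∧ ∀ k ≤ 2, ∀ x,
      iteratedFDeriv ℝ k (fun x => ∑' n, u n t x) x = ∑' n, iteratedFDeriv ℝ k (u n t) x := by
    intro t ht
    have hst : 0 < √t := Real.sqrt_pos.2 ht
    have hb : ∀ (k : ℕ) (n : ℕ) (x : Plane), (k : ℕ∞) ≤ 2 →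
        ‖iteratedFDeriv ℝ k (u n t) x‖ ≤ c n / √t ^ (θ + k) := by
      intro k n x hk
      refine ((hu n).bound t ht k (by exact_mod_cast hk) x).trans ?_
      have := (hu n).nonneg
      gcongr
      linarith [norm_nonneg x]
    have hs : ∀ k : ℕ, (k : ℕ∞) ≤ 2 → Summable fun n => c n / √t ^ (θ + k) :=
      fun k _ => hc.div_const _
    refine ⟨contDiff_tsum (N := 2) (fun n => (hu n).contDiff t ht) hs hb, fun k hk x => ?_⟩
    exact iteratedFDeriv_tsum_apply (N := 2) (fun n => (hu n).contDiff t ht) hs hb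
      (by exact_mod_cast hk) x
  refine ⟨?_, fun t ht => ?_, fun t ht k hk x => ?_⟩
  · refine stronglyMeasurable_of_tendsto atTop
      (f := fun N p => if 0 < p.1 then ∑ n ∈ Finset.range N, u n p.1 p.2 else 0) (fun N => ?_) ?_
    · exact StronglyMeasurable.ite (measurableSet_lt measurable_const measurable_fst)
        (Finset.stronglyMeasurable_fun_sum _ fun n _ => (hu n).stronglyMeasurable)
        stronglyMeasurable_const
    · rw [tendsto_pi_nhds]
      rintro ⟨t, x⟩
      by_cases ht : 0 < t
      · simp only [Function.uncurry, if_pos ht]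
        exact (hsum t ht x).hasSum.tendsto_sum_nat
      · simp only [Function.uncurry, if_neg ht]
        exact tendsto_const_nhds
  · simp only [if_pos ht]
    exact (hder t ht).1
  · simp only [if_pos ht]
    rw [(hder t ht).2 k hk x, ← tsum_div_const]
    exact tsum_of_norm_bounded (hc.div_const _).hasSum fun n => (hu n).bound t ht k hk x

end Operations

/-! ### The bilinear operator -/

theorem slab_eq (t : ℝ) : slab t = (volume : Measure (ℝ × Plane)).restrict (Ioo 0 t ×ˢ univ) := by
  rw [slab, Measure.volume_eq_prod, ← Measure.prod_restrict, Measure.restrict_univ]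

theorem slab_le_spaceTime (t : ℝ) : slab t ≤ spaceTime := by
  rw [slab_eq, spaceTime]
  exact Measure.restrict_mono (Set.prod_mono Ioo_subset_Ioi_self le_rfl) le_rfl

/-- A measurable field with `|u| ≤ A (√t + |x|)^{-1}` almost everywhere in space-time. -/
structure IsXBounded (A : ℝ) (u : ℝ → Plane → Plane) : Prop where
  aestronglyMeasurable : AEStronglyMeasurable (Function.uncurry u) spaceTime
  bound : ∀ᵐ p ∂spaceTime, ‖u p.1 p.2‖ ≤ A / (√p.1 + ‖p.2‖)
  nonneg : 0 ≤ A

theorem ae_spaceTime {P : ℝ × Plane → Prop} (h : ∀ s, 0 < s → ∀ y, P (s, y)) :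
    ∀ᵐ p ∂spaceTime, P p := by
  rw [spaceTime, ae_restrict_iff' (measurableSet_Ioi.prod .univ)]
  exact ae_of_all _ fun p hp => h p.1 hp.1 p.2

theorem IsXField.isXBounded {A : ℝ} {u : ℝ → Plane → Plane} (hu : IsXField 1 A u) :
    IsXBounded A u :=
  ⟨hu.stronglyMeasurable.aestronglyMeasurable,
    ae_spaceTime fun s hs y => by simpa using hu.norm_le hs y, hu.nonneg⟩

theorem IsXBounded.sub {A B : ℝ} {u v : ℝ → Plane → Plane} (hu : IsXBounded A u)
    (hv : IsXBounded B v) : IsXBounded (A + B) (fun t x => u t x - v t x) := by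
  refine ⟨hu.aestronglyMeasurable.sub hv.aestronglyMeasurable, ?_, add_nonneg hu.nonneg hv.nonneg⟩
  filter_upwards [hu.bound, hv.bound] with p h1 h2
  rw [add_div]
  exact (norm_sub_le _ _).trans (add_le_add h1 h2)

theorem abs_coord_le (x : Plane) (i : Fin 2) : |x i| ≤ ‖x‖ := by
  simpa using PiLp.norm_apply_le x i

/-- The products `u_h v_k` which make up `u ⊗ v`. -/
def tensorEntry (u v : ℝ → Plane → Plane) (h k : Fin 2) (t : ℝ) (x : Plane) : ℝ :=
  u t x h * v t x k

theorem IsXBounded.tensorEntry {A B : ℝ} {u v : ℝ → Plane → Plane} (hu : IsXBounded A u)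
    (hv : IsXBounded B v) (h k : Fin 2) (t : ℝ) :
    AEStronglyMeasurable (Function.uncurry (tensorEntry u v h k)) (slab t) ∧
      ∀ᵐ p ∂slab t, |NSProfile.tensorEntry u v h k p.1 p.2| ≤ A * B / (√p.1 + ‖p.2‖) ^ 2 := by
  have hm := fun (i : Fin 2) => (EuclideanSpace.proj i : Plane →L[ℝ] ℝ).continuous
  refine ⟨((hm h).comp_aestronglyMeasurable
    (hu.aestronglyMeasurable.mono_measure (slab_le_spaceTime t))).mul
    ((hm k).comp_aestronglyMeasurable
    (hv.aestronglyMeasurable.mono_measure (slab_le_spaceTime t))), ?_⟩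
  filter_upwards [ae_mono (slab_le_spaceTime t) hu.bound, ae_mono (slab_le_spaceTime t) hv.bound]
    with p h1 h2
  have hA := hu.nonneg
  have hB := hv.nonneg
  have h0 : 0 ≤ √p.1 + ‖p.2‖ := by positivity
  rw [NSProfile.tensorEntry, abs_mul]
  calc _ ≤ ‖u p.1 p.2‖ * ‖v p.1 p.2‖ := by gcongr <;> exact abs_coord_le _ _
    _ ≤ A / (√p.1 + ‖p.2‖) * (B / (√p.1 + ‖p.2‖)) := by gcongr
    _ = _ := by rw [div_mul_div_comm, ← sq]

theorem duhamel_of_nonpos (K w : ℝ → Plane → ℝ) {t : ℝ} (ht : t ≤ 0) (x : Plane) :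
    duhamel K w t x = 0 := by
  rw [duhamel, slab, Ioo_eq_empty (not_lt.2 ht)]
  simp

/-- The bilinear operator, written with the explicit kernel. -/
noncomputable def bilinearDuhamel (u v : ℝ → Plane → Plane) (t : ℝ) (x : Plane) : Plane :=
  ∑ j, (∑ h, ∑ k, duhamel (oseenKernel j h k) (tensorEntry u v h k) t x) • basisVec j

theorem bilinearDuhamel_apply (u v : ℝ → Plane → Plane) (t : ℝ) (x : Plane) (j : Fin 2) :
    bilinearDuhamel u v t x j =
      ∑ h, ∑ k, duhamel (oseenKernel j h k) (tensorEntry u v h k) t x := by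
  fin_cases j <;> simp [bilinearDuhamel, Fin.sum_univ_two]

theorem norm_le_sum_coord (x : Plane) : ‖x‖ ≤ |x 0| + |x 1| := by
  rw [EuclideanSpace.norm_eq, Fin.sum_univ_two, Real.sqrt_le_left (by positivity)]
  simp only [Real.norm_eq_abs]
  nlinarith [abs_nonneg (x 0), abs_nonneg (x 1), mul_nonneg (abs_nonneg (x 0)) (abs_nonneg (x 1))]

theorem exists_bilinearDuhamel_bounds : ∃ D > 0, ∀ {A B : ℝ} {u v : ℝ → Plane → Plane},
    IsXBounded A u → IsXBounded B v → ∀ t, 0 < t → ∀ x : Plane,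
      (∀ j h k, Integrable (fun p : ℝ × Plane =>
        oseenKernel j h k (t - p.1) (x - p.2) * tensorEntry u v h k p.1 p.2) (slab t)) ∧
      ‖bilinearDuhamel u v t x‖ ≤ D * A * B * √t / (√t + ‖x‖) ^ 2 := by
  obtain ⟨C, hC, hK⟩ := exists_isXField_oseenKernel
  have hpi := Real.pi_pos
  refine ⟨8 * (32 * Real.pi * C), by positivity, ?_⟩
  intro A B u v hu hv t ht x
  have hA := hu.nonneg
  have hB := hv.nonneg
  have key := fun j h k => integrable_duhamel (A := A * B) (hK j h k).stronglyMeasurable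
    (fun τ hτ z => (hK j h k).abs_le hτ z) hC.le (hu.tensorEntry hv h k t).1 (by positivity)
    (hu.tensorEntry hv h k t).2 ht x
  refine ⟨fun j h k => (key j h k).1, (norm_le_sum_coord _).trans ?_⟩
  have hj : ∀ j, |bilinearDuhamel u v t x j| ≤
      4 * (32 * Real.pi * C * (A * B) * √t / (√t + ‖x‖) ^ 2) := by
    intro j
    rw [bilinearDuhamel_apply, Fin.sum_univ_two, Fin.sum_univ_two, Fin.sum_univ_two]
    have e := fun h k => abs_le.1 (key j h k).2
    rw [abs_le]
    constructor <;> linarith [(e 0 0).1, (e 0 1).1, (e 1 0).1, (e 1 1).1, (e 0 0).2, (e 0 1).2,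
      (e 1 0).2, (e 1 1).2]
  calc _ ≤ _ := add_le_add (hj 0) (hj 1)
    _ = _ := by ring

/-- `B(u,u) - B(v,v) = B(u,u-v) + B(u-v,v)`. -/
theorem bilinearDuhamel_self_sub_self {A B : ℝ} {u v : ℝ → Plane → Plane}
    (hu : IsXBounded A u) (hv : IsXBounded B v) (t : ℝ) (x : Plane) :
    bilinearDuhamel u u t x - bilinearDuhamel v v t x =
      bilinearDuhamel u (fun t x => u t x - v t x) t x +
        bilinearDuhamel (fun t x => u t x - v t x) v t x := by
  rcases le_or_gt t 0 with ht | ht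
  · simp [bilinearDuhamel, duhamel_of_nonpos _ _ ht]
  obtain ⟨D, -, hD⟩ := exists_bilinearDuhamel_bounds
  have hd := hu.sub hv
  have i1 := (hD hu hu t ht x).1
  have i2 := (hD hv hv t ht x).1
  have i3 := (hD hu hd t ht x).1
  have i4 := (hD hd hv t ht x).1
  ext j
  simp only [PiLp.sub_apply, PiLp.add_apply, bilinearDuhamel_apply, ← Finset.sum_sub_distrib,
    ← Finset.sum_add_distrib]
  refine Finset.sum_congr rfl fun h _ => Finset.sum_congr rfl fun k _ => ?_
  rw [duhamel, duhamel, duhamel, duhamel, ← integral_sub (i1 j h k) (i2 j h k),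
    ← integral_add (i3 j h k) (i4 j h k)]
  congr 1
  funext p
  simp only [tensorEntry, PiLp.sub_apply]
  ring

theorem IsXField.tensorEntry {A B : ℝ} {u v : ℝ → Plane → Plane} (hu : IsXField 1 A u)
    (hv : IsXField 1 B v) (h k : Fin 2) :
    IsXField 2 (4 * A * B) (NSProfile.tensorEntry u v h k) := by
  have hproj : ∀ i : Fin 2, ‖(EuclideanSpace.proj i : Plane →L[ℝ] ℝ)‖ ≤ 1 := fun i =>
    ContinuousLinearMap.opNorm_le_bound _ zero_le_one fun x => by
      simpa using abs_coord_le x i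
  exact (hu.clm_comp (EuclideanSpace.proj h) (hproj h)).mul
    (hv.clm_comp (EuclideanSpace.proj k) (hproj k))

/-- The bilinear operator is bounded on fields of degree `1`. -/
theorem exists_isXField_bilinearDuhamel : ∃ D > 0, ∀ {A B : ℝ} {u v : ℝ → Plane → Plane},
    IsXField 1 A u → IsXField 1 B v → IsXField 1 (D * A * B) (bilinearDuhamel u v) := by
  obtain ⟨C, hC, hK⟩ := exists_isXField_oseenKernel
  obtain ⟨D, hD, hdu⟩ := exists_isXField_duhamel
  refine ⟨8 * (D * C * 4), by positivity, ?_⟩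
  intro A B u v hu hv
  have hvec : ∀ j : Fin 2, ‖(ContinuousLinearMap.id ℝ ℝ).smulRight (basisVec j)‖ ≤ 1 := fun j => by
    rw [ContinuousLinearMap.norm_smulRight_apply, norm_basisVec, mul_one]
    exact ContinuousLinearMap.norm_id_le
  have := IsXField.finset_sum (θ := 1) Finset.univ (fun j =>
    (IsXField.finset_sum Finset.univ (fun h => IsXField.finset_sum Finset.univ (fun k =>
      hdu (hK j h k) (hu.tensorEntry hv h k)))).clm_comp _ (hvec j))
  refine IsXField.mono (u := bilinearDuhamel u v) this (le_of_eq ?_)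
  simp only [Finset.sum_const, Finset.card_univ, Fintype.card_fin, nsmul_eq_mul]
  push_cast
  ring

theorem nsBilinear_eq_bilinearDuhamel {A B : ℝ} {u v : ℝ → Plane → Plane}
    (hu : IsXBounded A u) (hv : IsXBounded B v) {t : ℝ} (ht : 0 < t) (x : Plane) :
    nsBilinear u v t x = bilinearDuhamel u v t x := by
  obtain ⟨D, -, hD⟩ := exists_bilinearDuhamel_bounds
  have hi := (hD hu hv t ht x).1
  ext j
  rw [bilinearDuhamel_apply]
  simp only [nsBilinear]
  simp only [duhamel]
  rw [← Finset.sum_congr rfl fun h _ => integral_finsetSum Finset.univ fun k _ => hi j h k,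
    ← integral_finsetSum _ fun h _ => integrable_finsetSum _ fun k _ => hi j h k,
    intervalIntegral.integral_of_le ht.le, integral_Ioc_eq_integral_Ioo,
    integral_prod _ (integrable_finsetSum _ fun h _ => integrable_finsetSum _ fun k _ => hi j h k)]
  refine setIntegral_congr_fun measurableSet_Ioo fun s hs => ?_
  simp only [tensorEntry, oseenDivKernel_eq _ _ _ (sub_pos.2 hs.2)]


/-! ### Existence and uniqueness of small mild solutions -/

/-- The successive approximations of `u = H - B(u,u)`. -/
noncomputable def picard (H : ℝ → Plane → Plane) : ℕ → ℝ → Plane → Plane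
  | 0 => fun _ _ => 0
  | n + 1 => fun t x => H t x - bilinearDuhamel (picard H n) (picard H n) t x

/-- For small `H` the successive approximations converge geometrically: each bilinear term contracts
the previous increment by a factor `1/2`. -/
theorem exists_isXField_picard : ∃ A₀ > 0, ∀ {A : ℝ} {H : ℝ → Plane → Plane}, IsXField 1 A H →
    A ≤ A₀ → ∀ n, IsXField 1 (∑ i ∈ Finset.range n, A * (1 / 2) ^ i) (picard H n) ∧
      IsXField 1 (A * (1 / 2) ^ n) (fun t x => picard H (n + 1) t x - picard H n t x) := by
  obtain ⟨D, hD, hb⟩ := exists_isXField_bilinearDuhamel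
  refine ⟨1 / (8 * D), by positivity, ?_⟩
  intro A H hH hA n
  have hA0 := hH.nonneg
  have hgeom : ∀ n, ∑ i ∈ Finset.range n, A * (1 / 2 : ℝ) ^ i ≤ 2 * A := by
    intro n
    rw [← Finset.mul_sum, mul_comm]
    gcongr
    exact sum_geometric_two_le n
  induction n with
  | zero =>
    refine ⟨by simpa [picard] using isXField_zero (F := Plane) 1, ?_⟩
    have e : (fun t x => picard H (0 + 1) t x - picard H 0 t x) = H := by
      funext t x
      simp [picard, bilinearDuhamel, duhamel, tensorEntry]
    rw [e]
    simpa using hH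
  | succ n ih =>
    have h1 : IsXField 1 (∑ i ∈ Finset.range (n + 1), A * (1 / 2 : ℝ) ^ i) (picard H (n + 1)) := by
      rw [Finset.sum_range_succ]
      simpa using ih.1.add ih.2
    refine ⟨h1, ?_⟩
    have e : (fun t x => picard H (n + 1 + 1) t x - picard H (n + 1) t x) = fun t x =>
        -(bilinearDuhamel (picard H (n + 1))
            (fun t x => picard H (n + 1) t x - picard H n t x) t x +
          bilinearDuhamel (fun t x => picard H (n + 1) t x - picard H n t x) (picard H n) t x) := by
      funext t x
      rw [← bilinearDuhamel_self_sub_self h1.isXBounded ih.1.isXBounded]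
      simp only [picard]
      abel
    rw [e]
    refine ((hb h1 ih.2).add (hb ih.2 ih.1)).neg.mono ?_
    have hc : 0 ≤ A * (1 / 2 : ℝ) ^ n := by positivity
    calc _ ≤ D * (2 * A) * (A * (1 / 2) ^ n) + D * (A * (1 / 2) ^ n) * (2 * A) := by
          gcongr
          · exact hgeom _
          · exact hgeom _
      _ = 4 * D * A * (A * (1 / 2) ^ n) := by ring
      _ ≤ 4 * D * (1 / (8 * D)) * (A * (1 / 2) ^ n) := by gcongr
      _ = _ := by field_simp; ring

/-- Existence of a solution of `u = H - B(u,u)` for small `H`. -/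
theorem exists_mild_solution : ∃ A₀ > 0, ∀ {A : ℝ} {H : ℝ → Plane → Plane}, IsXField 1 A H →
    A ≤ A₀ → ∃ u, IsXField 1 (2 * A) u ∧
      ∀ t, 0 < t → ∀ x, u t x = H t x - bilinearDuhamel u u t x := by
  obtain ⟨A₀, hA₀, hp⟩ := exists_isXField_picard
  obtain ⟨D, hD, hb⟩ := exists_bilinearDuhamel_bounds
  refine ⟨A₀, hA₀, ?_⟩
  intro A H hH hA
  have hA0 := hH.nonneg
  have key := hp hH hA
  let e : ℕ → ℝ → Plane → Plane := fun n t x => picard H (n + 1) t x - picard H n t x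
  have he : ∀ n, IsXField 1 (A * (1 / 2) ^ n) (e n) := fun n => (key n).2
  have hsum : Summable fun n : ℕ => A * (1 / 2 : ℝ) ^ n := summable_geometric_two.mul_left A
  let u : ℝ → Plane → Plane := fun t x => if 0 < t then ∑' n, e n t x else 0
  have hu : IsXField 1 (2 * A) u := by
    have := isXField_tsum he hsum
    rwa [tsum_mul_left, tsum_geometric_two, mul_comm] at this
  have hpic : ∀ n t x, ∑ i ∈ Finset.range n, e i t x = picard H n t x := by
    intro n t x
    simp only [e]
    rw [Finset.sum_range_sub (fun i => picard H i t x)]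
    simp [picard]
  have hdiff : ∀ n t, 0 < t → ∀ x, u t x - picard H n t x =
      (fun t x => if 0 < t then ∑' i, e (i + n) t x else 0) t x := by
    intro n t ht x
    have hs : Summable fun n => e n t x :=
      Summable.of_norm_bounded (hsum.div_const _) fun n => (he n).norm_le ht x
    simp only [u, if_pos ht]
    rw [← hs.sum_add_tsum_nat_add n, hpic]
    abel
  have hdX : ∀ n, IsXField 1 (2 * A * (1 / 2) ^ n)
      (fun t x => if 0 < t then ∑' i, e (i + n) t x else 0) := by
    intro n
    have h1 : Summable fun i : ℕ => A * (1 / 2 : ℝ) ^ (i + n) :=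
      hsum.comp_injective (add_left_injective n)
    have := isXField_tsum (fun i => he (i + n)) h1
    refine this.mono (le_of_eq ?_)
    simp only [pow_add, ← mul_assoc]
    rw [tsum_mul_right, tsum_mul_left, tsum_geometric_two]
    ring
  have hgeom : ∀ n, ∑ i ∈ Finset.range n, A * (1 / 2 : ℝ) ^ i ≤ 2 * A := by
    intro n
    rw [← Finset.mul_sum, mul_comm]
    gcongr
    exact sum_geometric_two_le n
  refine ⟨u, hu, fun t ht x => ?_⟩
  have hdB : ∀ n, IsXBounded (2 * A * (1 / 2) ^ n) (fun t x => u t x - picard H n t x) := by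
    intro n
    have h1 := hu.isXBounded.sub (key n).1.isXBounded
    refine ⟨h1.aestronglyMeasurable, ae_spaceTime fun s hs y => ?_, by positivity⟩
    simp only
    rw [hdiff n s hs y]
    simpa using (hdX n).norm_le hs y
  have hpow : Tendsto (fun n : ℕ => (1 / 2 : ℝ) ^ n) atTop (𝓝 0) :=
    tendsto_pow_atTop_nhds_zero_of_lt_one (by norm_num) (by norm_num)
  have hst : 0 < √t := Real.sqrt_pos.2 ht
  have lim1 : Tendsto (fun n => picard H n t x) atTop (𝓝 (u t x)) := by
    rw [tendsto_iff_norm_sub_tendsto_zero]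
    refine squeeze_zero (g := fun n : ℕ => (1 / 2 : ℝ) ^ n * (2 * A / (√t + ‖x‖) ^ 1))
      (fun n => norm_nonneg _) (fun n => ?_) (by simpa using hpow.mul_const _)
    rw [norm_sub_rev, hdiff n t ht x]
    exact ((hdX n).norm_le ht x).trans (le_of_eq (by ring))
  have lim2 : Tendsto (fun n => bilinearDuhamel (picard H n) (picard H n) t x) atTop
      (𝓝 (bilinearDuhamel u u t x)) := by
    rw [tendsto_iff_norm_sub_tendsto_zero]
    refine squeeze_zero (g := fun n : ℕ => (1 / 2 : ℝ) ^ n *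
      (2 * (D * (2 * A) * (2 * A) * √t / (√t + ‖x‖) ^ 2)))
      (fun n => norm_nonneg _) (fun n => ?_) (by simpa using hpow.mul_const _)
    rw [norm_sub_rev, bilinearDuhamel_self_sub_self hu.isXBounded (key n).1.isXBounded]
    have b1 := (hb hu.isXBounded (hdB n) t ht x).2
    have b2 := (hb (hdB n) ((key n).1.mono (hgeom n)).isXBounded t ht x).2
    exact (norm_add_le _ _).trans ((add_le_add b1 b2).trans (le_of_eq (by ring)))
  have lim3 := (tendsto_add_atTop_iff_nat 1).2 lim1
  exact tendsto_nhds_unique lim3 (tendsto_const_nhds.sub lim2)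

/-- Uniqueness of small solutions of `u = H - B(u,u)`. -/
theorem exists_mild_unique : ∃ A₀ > 0, ∀ {A : ℝ} {H u v : ℝ → Plane → Plane}, IsXBounded A u →
    IsXBounded A v → A ≤ A₀ →
      (∀ t, 0 < t → ∀ x, u t x = H t x - bilinearDuhamel u u t x) →
      (∀ t, 0 < t → ∀ x, v t x = H t x - bilinearDuhamel v v t x) →
      ∀ t, 0 < t → ∀ x, u t x = v t x := by
  obtain ⟨D, hD, hb⟩ := exists_bilinearDuhamel_bounds
  refine ⟨1 / (4 * D), by positivity, ?_⟩
  intro A H u v hu hv hA hu' hv'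
  have hA0 := hu.nonneg
  have step : ∀ n : ℕ, IsXBounded (2 * A * (1 / 2) ^ n) (fun t x => u t x - v t x) ∧
      ∀ t, 0 < t → ∀ x, ‖u t x - v t x‖ ≤ 2 * A * (1 / 2) ^ (n + 1) / (√t + ‖x‖) := by
    have h2 : ∀ n : ℕ, IsXBounded (2 * A * (1 / 2) ^ n) (fun t x => u t x - v t x) →
        ∀ t, 0 < t → ∀ x, ‖u t x - v t x‖ ≤ 2 * A * (1 / 2) ^ (n + 1) / (√t + ‖x‖) := by
      intro n hn t ht x
      have hst : 0 < √t := Real.sqrt_pos.2 ht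
      have e : u t x - v t x = -(bilinearDuhamel u (fun t x => u t x - v t x) t x +
          bilinearDuhamel (fun t x => u t x - v t x) v t x) := by
        rw [← bilinearDuhamel_self_sub_self hu hv, hu' t ht x, hv' t ht x]
        abel
      rw [e, norm_neg]
      have b1 := (hb hu hn t ht x).2
      have b2 := (hb hn hv t ht x).2
      refine (norm_add_le _ _).trans ((add_le_add b1 b2).trans ?_)
      calc _ = 2 * (D * A) * (2 * A * (1 / 2) ^ n) * (√t / (√t + ‖x‖) ^ 2) := by ring
        _ ≤ 2 * (D * (1 / (4 * D))) * (2 * A * (1 / 2) ^ n) * (1 / (√t + ‖x‖)) := by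
            have h3 : √t / (√t + ‖x‖) ^ 2 ≤ 1 / (√t + ‖x‖) := by
              rw [div_le_div_iff₀ (by positivity) (by positivity)]
              nlinarith [norm_nonneg x, mul_nonneg hst.le (norm_nonneg x)]
            gcongr
        _ = _ := by field_simp; ring
    intro n
    induction n with
    | zero =>
      have h1 : IsXBounded (2 * A * (1 / 2) ^ 0) (fun t x => u t x - v t x) := by
        have := hu.sub hv
        rwa [← two_mul, ← mul_one (2 * A), ← pow_zero (1 / 2 : ℝ)] at this
      exact ⟨h1, h2 0 h1⟩
    | succ n ih =>
      have h1 : IsXBounded (2 * A * (1 / 2) ^ (n + 1)) (fun t x => u t x - v t x) :=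
        ⟨(hu.sub hv).aestronglyMeasurable, ae_spaceTime ih.2, by positivity⟩
      exact ⟨h1, h2 _ h1⟩
  intro t ht x
  have hpow : Tendsto (fun n : ℕ => 2 * A * (1 / 2 : ℝ) ^ (n + 1) / (√t + ‖x‖)) atTop (𝓝 0) := by
    have := (tendsto_pow_atTop_nhds_zero_of_lt_one (r := (1 / 2 : ℝ)) (by norm_num)
      (by norm_num)).comp (tendsto_add_atTop_nat 1)
    simpa using (this.const_mul (2 * A)).div_const (√t + ‖x‖)
  have := ge_of_tendsto hpow (Eventually.of_forall fun n => (step n).2 t ht x)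
  exact sub_eq_zero.1 (norm_le_zero_iff.1 this)


/-! ### The heat flow away from the parabolic origin -/

theorem norm_fderiv_eq_norm_iteratedFDeriv_one {F : Type*} [NormedAddCommGroup F] [NormedSpace ℝ F]
    (f : Plane → F) (x : Plane) : ‖fderiv ℝ f x‖ = ‖iteratedFDeriv ℝ 1 f x‖ := by
  rw [← norm_iteratedFDeriv_fderiv, norm_iteratedFDeriv_zero]

theorem norm_fderiv_fderiv_eq_norm_iteratedFDeriv_two {F : Type*} [NormedAddCommGroup F]
    [NormedSpace ℝ F] (f : Plane → F) (x : Plane) :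
    ‖fderiv ℝ (fderiv ℝ f) x‖ = ‖iteratedFDeriv ℝ 2 f x‖ := by
  rw [norm_fderiv_eq_norm_iteratedFDeriv_one, norm_iteratedFDeriv_fderiv]

/-- Taylor's formula of order two, with the remainder estimated on a ball. -/
theorem norm_taylor_two_le {F : Type*} [NormedAddCommGroup F] [NormedSpace ℝ F] {f : Plane → F}
    {x : Plane} {R M : ℝ} (hf : ContDiffOn ℝ 2 f (Metric.ball x R))
    (hM : ∀ y ∈ Metric.ball x R, ‖iteratedFDeriv ℝ 2 f y‖ ≤ M) {z : Plane} (hz : ‖z‖ < R) :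
    ‖f (x - z) - f x + fderiv ℝ f x z‖ ≤ M * ‖z‖ ^ 2 := by
  have hsub : ∀ y ∈ Metric.closedBall x ‖z‖, y ∈ Metric.ball x R := fun y hy =>
    Metric.mem_ball.2 ((Metric.mem_closedBall.1 hy).trans_lt hz)
  have hat : ∀ y ∈ Metric.closedBall x ‖z‖, ContDiffAt ℝ 2 f y := fun y hy =>
    hf.contDiffAt (Metric.isOpen_ball.mem_nhds (hsub y hy))
  have hd : ∀ y ∈ Metric.closedBall x ‖z‖, DifferentiableAt ℝ f y := fun y hy =>
    (hat y hy).differentiableAt (by norm_num)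
  have hd2 : ∀ y ∈ Metric.closedBall x ‖z‖, DifferentiableAt ℝ (fderiv ℝ f) y := fun y hy =>
    ((hat y hy).fderiv_right (m := 1) (by norm_num)).differentiableAt (by norm_num)
  have hx : x ∈ Metric.closedBall x ‖z‖ := Metric.mem_closedBall_self (norm_nonneg z)
  have hxz : x - z ∈ Metric.closedBall x ‖z‖ := by
    rw [Metric.mem_closedBall, dist_eq_norm]; simp
  have hconv := convex_closedBall x ‖z‖
  have hM0 : 0 ≤ M := (norm_nonneg _).trans (hM x (hsub x hx))
  have h1 : ∀ y ∈ Metric.closedBall x ‖z‖, ‖fderiv ℝ f y - fderiv ℝ f x‖ ≤ M * ‖z‖ := by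
    intro y hy
    refine (hconv.norm_image_sub_le_of_norm_fderiv_le hd2 (C := M) (fun w hw => ?_) hx hy).trans ?_
    · rw [norm_fderiv_fderiv_eq_norm_iteratedFDeriv_two]
      exact hM w (hsub w hw)
    · rw [Metric.mem_closedBall, dist_eq_norm] at hy
      gcongr
  have h2 := hconv.norm_image_sub_le_of_norm_fderiv_le' (φ := fderiv ℝ f x) hd h1 hx hxz
  simp only [sub_sub_cancel_left, map_neg, norm_neg, sub_neg_eq_add] at h2
  rwa [mul_assoc, ← sq] at h2

theorem IsDatum.taylor {A : ℝ} {a : Plane → Plane} (ha : IsDatum A a) {x z : Plane} (hx : x ≠ 0)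
    (hz : ‖z‖ < ‖x‖ / 2) :
    ‖a (x - z) - a x + fderiv ℝ a x z‖ ≤ 8 * A / ‖x‖ ^ 3 * ‖z‖ ^ 2 := by
  have hx0 : 0 < ‖x‖ := norm_pos_iff.2 hx
  have hA := ha.nonneg
  have hne : ∀ y ∈ Metric.ball x (‖x‖ / 2), ‖x‖ / 2 < ‖y‖ := by
    intro y hy
    rw [mem_ball_iff_norm'] at hy
    have := norm_le_norm_add_norm_sub' x y
    linarith
  have hne0 : ∀ y ∈ Metric.ball x (‖x‖ / 2), y ≠ 0 := fun y hy =>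
    norm_pos_iff.1 ((by positivity : 0 < ‖x‖ / 2).trans (hne y hy))
  refine norm_taylor_two_le (ha.contDiffOn.mono fun y hy => hne0 y hy) (fun y hy => ?_) hz
  refine (ha.bound 2 le_rfl y (hne0 y hy)).trans ?_
  calc A / ‖y‖ ^ (1 + 2) ≤ A / (‖x‖ / 2) ^ (1 + 2) := by gcongr; exact (hne y hy).le
    _ = _ := by rw [div_pow]; field_simp; ring

theorem integral_add_add {α F : Type*} [MeasurableSpace α] {μ : Measure α} [NormedAddCommGroup F]
    [NormedSpace ℝ F] {f g h : α → F} (hf : Integrable f μ) (hg : Integrable g μ)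
    (hh : Integrable h μ) :
    ∫ x, (f x + g x + h x) ∂μ = ∫ x, f x ∂μ + ∫ x, g x ∂μ + ∫ x, h x ∂μ := by
  rw [integral_add (f := fun x => f x + g x) (hf.add hg) hh, integral_add hf hg]

theorem integral_eq_zero_of_odd {F : Type*} [NormedAddCommGroup F] [NormedSpace ℝ F]
    {f : Plane → F} (hf : ∀ x, f (-x) = -f x) : ∫ x, f x = 0 := by
  have h := integral_neg_eq_self f volume
  simp only [hf, integral_neg] at h
  have h2 : (2 : ℝ) • ∫ x, f x = 0 := by
    rw [two_smul]
    nth_rewrite 1 [← h]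
    exact neg_add_cancel _
  simpa using h2

theorem heatKernel_neg (t : ℝ) (z : Plane) : heatKernel t (-z) = heatKernel t z := by
  simp [heatKernel]

/-- The decay of the heat kernel is strong enough for its second moments to be `O(t)`. -/
theorem exists_heatKernel_le : ∃ C > 0, ∀ t, 0 < t → ∀ z : Plane,
    heatKernel t z ≤ C * (t ^ 2 * ((√t + ‖z‖) ^ 6)⁻¹) := by
  refine ⟨8 ^ 3 * ((3).factorial * Real.exp 1), by positivity, fun t ht z => ?_⟩
  have hst : 0 < √t := Real.sqrt_pos.2 ht
  have hy : 0 ≤ ‖z‖ ^ 2 / (4 * t) := by positivity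
  have h1 := one_add_pow_mul_exp_neg_le 3 hy
  have h2 : (√t + ‖z‖) ^ 2 ≤ 8 * t * (1 + ‖z‖ ^ 2 / (4 * t)) := by
    have e : 8 * t * (1 + ‖z‖ ^ 2 / (4 * t)) = 8 * t + 2 * ‖z‖ ^ 2 := by field_simp; ring
    rw [e]
    nlinarith [sq_nonneg (√t - ‖z‖), Real.sq_sqrt ht.le]
  have h3 : (√t + ‖z‖) ^ 6 ≤ (8 * t * (1 + ‖z‖ ^ 2 / (4 * t))) ^ 3 := by
    calc _ = ((√t + ‖z‖) ^ 2) ^ 3 := by ring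
      _ ≤ _ := by gcongr
  have hpi : (4 * Real.pi * t)⁻¹ ≤ t⁻¹ := by
    apply inv_anti₀ ht
    nlinarith [Real.pi_gt_three]
  rw [heatKernel, neg_div, ← div_eq_mul_inv, ← mul_div_assoc, le_div_iff₀ (by positivity)]
  calc _ ≤ t⁻¹ * Real.exp (-(‖z‖ ^ 2 / (4 * t))) * (8 * t * (1 + ‖z‖ ^ 2 / (4 * t))) ^ 3 := by
        gcongr
    _ = 8 ^ 3 * t ^ 2 * ((1 + ‖z‖ ^ 2 / (4 * t)) ^ 3 * Real.exp (-(‖z‖ ^ 2 / (4 * t)))) := by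
        rw [mul_pow, mul_pow]; field_simp
    _ ≤ 8 ^ 3 * t ^ 2 * ((3).factorial * Real.exp 1) := by gcongr
    _ = _ := by ring

theorem integral_heatKernel {t : ℝ} (ht : 0 < t) : ∫ z, heatKernel t z = 1 := by
  have h := GaussianFourier.integral_rexp_neg_mul_sq_norm (V := Plane) (b := (4 * t)⁻¹)
    (by positivity)
  have e : ∀ z : Plane, heatKernel t z = (4 * Real.pi * t)⁻¹ * Real.exp (-(4 * t)⁻¹ * ‖z‖ ^ 2) := by
    intro z
    rw [heatKernel]
    congr 2
    field_simp
  simp_rw [e]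
  rw [integral_const_mul, h]
  have hpi := Real.pi_pos
  simp
  field_simp

theorem integrable_heatKernel {t : ℝ} (ht : 0 < t) : Integrable (heatKernel t) :=
  Integrable.of_integral_ne_zero (by rw [integral_heatKernel ht]; exact one_ne_zero)

/-- The heat flow stays close to the datum: `|e^{tΔ} a - a| ≤ C t |x|^{-3}`. Near `x`, Taylor's
formula is used and the linear term cancels by symmetry of the heat kernel. -/
theorem exists_norm_heatFlow_sub_le : ∃ C > 0, ∀ {a : Plane → Plane} {A : ℝ}, IsDatum A a →
    ∀ t, 0 < t → ∀ x, x ≠ 0 → ‖heatFlow t a x - a x‖ ≤ C * A * t / ‖x‖ ^ 3 := by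
  obtain ⟨C, hC, hg⟩ := exists_heatKernel_le
  have hpi := Real.pi_pos
  refine ⟨528 * Real.pi * C, by positivity, ?_⟩
  intro a A ha t ht x hx
  have hst : 0 < √t := Real.sqrt_pos.2 ht
  have hA := ha.nonneg
  set r := ‖x‖ with hr
  have hr0 : 0 < r := norm_pos_iff.2 hx
  have hss : √t ^ 2 = t := Real.sq_sqrt ht.le
  let L : Plane → Plane := (Metric.ball 0 (r / 2)).indicator fun z => heatKernel t z • fderiv ℝ a x z
  let φ : Plane → Plane := fun z => heatKernel t z • (a (x - z) - a x) + L z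
  let G : Plane → ℝ := fun z => 8 * A * C / r ^ 3 * t * (t * ((√t + ‖z‖) ^ 4)⁻¹) +
    3 * A * C * t / r * (Metric.ball 0 (r / 2))ᶜ.indicator (fun z => (‖z‖ ^ (2 + 2))⁻¹) z +
    16 * A * C * t / r ^ 4 * (Metric.ball 0 (r / 2)).indicator (fun y => ‖y‖⁻¹) (x - z)
  have hgk : Measurable (heatKernel t) := measurable_heatKernel_apply t
  have hLm : Integrable L := by
    refine IntegrableOn.integrable_indicator ?_ measurableSet_ball
    refine Integrable.mono' ((integrable_heatKernel ht).mul_const (‖fderiv ℝ a x‖ * (r / 2))).integrableOn ?_ ?_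
    · exact (hgk.aestronglyMeasurable.smul
        (fderiv ℝ a x).continuous.aestronglyMeasurable)
    · refine (ae_restrict_iff' measurableSet_ball).2 (.of_forall fun z hz => ?_)
      rw [mem_ball_zero_iff] at hz
      rw [norm_smul, Real.norm_of_nonneg (heatKernel_nonneg ht z)]
      have := heatKernel_nonneg ht z
      gcongr
      exact ((fderiv ℝ a x).le_opNorm z).trans (by gcongr)
  have hL0 : ∫ z, L z = 0 := by
    refine integral_eq_zero_of_odd fun z => ?_
    by_cases hz : z ∈ Metric.ball (0 : Plane) (r / 2)
    · have hz' : -z ∈ Metric.ball (0 : Plane) (r / 2) := by simpa using hz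
      simp only [L, indicator_of_mem hz, indicator_of_mem hz', heatKernel_neg, map_neg, smul_neg]
    · have hz' : -z ∉ Metric.ball (0 : Plane) (r / 2) := by simpa using hz
      simp only [L, indicator_of_notMem hz, indicator_of_notMem hz', neg_zero]
  have hi1 := integrable_weight ht
  have hi2 := (integrable_indicator_iff (measurableSet_ball.compl)).2
    (integrableOn_compl_ball_norm_pow_inv 2 (by omega) (R := r / 2) (by positivity))
  have hi3 : Integrable fun z : Plane =>
      (Metric.ball 0 (r / 2)).indicator (fun y : Plane => ‖y‖⁻¹) (x - z) :=
    (((integrable_indicator_iff measurableSet_ball).2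
      (integrableOn_ball_norm_inv (r / 2))).comp_sub_left x)
  have hG : Integrable G := ((hi1.1.const_mul _).add (hi2.const_mul _)).add (hi3.const_mul _)
  have hGi : ∫ z, G z ≤ 528 * Real.pi * C * A * t / r ^ 3 := by
    simp only [G]
    rw [integral_add_add (hi1.1.const_mul _) (hi2.const_mul _) (hi3.const_mul _),
      integral_const_mul (8 * A * C / r ^ 3 * t), integral_const_mul (3 * A * C * t / r),
      integral_const_mul (16 * A * C * t / r ^ 4), integral_indicator measurableSet_ball.compl,
      integral_sub_left_eq_self (fun z : Plane =>
        (Metric.ball 0 (r / 2)).indicator (fun y : Plane => ‖y‖⁻¹) z) volume x,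
      integral_indicator measurableSet_ball, setIntegral_ball_norm_inv (by positivity)]
    have h2 := setIntegral_compl_ball_norm_pow_inv_le 2 (by omega) (R := r / 2) (by positivity)
    calc _ ≤ 8 * A * C / r ^ 3 * t * (2 * Real.pi) +
          3 * A * C * t / r * (2 ^ (2 + 2) * (2 * Real.pi) * ((r / 2) ^ 2)⁻¹) +
          16 * A * C * t / r ^ 4 * (2 * Real.pi * (r / 2)) := by
          gcongr
          exact hi1.2
      _ ≤ _ := by
          rw [le_div_iff₀ (by positivity)]
          field_simp
          norm_num
          have : 0 ≤ C * Real.pi := by positivity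
          nlinarith
  have hφm : AEStronglyMeasurable φ volume := by
    refine AEStronglyMeasurable.add ?_ hLm.aestronglyMeasurable
    refine hgk.aestronglyMeasurable.smul (AEStronglyMeasurable.sub ?_ aestronglyMeasurable_const)
    exact (ha.stronglyMeasurable.comp_measurable (by fun_prop : Measurable fun z : Plane => x - z)).aestronglyMeasurable
  have hle : ∀ᵐ z, ‖φ z‖ ≤ G z := by
    have hne : ∀ᵐ z : Plane, z ≠ x := by simp [ae_iff, measure_singleton]
    filter_upwards [hne] with z hz
    have hxz : 0 < ‖x - z‖ := norm_pos_iff.2 (sub_ne_zero.2 hz.symm)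
    have hg0 := heatKernel_nonneg ht z
    have hG1 : 0 ≤ 8 * A * C / r ^ 3 * t * (t * ((√t + ‖z‖) ^ 4)⁻¹) := by positivity
    have hG2 : 0 ≤ 3 * A * C * t / r *
        (Metric.ball (0 : Plane) (r / 2))ᶜ.indicator (fun z => (‖z‖ ^ (2 + 2))⁻¹) z := by
      have : 0 ≤ (Metric.ball (0 : Plane) (r / 2))ᶜ.indicator (fun z => (‖z‖ ^ (2 + 2))⁻¹) z :=
        indicator_nonneg (fun _ _ => by positivity) _
      positivity
    have hG3 : 0 ≤ 16 * A * C * t / r ^ 4 *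
        (Metric.ball (0 : Plane) (r / 2)).indicator (fun y => ‖y‖⁻¹) (x - z) := by
      have : 0 ≤ (Metric.ball (0 : Plane) (r / 2)).indicator (fun y => ‖y‖⁻¹) (x - z) :=
        indicator_nonneg (fun _ _ => by positivity) _
      positivity
    by_cases hzb : z ∈ Metric.ball (0 : Plane) (r / 2)
    · have hz' : ‖z‖ < r / 2 := mem_ball_zero_iff.1 hzb
      have e : φ z = heatKernel t z • (a (x - z) - a x + fderiv ℝ a x z) := by
        simp only [φ, L, indicator_of_mem hzb, smul_add]
      have h1 : ‖φ z‖ ≤ 8 * A * C / r ^ 3 * t * (t * ((√t + ‖z‖) ^ 4)⁻¹) := by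
        rw [e, norm_smul, Real.norm_of_nonneg hg0]
        calc _ ≤ C * (t ^ 2 * ((√t + ‖z‖) ^ 6)⁻¹) * (8 * A / r ^ 3 * (√t + ‖z‖) ^ 2) := by
              gcongr
              · exact hg t ht z
              · refine (ha.taylor hx hz').trans ?_
                gcongr
                linarith
          _ = _ := by field_simp
      simp only [G]
      linarith
    · have hz' : r / 2 ≤ ‖z‖ := by simpa using hzb
      have hz0 : 0 < ‖z‖ := (by positivity : 0 < r / 2).trans_le hz'
      have hg4 : heatKernel t z ≤ C * (t * (‖z‖ ^ (2 + 2))⁻¹) := by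
        refine (hg t ht z).trans ?_
        have h5 : t ≤ (√t + ‖z‖) ^ 2 := le_sq_sqrt_add ht (norm_nonneg z)
        have h4 : ‖z‖ ^ 4 ≤ (√t + ‖z‖) ^ 4 := by gcongr; linarith
        have h6 : t * ‖z‖ ^ 4 ≤ (√t + ‖z‖) ^ 6 := by
          calc _ ≤ (√t + ‖z‖) ^ 2 * (√t + ‖z‖) ^ 4 := by gcongr
            _ = _ := by ring
        have h7 : t ^ 2 * ((√t + ‖z‖) ^ 6)⁻¹ ≤ t * (‖z‖ ^ (2 + 2))⁻¹ := by
          rw [← div_eq_mul_inv, ← div_eq_mul_inv, div_le_div_iff₀ (by positivity) (by positivity)]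
          calc _ = t * (t * ‖z‖ ^ 4) := by ring
            _ ≤ _ := by gcongr
        gcongr
      have e : φ z = heatKernel t z • (a (x - z) - a x) := by
        simp only [φ, L, indicator_of_notMem hzb, add_zero]
      have h1 : ‖φ z‖ ≤ heatKernel t z * (A / ‖x - z‖ + A / r) := by
        rw [e, norm_smul, Real.norm_of_nonneg hg0]
        gcongr
        exact (norm_sub_le _ _).trans (add_le_add (ha.norm_le (norm_pos_iff.1 hxz)) (ha.norm_le hx))
      have hzc : z ∈ (Metric.ball (0 : Plane) (r / 2))ᶜ := hzb
      have h2 : heatKernel t z * (A / r) ≤ A * C * t / r * (‖z‖ ^ (2 + 2))⁻¹ := by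
        calc _ ≤ C * (t * (‖z‖ ^ (2 + 2))⁻¹) * (A / r) := by gcongr
          _ = _ := by ring
      have h3 : heatKernel t z * (A / ‖x - z‖) ≤ 2 * A * C * t / r * (‖z‖ ^ (2 + 2))⁻¹ +
          16 * A * C * t / r ^ 4 *
            (Metric.ball (0 : Plane) (r / 2)).indicator (fun y => ‖y‖⁻¹) (x - z) := by
        by_cases hxb : x - z ∈ Metric.ball (0 : Plane) (r / 2)
        · rw [indicator_of_mem hxb]
          refine le_add_of_nonneg_of_le (by positivity) ?_
          calc _ ≤ C * (t * ((r / 2) ^ (2 + 2))⁻¹) * (A / ‖x - z‖) := by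
                gcongr
                exact hg4.trans (by gcongr)
            _ = _ := by rw [div_pow]; field_simp; norm_num; ring
        · rw [indicator_of_notMem hxb, mul_zero, add_zero]
          have hxb' : r / 2 ≤ ‖x - z‖ := by simpa using hxb
          calc _ ≤ C * (t * (‖z‖ ^ (2 + 2))⁻¹) * (A / (r / 2)) := by gcongr
            _ = _ := by field_simp
      simp only [G, indicator_of_mem hzc] at hG3 ⊢
      have h4 : 3 * A * C * t / r * (‖z‖ ^ (2 + 2))⁻¹ =
        2 * A * C * t / r * (‖z‖ ^ (2 + 2))⁻¹ + A * C * t / r * (‖z‖ ^ (2 + 2))⁻¹ := by ring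
      rw [mul_add] at h1
      linarith
  have hφ : Integrable φ := hG.mono' hφm hle
  have hca : Integrable fun z => heatKernel t z • a x := (integrable_heatKernel ht).smul_const _
  have hsplit : (fun z => heatKernel t z • a (x - z)) = fun z => φ z + -L z + heatKernel t z • a x := by
    funext z
    simp only [φ, smul_sub]
    abel
  have hheat : heatFlow t a x = (∫ z, φ z) + a x := by
    rw [heatFlow_eq_integral_sub, hsplit, integral_add_add (g := fun z => -L z) hφ hLm.neg hca,
      integral_neg, hL0, integral_smul_const, integral_heatKernel ht, neg_zero, add_zero,
      one_smul]
  rw [hheat, add_sub_cancel_right]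
  exact (norm_integral_le_of_norm_le hG hle).trans hGi


/-! ### Cancellation in the first moments of the kernel -/

/-- The rotation of the plane by `π/4`. -/
noncomputable def rotEighth : Plane ≃ₗᵢ[ℝ] Plane :=
  LinearIsometry.toLinearIsometryEquiv (F := Plane) (E₁ := Plane)
    { toFun := fun x => !₂[(√2)⁻¹ * (x 0 - x 1), (√2)⁻¹ * (x 0 + x 1)]
      map_add' := fun x y => by
        ext i; fin_cases i <;> simp <;> ring
      map_smul' := fun c x => by
        ext i; fin_cases i <;> simp <;> ring
      norm_map' := fun x => by
        have h2 : (√2)⁻¹ ^ 2 = (2 : ℝ)⁻¹ := by rw [inv_pow, Real.sq_sqrt (by norm_num)]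
        rw [EuclideanSpace.norm_eq, EuclideanSpace.norm_eq]
        congr 1
        simp [Fin.sum_univ_two, mul_pow, -inv_pow, h2]
        ring } rfl

theorem rotEighth_apply_zero (x : Plane) : rotEighth x 0 = (√2)⁻¹ * (x 0 - x 1) := rfl

theorem rotEighth_apply_one (x : Plane) : rotEighth x 1 = (√2)⁻¹ * (x 0 + x 1) := rfl

theorem sq_norm_plane (x : Plane) : ‖x‖ ^ 2 = x 0 ^ 2 + x 1 ^ 2 := by
  rw [EuclideanSpace.norm_sq_eq, Fin.sum_univ_two]; simp

/-- The functions `z_l 𝔽_{j;h,k}(z)` only have angular modes of order two and four, hence the sum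
of their values at the four images of a point by rotations of angle at most `3π/4` vanishes. -/
theorem sum_rotEighth_coord_mul_profileTensor (j h k l : Fin 2) (x : Plane) :
    x l * profileTensor x j h k +
      rotEighth x l * profileTensor (rotEighth x) j h k +
      (rotEighth (rotEighth x) l * profileTensor (rotEighth (rotEighth x)) j h k +
      rotEighth (rotEighth (rotEighth x)) l *
        profileTensor (rotEighth (rotEighth (rotEighth x))) j h k) = 0 := by
  set c : ℝ := (√2)⁻¹ with hc
  have h2 : c ^ 2 = (2 : ℝ)⁻¹ := by rw [hc, inv_pow, Real.sq_sqrt (by norm_num)]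
  have h4 : c ^ 4 = (4 : ℝ)⁻¹ := by
    rw [show c ^ 4 = (c ^ 2) ^ 2 by ring, h2]; norm_num
  have r0 : ∀ y : Plane, rotEighth y 0 = c * (y 0 - y 1) := rotEighth_apply_zero
  have r1 : ∀ y : Plane, rotEighth y 1 = c * (y 0 + y 1) := rotEighth_apply_one
  have s0 : rotEighth (rotEighth x) 0 = -x 1 := by
    rw [r0, r0, r1]; linear_combination (-2 * x 1) * h2
  have s1 : rotEighth (rotEighth x) 1 = x 0 := by
    rw [r1, r0, r1]; linear_combination (2 * x 0) * h2
  simp only [profileTensor, LinearIsometryEquiv.norm_map, div_eq_mul_inv]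
  generalize (‖x‖ ^ 6)⁻¹ = D
  rw [sq_norm_plane]
  have t0 : rotEighth (rotEighth (rotEighth x)) 0 = c * (-x 1 - x 0) := by rw [r0, s0, s1]
  have t1 : rotEighth (rotEighth (rotEighth x)) 1 = c * (-x 1 + x 0) := by rw [r1, s0, s1]
  have q0 := r0 x
  have q1 := r1 x
  obtain ⟨p, hp⟩ : ∃ p, x 0 = p := ⟨_, rfl⟩
  obtain ⟨q, hq⟩ : ∃ q, x 1 = q := ⟨_, rfl⟩
  simp only [hp, hq] at q0 q1 s0 s1 t0 t1 ⊢
  fin_cases j <;> fin_cases h <;> fin_cases k <;> fin_cases l <;>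
    simp only [Fin.zero_eta, Fin.mk_one, Fin.isValue, t0, t1, s0, s1, q0, q1, hp, hq, if_true, zero_ne_one,
      one_ne_zero, if_false] <;> ring_nf <;> simp only [h2, h4] <;> ring_nf

theorem measurable_profileTensor (j h k : Fin 2) : Measurable fun z => profileTensor z j h k := by
  have hc := measurable_coord
  unfold profileTensor
  split_ifs <;> fun_prop

/-- The first moments of `𝔽` over centred annuli vanish. -/
theorem setIntegral_annulus_coord_mul_profileTensor (j h k l : Fin 2) {r : ℝ} (hr : 0 < r) (R : ℝ) :
    IntegrableOn (fun z : Plane => z l * profileTensor z j h k) {z | r ≤ ‖z‖ ∧ ‖z‖ < R} ∧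
      ∫ z in {z : Plane | r ≤ ‖z‖ ∧ ‖z‖ < R}, z l * profileTensor z j h k = 0 := by
  obtain ⟨C, hC, hF⟩ := exists_abs_profileTensor_le
  have hS : MeasurableSet {z : Plane | r ≤ ‖z‖ ∧ ‖z‖ < R} :=
    (measurableSet_le measurable_const measurable_norm).inter
      (measurableSet_lt measurable_norm measurable_const)
  have hsub : {z : Plane | r ≤ ‖z‖ ∧ ‖z‖ < R} ⊆ Metric.ball 0 R := fun z hz =>
    mem_ball_zero_iff.2 hz.2
  have hi : IntegrableOn (fun z : Plane => z l * profileTensor z j h k)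
      {z | r ≤ ‖z‖ ∧ ‖z‖ < R} := by
    refine Integrable.mono' (((integrableOn_ball_norm_inv R).mono_set hsub).const_mul (C / r)) ?_ ?_
    · exact ((measurable_coord l).mul (measurable_profileTensor j h k)).aestronglyMeasurable
    · refine (ae_restrict_iff' hS).2 (.of_forall fun z hz => ?_)
      have hz0 : 0 < ‖z‖ := hr.trans_le hz.1
      rw [norm_mul, Real.norm_eq_abs, Real.norm_eq_abs]
      calc _ ≤ ‖z‖ * (C / ‖z‖ ^ 3) := by
            gcongr
            · exact abs_coord_le z l
            · exact hF j h k z (norm_pos_iff.1 hz0)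
        _ = C / ‖z‖ * ‖z‖⁻¹ := by field_simp
        _ ≤ _ := by gcongr; exact hz.1
  refine ⟨hi, ?_⟩
  let f : Plane → ℝ := {z : Plane | r ≤ ‖z‖ ∧ ‖z‖ < R}.indicator
    (fun z : Plane => z l * profileTensor z j h k)
  have hf : Integrable f := hi.integrable_indicator hS
  rw [← integral_indicator hS]
  change ∫ z, f z = 0
  have hrot : ∀ g : Plane → ℝ, ∫ z, g (rotEighth z) = ∫ z, g z := fun g =>
    rotEighth.measurePreserving.integral_comp rotEighth.toHomeomorph.measurableEmbedding g
  have hroti : ∀ g : Plane → ℝ, Integrable g → Integrable fun z => g (rotEighth z) := fun g hg =>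
    (rotEighth.measurePreserving.integrable_comp_emb
      rotEighth.toHomeomorph.measurableEmbedding).2 hg
  have hf1 := hroti _ hf
  have hf2 := hroti _ hf1
  have hf3 := hroti _ hf2
  have e1 := hrot f
  have e2 := hrot fun z => f (rotEighth z)
  have e3 := hrot fun z => f (rotEighth (rotEighth z))
  have h0 : ∫ z, (f z + f (rotEighth z) + (f (rotEighth (rotEighth z)) +
      f (rotEighth (rotEighth (rotEighth z))))) = 0 := by
    rw [← integral_zero Plane ℝ]
    congr 1
    funext z
    simp only [f, indicator, mem_ofPred_eq, LinearIsometryEquiv.norm_map]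
    split_ifs
    · exact sum_rotEighth_coord_mul_profileTensor j h k l z
    · simp
  rw [integral_add (f := fun z => f z + f (rotEighth z))
      (g := fun z => f (rotEighth (rotEighth z)) + f (rotEighth (rotEighth (rotEighth z))))
      (hf.add hf1) (hf2.add hf3),
    integral_add hf hf1, integral_add hf2 hf3, e3, e2, e1] at h0
  linarith

/-- The first moments of the Oseen kernels over centred balls are bounded, uniformly in the radius
and in time. -/
theorem exists_abs_moment_le : ∃ C > 0, ∀ (j h k l : Fin 2) (τ : ℝ), 0 < τ → ∀ R : ℝ,
    |∫ z in Metric.ball (0 : Plane) R, z l * oseenKernel j h k τ z| ≤ C := by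
  obtain ⟨C, hC, hK⟩ := exists_isXField_oseenKernel
  obtain ⟨C', hC', hKF⟩ := exists_abs_oseenKernel_sub_profileTensor_le
  have hpi := Real.pi_pos
  refine ⟨Real.pi * C + 32 * Real.pi * C', by positivity, ?_⟩
  intro j h k l τ hτ R
  have hst : 0 < √τ := Real.sqrt_pos.2 hτ
  have hss : √τ ^ 2 = τ := Real.sq_sqrt hτ.le
  have hS : MeasurableSet {z : Plane | √τ ≤ ‖z‖ ∧ ‖z‖ < R} :=
    (measurableSet_le measurable_const measurable_norm).inter
      (measurableSet_lt measurable_norm measurable_const)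
  obtain ⟨hiF, hF0⟩ := setIntegral_annulus_coord_mul_profileTensor j h k l hst R
  have hKm : Measurable (oseenKernel j h k τ) :=
    (hK j h k).stronglyMeasurable.measurable.comp (measurable_const.prodMk measurable_id)
  have hfm : Measurable fun z : Plane => z l * oseenKernel j h k τ z := (measurable_coord l).mul hKm
  have hfb : ∀ z : Plane, |z l * oseenKernel j h k τ z| ≤ C / τ := by
    intro z
    have hz : 0 < √τ + ‖z‖ := by positivity
    rw [abs_mul]
    calc _ ≤ (√τ + ‖z‖) * (C / (√τ + ‖z‖) ^ 3) := by
          gcongr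
          · exact (abs_coord_le z l).trans (by linarith)
          · exact (hK j h k).abs_le hτ z
      _ = C / (√τ + ‖z‖) ^ 2 := by field_simp
      _ ≤ C / τ := by gcongr; exact le_sq_sqrt_add hτ (norm_nonneg z)
  have hiK : IntegrableOn (fun z : Plane => z l * oseenKernel j h k τ z) (Metric.ball 0 R) := by
    refine Measure.integrableOn_of_bounded (M := C / τ) measure_ball_lt_top.ne
      hfm.aestronglyMeasurable (.of_forall fun z => hfb z)
  have e : ∫ z in Metric.ball (0 : Plane) R, z l * oseenKernel j h k τ z =
      ∫ z, ((Metric.ball (0 : Plane) R).indicator (fun z => z l * oseenKernel j h k τ z) z -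
        {z : Plane | √τ ≤ ‖z‖ ∧ ‖z‖ < R}.indicator (fun z => z l * profileTensor z j h k) z) := by
    rw [integral_sub (hiK.integrable_indicator measurableSet_ball) (hiF.integrable_indicator hS),
      integral_indicator measurableSet_ball, integral_indicator hS, hF0, sub_zero]
  have hi1 : Integrable ((Metric.ball (0 : Plane) √τ).indicator fun _ => C / τ) :=
    (integrableOn_const measure_ball_lt_top.ne).integrable_indicator measurableSet_ball
  have hi2 : Integrable ((Metric.ball (0 : Plane) √τ)ᶜ.indicator
      fun z => C' * τ * (‖z‖ ^ (2 + 2))⁻¹) :=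
    IntegrableOn.integrable_indicator
      (Integrable.const_mul (integrableOn_compl_ball_norm_pow_inv 2 (by omega) hst) _)
      measurableSet_ball.compl
  rw [e, ← Real.norm_eq_abs]
  refine (norm_integral_le_of_norm_le (hi1.add hi2) (.of_forall fun z => ?_)).trans ?_
  · rw [Pi.add_apply]
    by_cases hz : ‖z‖ < √τ
    · have h1 : z ∈ Metric.ball (0 : Plane) √τ := mem_ball_zero_iff.2 hz
      have h2 : z ∉ (Metric.ball (0 : Plane) √τ)ᶜ := fun h => h h1
      have h3 : z ∉ {z : Plane | √τ ≤ ‖z‖ ∧ ‖z‖ < R} := fun h => absurd h.1 (not_le.2 hz)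
      rw [indicator_of_mem h1, indicator_of_notMem h2, indicator_of_notMem h3, sub_zero, add_zero]
      exact (norm_indicator_le_norm_self _ _).trans (hfb z)
    · have h1 : z ∉ Metric.ball (0 : Plane) √τ := fun h => hz (mem_ball_zero_iff.1 h)
      have h2 : z ∈ (Metric.ball (0 : Plane) √τ)ᶜ := h1
      rw [not_lt] at hz
      have hz0 : 0 < ‖z‖ := hst.trans_le hz
      rw [indicator_of_notMem h1, indicator_of_mem h2, zero_add]
      by_cases hR : ‖z‖ < R
      · have h4 : z ∈ Metric.ball (0 : Plane) R := mem_ball_zero_iff.2 hR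
        have h5 : z ∈ {z : Plane | √τ ≤ ‖z‖ ∧ ‖z‖ < R} := ⟨hz, hR⟩
        rw [indicator_of_mem h4, indicator_of_mem h5, ← mul_sub, norm_mul, Real.norm_eq_abs,
          Real.norm_eq_abs]
        calc _ ≤ ‖z‖ * (C' * τ / ‖z‖ ^ 5) := by
              gcongr
              · exact abs_coord_le z l
              · exact hKF j h k τ hτ z (norm_pos_iff.1 hz0)
          _ = _ := by field_simp
      · have h4 : z ∉ Metric.ball (0 : Plane) R := fun h => hR (mem_ball_zero_iff.1 h)
        have h5 : z ∉ {z : Plane | √τ ≤ ‖z‖ ∧ ‖z‖ < R} := fun h => hR h.2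
        rw [indicator_of_notMem h4, indicator_of_notMem h5, sub_zero, norm_zero]
        positivity
  · rw [integral_add' hi1 hi2, integral_indicator measurableSet_ball,
      integral_indicator measurableSet_ball.compl, integral_const_mul, setIntegral_const,
      volume_real_ball_plane hst.le, smul_eq_mul]
    have := setIntegral_compl_ball_norm_pow_inv_le 2 (by omega) hst
    rw [hss] at this ⊢
    calc _ ≤ τ * Real.pi * (C / τ) + C' * τ * (2 ^ (2 + 2) * (2 * Real.pi) * τ⁻¹) := by gcongr
      _ = _ := by field_simp; ring


/-! ### The Duhamel integral away from the parabolic origin -/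

theorem half_norm_lt_of_mem_ball {x y : Plane} (hy : y ∈ Metric.ball x (‖x‖ / 2)) :
    ‖x‖ / 2 < ‖y‖ := by
  rw [mem_ball_iff_norm'] at hy
  have := norm_le_norm_add_norm_sub' x y
  linarith

section Zones

variable {K w : ℝ → Plane → ℝ} {C A τ s : ℝ} {x : Plane}

/-- The zone near `x`. The source is replaced by its Taylor polynomial at `x`; the constant term is
integrated against an odd kernel, the linear one against a kernel with bounded first moments. -/
theorem abs_setIntegral_near_target_le {Cm : ℝ} (hK : IsXField 3 C K)
    (hodd : ∀ z, K τ (-z) = -K τ z)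
    (hm : ∀ l : Fin 2, |∫ z in Metric.ball (0 : Plane) (‖x‖ / 2), z l * K τ z| ≤ Cm)
    (hw : IsXField 2 A w) (hτ : 0 < τ) (hs : 0 < s) (hx : x ≠ 0) :
    |∫ y in Metric.ball x (‖x‖ / 2), K τ (x - y) * w s y| ≤
      (16 * Real.pi * C + 2 * Cm) * A / ‖x‖ ^ 3 := by
  have hC := hK.nonneg
  have hA := hw.nonneg
  have hpi := Real.pi_pos
  have hsτ : 0 < √τ := Real.sqrt_pos.2 hτ
  have hss : 0 < √s := Real.sqrt_pos.2 hs
  set r := ‖x‖ with hr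
  have hr0 : 0 < r := norm_pos_iff.2 hx
  let D : Plane →L[ℝ] ℝ := fderiv ℝ (w s) x
  let k : Plane → ℝ := (Metric.ball (0 : Plane) (r / 2)).indicator (K τ)
  have hKm : Measurable (K τ) :=
    hK.stronglyMeasurable.measurable.comp (measurable_const.prodMk measurable_id)
  have hwc := hw.contDiff s hs
  have hKb : ∀ z, |K τ z| ≤ C / √τ ^ 3 := fun z => (hK.abs_le hτ z).trans (by
    gcongr; linarith [norm_nonneg z])
  have hKi : IntegrableOn (K τ) (Metric.ball 0 (r / 2)) :=
    Measure.integrableOn_of_bounded (M := C / √τ ^ 3) measure_ball_lt_top.ne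
      hKm.aestronglyMeasurable (.of_forall fun z => hKb z)
  have hk : Integrable k := hKi.integrable_indicator measurableSet_ball
  have hk0 : ∫ z, k z = 0 := by
    refine integral_eq_zero_of_odd fun z => ?_
    by_cases hz : z ∈ Metric.ball (0 : Plane) (r / 2)
    · have hz' : -z ∈ Metric.ball (0 : Plane) (r / 2) := by simpa using hz
      simp only [k, indicator_of_mem hz, indicator_of_mem hz', hodd]
    · have hz' : -z ∉ Metric.ball (0 : Plane) (r / 2) := by simpa using hz
      simp only [k, indicator_of_notMem hz, indicator_of_notMem hz', neg_zero]
  have hDz : ∀ z : Plane, D z = z 0 * D (basisVec 0) + z 1 * D (basisVec 1) := by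
    intro z
    have e : z = z 0 • basisVec 0 + z 1 • basisVec 1 := by
      ext i; fin_cases i <;> simp
    nth_rewrite 1 [e]
    rw [map_add, map_smul, map_smul, smul_eq_mul, smul_eq_mul]
  have hDn : ∀ l : Fin 2, |D (basisVec l)| ≤ A / r ^ 3 := by
    intro l
    have h1 := D.le_opNorm (basisVec l)
    rw [norm_basisVec, mul_one, norm_fderiv_eq_norm_iteratedFDeriv_one] at h1
    refine h1.trans ((hw.bound s hs 1 (by norm_num) x).trans ?_)
    gcongr
    linarith
  have hl : ∀ l : Fin 2, Integrable (fun z => z l * k z) ∧ |∫ z, z l * k z| ≤ Cm := by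
    intro l
    have e : (fun z : Plane => z l * k z) =
        (Metric.ball (0 : Plane) (r / 2)).indicator fun z => z l * K τ z := by
      funext z
      by_cases hz : z ∈ Metric.ball (0 : Plane) (r / 2)
      · simp only [k, indicator_of_mem hz]
      · simp only [k, indicator_of_notMem hz, mul_zero]
    rw [e]
    refine ⟨IntegrableOn.integrable_indicator ?_ measurableSet_ball, ?_⟩
    · refine Measure.integrableOn_of_bounded (M := r / 2 * (C / √τ ^ 3)) measure_ball_lt_top.ne
        ((measurable_coord l).mul hKm).aestronglyMeasurable ?_
      refine (ae_restrict_iff' measurableSet_ball).2 (.of_forall fun z hz => ?_)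
      rw [norm_mul]
      gcongr
      · exact (abs_coord_le z l).trans (mem_ball_zero_iff.1 hz).le
      · exact hKb z
    · rw [integral_indicator measurableSet_ball]
      exact hm l
  have hshift : ∫ y in Metric.ball x (r / 2), K τ (x - y) * w s y = ∫ z, k z * w s (x - z) := by
    rw [← integral_indicator measurableSet_ball,
      ← integral_sub_left_eq_self (fun z => k z * w s (x - z)) volume x]
    congr 1
    funext y
    have e : y ∈ Metric.ball x (r / 2) ↔ x - y ∈ Metric.ball (0 : Plane) (r / 2) := by
      rw [mem_ball_iff_norm', mem_ball_zero_iff]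
    by_cases hy : y ∈ Metric.ball x (r / 2)
    · simp only [k, indicator_of_mem hy, indicator_of_mem (e.1 hy), sub_sub_cancel]
    · simp only [k, indicator_of_notMem hy, indicator_of_notMem (fun h => hy (e.2 h)), zero_mul]
  let φ : Plane → ℝ := fun z => k z * (w s (x - z) - w s x + D z)
  have hφm : AEStronglyMeasurable φ volume := by
    refine hk.aestronglyMeasurable.mul ?_
    exact ((((hwc.continuous.comp (continuous_const.sub continuous_id)).sub
      continuous_const).add D.continuous)).aestronglyMeasurable
  have hG : Integrable ((Metric.ball (0 : Plane) (r / 2)).indicator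
      fun z => 16 * C * A / r ^ 4 * ‖z‖⁻¹) :=
    IntegrableOn.integrable_indicator
      (Integrable.const_mul (integrableOn_ball_norm_inv (r / 2)) _) measurableSet_ball
  have hφle : ∀ z, ‖φ z‖ ≤ (Metric.ball (0 : Plane) (r / 2)).indicator
      (fun z => 16 * C * A / r ^ 4 * ‖z‖⁻¹) z := by
    intro z
    by_cases hz : z ∈ Metric.ball (0 : Plane) (r / 2)
    · have hz' : ‖z‖ < r / 2 := mem_ball_zero_iff.1 hz
      simp only [φ, k, indicator_of_mem hz, norm_mul]
      rcases eq_or_ne z 0 with rfl | hz0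
      · simp
      have hz0' : 0 < ‖z‖ := norm_pos_iff.2 hz0
      have ht : ‖w s (x - z) - w s x + D z‖ ≤ 16 * A / r ^ 4 * ‖z‖ ^ 2 := by
        refine norm_taylor_two_le hwc.contDiffOn (fun y hy => ?_) hz'
        have hy' := half_norm_lt_of_mem_ball hy
        refine (hw.bound s hs 2 le_rfl y).trans ?_
        calc _ ≤ A / (r / 2) ^ (2 + 2) := by gcongr; linarith
          _ = _ := by rw [div_pow]; field_simp; ring
      calc _ ≤ C / ‖z‖ ^ 3 * (16 * A / r ^ 4 * ‖z‖ ^ 2) := by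
            gcongr
            refine (hK.norm_le hτ z).trans ?_
            gcongr
            linarith
        _ = _ := by field_simp
    · simp only [φ, k, indicator_of_notMem hz, zero_mul, norm_zero, le_refl]
  have hφ : Integrable φ := hG.mono' hφm (.of_forall hφle)
  have hφi : |∫ z, φ z| ≤ 16 * Real.pi * C * A / r ^ 3 := by
    refine (norm_integral_le_of_norm_le hG (.of_forall hφle)).trans (le_of_eq ?_)
    rw [integral_indicator measurableSet_ball, integral_const_mul,
      setIntegral_ball_norm_inv (by positivity)]
    field_simp
  have hsplit : ∫ z, k z * w s (x - z) = (∫ z, φ z) -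
      ((∫ z, z 0 * k z) * D (basisVec 0) + (∫ z, z 1 * k z) * D (basisVec 1)) := by
    have e : (fun z => k z * w s (x - z)) = fun z => φ z + k z * w s x +
        (-(z 0 * k z * D (basisVec 0) + z 1 * k z * D (basisVec 1))) := by
      funext z
      simp only [φ, hDz z]
      ring
    rw [e, integral_add_add (h := fun z : Plane =>
        -(z 0 * k z * D (basisVec 0) + z 1 * k z * D (basisVec 1))) hφ (hk.mul_const _)
      (((hl 0).1.mul_const _).add ((hl 1).1.mul_const _)).neg, integral_neg,
      integral_add ((hl 0).1.mul_const _) ((hl 1).1.mul_const _), integral_mul_const,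
      integral_mul_const, integral_mul_const, hk0]
    ring
  have hmom : ∀ l : Fin 2, |(∫ z, z l * k z) * D (basisVec l)| ≤ Cm * (A / r ^ 3) := by
    intro l
    rw [abs_mul]
    have := (abs_nonneg _).trans (hl l).2
    exact mul_le_mul (hl l).2 (hDn l) (abs_nonneg _) this
  rw [hshift, hsplit]
  have h0 := abs_le.1 (hmom 0)
  have h1 := abs_le.1 (hmom 1)
  have h2 := abs_le.1 hφi
  have e : (16 * Real.pi * C + 2 * Cm) * A / r ^ 3 =
    16 * Real.pi * C * A / r ^ 3 + 2 * (Cm * (A / r ^ 3)) := by ring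
  rw [e, abs_le]
  constructor <;> linarith [h0.1, h0.2, h1.1, h1.2, h2.1, h2.2]

/-- The zone near the origin, where the kernel is almost constant. -/
theorem abs_setIntegral_near_origin_le {C' f : ℝ} (hK : IsXField 3 C K)
    (hf : |K τ x - f| ≤ C' * τ / ‖x‖ ^ 5) (hw : IsXField 2 A w) (hτ : 0 < τ) (hs : 0 < s)
    (hx : x ≠ 0) :
    |∫ y in Metric.ball 0 (‖x‖ / 2), (K τ (x - y) - f) * w s y| ≤
      Real.pi * A * (16 * C / ‖x‖ ^ 3 + C' * τ / (√s * ‖x‖ ^ 4)) := by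
  have hC := hK.nonneg
  have hA := hw.nonneg
  have hss : 0 < √s := Real.sqrt_pos.2 hs
  set r := ‖x‖ with hr
  have hr0 : 0 < r := norm_pos_iff.2 hx
  have hne : ∀ᵐ y ∂(volume.restrict (Metric.ball (0 : Plane) (r / 2))), y ≠ 0 :=
    ae_restrict_of_ae (by simp [ae_iff, measure_singleton])
  have hmem := ae_restrict_mem (μ := volume) (s := Metric.ball (0 : Plane) (r / 2))
    measurableSet_ball
  have hmvt : ∀ y ∈ Metric.ball (0 : Plane) (r / 2), |K τ (x - y) - K τ x| ≤
      16 * C / r ^ 4 * ‖y‖ := by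
    intro y hy
    have hy' := mem_ball_zero_iff.1 hy
    have hd : ∀ z ∈ Metric.ball x (r / 2), DifferentiableAt ℝ (K τ) z := fun z _ =>
      (hK.contDiff τ hτ).contDiffAt.differentiableAt (by norm_num)
    have hxb : x ∈ Metric.ball x (r / 2) := Metric.mem_ball_self (by positivity)
    have hyb : x - y ∈ Metric.ball x (r / 2) := by
      rw [mem_ball_iff_norm]; simpa using hy'
    have := (convex_ball x (r / 2)).norm_image_sub_le_of_norm_fderiv_le hd
      (C := 16 * C / r ^ 4) (fun z hz => ?_) hxb hyb
    · simpa using this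
    · rw [norm_fderiv_eq_norm_iteratedFDeriv_one]
      have hz' := half_norm_lt_of_mem_ball hz
      refine (hK.bound τ hτ 1 (by norm_num) z).trans ?_
      calc _ ≤ C / (r / 2) ^ (3 + 1) := by
            gcongr
            linarith [Real.sqrt_nonneg τ]
        _ = _ := by rw [div_pow]; field_simp; ring
  have hG : IntegrableOn (fun y : Plane => (16 * C * A / r ^ 4 + C' * τ * A / (√s * r ^ 5)) * ‖y‖⁻¹)
      (Metric.ball 0 (r / 2)) :=
    Integrable.const_mul (integrableOn_ball_norm_inv (r / 2)) _
  have hC' : 0 ≤ C' * τ / r ^ 5 := (abs_nonneg _).trans hf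
  rw [← Real.norm_eq_abs]
  refine (norm_integral_le_of_norm_le hG ?_).trans (le_of_eq ?_)
  · filter_upwards [hne, hmem] with y hy0 hy
    have hy0' : 0 < ‖y‖ := norm_pos_iff.2 hy0
    have e : K τ (x - y) - f = (K τ (x - y) - K τ x) + (K τ x - f) := by ring
    have hw1 : |w s y| ≤ A / ‖y‖ ^ 2 := (hw.abs_le hs y).trans (by gcongr; linarith)
    have hw2 : |w s y| ≤ A * ((√s)⁻¹ * ‖y‖⁻¹) := by
      refine (hw.abs_le hs y).trans ?_
      rw [div_eq_mul_inv]
      gcongr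
      exact inv_sq_sqrt_add_norm_le hs hy0
    rw [e, add_mul]
    refine (norm_add_le _ _).trans ?_
    rw [norm_mul, norm_mul, Real.norm_eq_abs, Real.norm_eq_abs, Real.norm_eq_abs]
    calc _ ≤ 16 * C / r ^ 4 * ‖y‖ * (A / ‖y‖ ^ 2) +
          C' * τ / r ^ 5 * (A * ((√s)⁻¹ * ‖y‖⁻¹)) := by
          gcongr
          exact hmvt y hy
      _ = _ := by field_simp
  · rw [integral_const_mul, setIntegral_ball_norm_inv (by positivity)]
    field_simp

/-- The zone away from both the origin and `x`. -/
theorem abs_setIntegral_far_le (hK : IsXField 3 C K) (hw : IsXField 2 A w) (hτ : 0 < τ)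
    (hs : 0 < s) (hx : x ≠ 0) :
    |∫ y in (Metric.ball 0 (‖x‖ / 2))ᶜ ∩ (Metric.ball x (‖x‖ / 2))ᶜ, K τ (x - y) * w s y| ≤
      128 * Real.pi * C * A / ‖x‖ ^ 3 := by
  have hC := hK.nonneg
  have hA := hw.nonneg
  have hpi := Real.pi_pos
  set r := ‖x‖ with hr
  have hr0 : 0 < r := norm_pos_iff.2 hx
  let k : Plane → ℝ := (Metric.ball (0 : Plane) (r / 2))ᶜ.indicator fun z => (‖z‖ ^ (1 + 2))⁻¹
  have hk : Integrable k := (integrableOn_compl_ball_norm_pow_inv 1 le_rfl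
    (by positivity)).integrable_indicator measurableSet_ball.compl
  have hk' : Integrable fun y => 4 * C * A / r ^ 2 * k (x - y) := (hk.comp_sub_left x).const_mul _
  have hS : MeasurableSet ((Metric.ball (0 : Plane) (r / 2))ᶜ ∩ (Metric.ball x (r / 2))ᶜ) :=
    measurableSet_ball.compl.inter measurableSet_ball.compl
  have hkn : ∀ y, 0 ≤ k y := fun y => indicator_nonneg (fun _ _ => by positivity) y
  rw [← Real.norm_eq_abs]
  refine (norm_integral_le_of_norm_le hk'.integrableOn
    ((ae_restrict_iff' hS).2 (.of_forall fun y hy => ?_))).trans ?_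
  · have h1 : r / 2 ≤ ‖y‖ := by simpa using hy.1
    have h2 : r / 2 ≤ ‖x - y‖ := by
      have := hy.2
      rw [mem_compl_iff, mem_ball_iff_norm', not_lt] at this
      exact this
    have h3 : x - y ∈ (Metric.ball (0 : Plane) (r / 2))ᶜ := by simpa using h2
    have h4 : 0 < ‖x - y‖ := (by positivity : 0 < r / 2).trans_le h2
    simp only [k, indicator_of_mem h3, norm_mul]
    calc _ ≤ C / ‖x - y‖ ^ 3 * (A / (r / 2) ^ 2) := by
          gcongr
          · refine (hK.norm_le hτ _).trans ?_
            gcongr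
            linarith [Real.sqrt_nonneg τ]
          · refine (hw.norm_le hs _).trans ?_
            gcongr
            linarith [Real.sqrt_nonneg s]
      _ = _ := by rw [div_pow]; field_simp; norm_num; ring
  · refine (setIntegral_le_integral hk' (.of_forall fun y => by
      have := hkn (x - y)
      positivity)).trans ?_
    rw [integral_const_mul, integral_sub_left_eq_self k volume x,
      integral_indicator measurableSet_ball.compl]
    have := setIntegral_compl_ball_norm_pow_inv_le 1 le_rfl (R := r / 2) (by positivity)
    calc _ ≤ 4 * C * A / r ^ 2 * (2 ^ (1 + 2) * (2 * Real.pi) * ((r / 2) ^ 1)⁻¹) := by gcongr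
      _ = _ := by field_simp; norm_num; ring

end Zones


/-! ### The profile of the solution -/

theorem measurableSet_annulus (s r : ℝ) : MeasurableSet {y : Plane | √s ≤ ‖y‖ ∧ ‖y‖ ≤ r} :=
  (measurableSet_le measurable_const measurable_norm).inter
    (measurableSet_le measurable_norm measurable_const)

theorem IsDatum.abs_mul_le {B : ℝ} {a : Plane → Plane} (ha : IsDatum B a) (h k : Fin 2) {y : Plane}
    (hy : y ≠ 0) : |a y h * a y k| ≤ B ^ 2 / ‖y‖ ^ 2 := by
  have := ha.nonneg
  rw [abs_mul, ← div_pow, sq]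
  have h1 := ha.norm_le hy
  gcongr
  · exact (abs_coord_le _ _).trans h1
  · exact (abs_coord_le _ _).trans h1

theorem IsDatum.measurable_mul {B : ℝ} {a : Plane → Plane} (ha : IsDatum B a) (h k : Fin 2) :
    Measurable fun y => a y h * a y k :=
  ((measurable_coord h).comp ha.stronglyMeasurable.measurable).mul
    ((measurable_coord k).comp ha.stronglyMeasurable.measurable)

theorem IsDatum.integrableOn_annulus {B : ℝ} {a : Plane → Plane} (ha : IsDatum B a) (h k : Fin 2)
    {s : ℝ} (hs : 0 < s) (r : ℝ) :
    IntegrableOn (fun y => a y h * a y k) {y : Plane | √s ≤ ‖y‖ ∧ ‖y‖ ≤ r} := by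
  have hss : 0 < √s := Real.sqrt_pos.2 hs
  have hsub : {y : Plane | √s ≤ ‖y‖ ∧ ‖y‖ ≤ r} ⊆ Metric.ball 0 (r + 1) := fun y hy => by
    have := hy.2
    rw [mem_ball_zero_iff]; linarith
  refine Integrable.mono' (((integrableOn_ball_norm_inv (r + 1)).mono_set hsub).const_mul
    (B ^ 2 / √s)) (ha.measurable_mul h k).aestronglyMeasurable ?_
  refine (ae_restrict_iff' (measurableSet_annulus s r)).2 (.of_forall fun y hy => ?_)
  have hy0 : 0 < ‖y‖ := hss.trans_le hy.1
  refine (ha.abs_mul_le h k (norm_pos_iff.1 hy0)).trans ?_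
  calc _ = B ^ 2 / ‖y‖ * ‖y‖⁻¹ := by field_simp
    _ ≤ _ := by gcongr; exact hy.1

/-- At each time, the second moments of `u` over a ball and those of `a` over an annulus with
parabolic inner radius differ by a bounded quantity. -/
theorem abs_setIntegral_tensorEntry_sub_le {B E : ℝ} {a : Plane → Plane} {u : ℝ → Plane → Plane}
    (hE : 0 ≤ E) (hu : IsXField 1 B u) (ha : IsDatum B a)
    (hua : ∀ s, 0 < s → ∀ y, y ≠ 0 → ‖u s y - a y‖ ≤ E * (s / ‖y‖ ^ 3 + √s / ‖y‖ ^ 2))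
    (h k : Fin 2) {s r : ℝ} (hs : 0 < s) (hr : 0 < r) :
    |(∫ y in Metric.ball 0 (r / 2), tensorEntry u u h k s y) -
      ∫ y in {y : Plane | √s ≤ ‖y‖ ∧ ‖y‖ ≤ r}, a y h * a y k| ≤
        10 * Real.pi * B ^ 2 + 64 * Real.pi * E * B := by
  have hpi := Real.pi_pos
  have hB := hu.nonneg
  have hss : 0 < √s := Real.sqrt_pos.2 hs
  have hs2 : √s ^ 2 = s := Real.sq_sqrt hs.le
  have hann := measurableSet_annulus s r
  have huc := (hu.tensorEntry hu h k).contDiff s hs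
  have hiw : IntegrableOn (tensorEntry u u h k s) (Metric.ball 0 (r / 2)) :=
    (huc.continuous.continuousOn.integrableOn_compact (isCompact_closedBall 0 (r / 2))).mono_set
      Metric.ball_subset_closedBall
  have hia := ha.integrableOn_annulus h k hs r
  have hi1 : Integrable ((Metric.ball (0 : Plane) √s).indicator fun y => B ^ 2 / √s * ‖y‖⁻¹) :=
    IntegrableOn.integrable_indicator (Integrable.const_mul (integrableOn_ball_norm_inv √s) _)
      measurableSet_ball
  have hi2 : Integrable ((Metric.ball (0 : Plane) √s)ᶜ.indicator
      fun y => 4 * E * B * √s * (‖y‖ ^ (1 + 2))⁻¹) :=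
    IntegrableOn.integrable_indicator (Integrable.const_mul
      (integrableOn_compl_ball_norm_pow_inv 1 le_rfl hss) _) measurableSet_ball.compl
  have hi3 : Integrable ((Metric.ball (0 : Plane) (2 * r)).indicator
      fun y => 2 * B ^ 2 / r * ‖y‖⁻¹) :=
    IntegrableOn.integrable_indicator (Integrable.const_mul (integrableOn_ball_norm_inv (2 * r)) _)
      measurableSet_ball
  have hn1 : ∀ y, 0 ≤ (Metric.ball (0 : Plane) √s).indicator (fun y => B ^ 2 / √s * ‖y‖⁻¹) y :=
    fun y => indicator_nonneg (fun _ _ => by positivity) y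
  have hn2 : ∀ y, 0 ≤ (Metric.ball (0 : Plane) √s)ᶜ.indicator
      (fun y => 4 * E * B * √s * (‖y‖ ^ (1 + 2))⁻¹) y :=
    fun y => indicator_nonneg (fun _ _ => by positivity) y
  have hn3 : ∀ y, 0 ≤ (Metric.ball (0 : Plane) (2 * r)).indicator
      (fun y => 2 * B ^ 2 / r * ‖y‖⁻¹) y :=
    fun y => indicator_nonneg (fun _ _ => by positivity) y
  have hne : ∀ᵐ y : Plane, y ≠ 0 := by simp [ae_iff, measure_singleton]
  rw [← integral_indicator measurableSet_ball, ← integral_indicator hann,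
    ← integral_sub (hiw.integrable_indicator measurableSet_ball) (hia.integrable_indicator hann),
    ← Real.norm_eq_abs]
  refine (norm_integral_le_of_norm_le ((hi1.add hi2).add hi3) ?_).trans ?_
  · filter_upwards [hne] with y hy
    have hy0 : 0 < ‖y‖ := norm_pos_iff.2 hy
    simp only [Pi.add_apply]
    have n1 := hn1 y
    have n2 := hn2 y
    have n3 := hn3 y
    rcases lt_or_ge ‖y‖ √s with h1 | h1
    · have m1 : y ∈ Metric.ball (0 : Plane) √s := mem_ball_zero_iff.2 h1
      have m2 : y ∉ {y : Plane | √s ≤ ‖y‖ ∧ ‖y‖ ≤ r} := fun h => absurd h.1 (not_le.2 h1)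
      rw [indicator_of_notMem m2, sub_zero]
      rw [indicator_of_mem m1] at n1 ⊢
      have h2 : ‖(Metric.ball 0 (r / 2)).indicator (tensorEntry u u h k s) y‖ ≤
          B ^ 2 / √s * ‖y‖⁻¹ := by
        refine (norm_indicator_le_norm_self _ _).trans ?_
        have hus := hu.norm_le hs y
        rw [pow_one] at hus
        rw [tensorEntry, norm_mul]
        calc _ ≤ B / (√s + ‖y‖) * (B / (√s + ‖y‖)) := by
              gcongr
              · exact (abs_coord_le _ _).trans hus
              · exact (abs_coord_le _ _).trans hus
          _ = B ^ 2 * ((√s + ‖y‖) ^ 2)⁻¹ := by field_simp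
          _ ≤ B ^ 2 * ((√s)⁻¹ * ‖y‖⁻¹) := by
              gcongr
              exact inv_sq_sqrt_add_norm_le hs hy
          _ = _ := by ring
      linarith
    · have m1 : y ∈ (Metric.ball (0 : Plane) √s)ᶜ := by simpa using h1
      rcases lt_or_ge ‖y‖ (r / 2) with h2 | h2
      · have m2 : y ∈ {y : Plane | √s ≤ ‖y‖ ∧ ‖y‖ ≤ r} := ⟨h1, by linarith⟩
        have m3 : y ∈ Metric.ball (0 : Plane) (r / 2) := mem_ball_zero_iff.2 h2
        rw [indicator_of_mem m2, indicator_of_mem m3]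
        rw [indicator_of_mem m1] at n2 ⊢
        have e : tensorEntry u u h k s y - a y h * a y k =
            (u s y - a y) h * u s y k + a y h * (u s y - a y) k := by
          simp only [tensorEntry, PiLp.sub_apply]; ring
        have hd : ‖u s y - a y‖ ≤ 2 * E * √s / ‖y‖ ^ 2 := by
          refine (hua s hs y hy).trans ?_
          have h3 : s / ‖y‖ ^ 3 ≤ √s / ‖y‖ ^ 2 := by
            rw [div_le_div_iff₀ (by positivity) (by positivity)]
            calc s * ‖y‖ ^ 2 = √s * √s * ‖y‖ ^ 2 := by rw [← sq, hs2]
              _ ≤ √s * ‖y‖ * ‖y‖ ^ 2 := by gcongr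
              _ = _ := by ring
          calc _ ≤ E * (√s / ‖y‖ ^ 2 + √s / ‖y‖ ^ 2) := by gcongr
            _ = _ := by ring
        have hus : ‖u s y‖ ≤ B / ‖y‖ := (hu.norm_le hs y).trans (by
          rw [pow_one]; gcongr; linarith)
        have hay := ha.norm_le hy
        have h5 : ‖tensorEntry u u h k s y - a y h * a y k‖ ≤
            4 * E * B * √s * (‖y‖ ^ (1 + 2))⁻¹ := by
          rw [e]
          refine (norm_add_le _ _).trans ?_
          rw [norm_mul, norm_mul]
          calc _ ≤ 2 * E * √s / ‖y‖ ^ 2 * (B / ‖y‖) + B / ‖y‖ * (2 * E * √s / ‖y‖ ^ 2) := by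
                gcongr
                · exact (abs_coord_le _ _).trans hd
                · exact (abs_coord_le _ _).trans hus
                · exact (abs_coord_le _ _).trans hay
                · exact (abs_coord_le _ _).trans hd
            _ = _ := by field_simp; norm_num; ring
        linarith
      · have m3 : y ∉ Metric.ball (0 : Plane) (r / 2) := by simpa using h2
        rw [indicator_of_notMem m3, zero_sub, norm_neg]
        rcases le_or_gt ‖y‖ r with h3 | h3
        · have m4 : y ∈ Metric.ball (0 : Plane) (2 * r) := mem_ball_zero_iff.2 (by linarith)
          rw [indicator_of_mem m4] at n3 ⊢
          have h5 : ‖{y : Plane | √s ≤ ‖y‖ ∧ ‖y‖ ≤ r}.indicator (fun y => a y h * a y k) y‖ ≤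
              2 * B ^ 2 / r * ‖y‖⁻¹ := by
            refine (norm_indicator_le_norm_self _ _).trans ((ha.abs_mul_le h k hy).trans ?_)
            calc _ = B ^ 2 / ‖y‖ * ‖y‖⁻¹ := by field_simp
              _ ≤ B ^ 2 / (r / 2) * ‖y‖⁻¹ := by gcongr
              _ = _ := by field_simp
          linarith
        · have m2 : y ∉ {y : Plane | √s ≤ ‖y‖ ∧ ‖y‖ ≤ r} := fun h => absurd h.2 (not_le.2 h3)
          rw [indicator_of_notMem m2, norm_zero]
          linarith
  · simp only [Pi.add_apply]
    rw [integral_add_add hi1 hi2 hi3, integral_indicator measurableSet_ball,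
      integral_indicator measurableSet_ball, integral_indicator measurableSet_ball.compl,
      integral_const_mul, integral_const_mul, integral_const_mul,
      setIntegral_ball_norm_inv hss.le, setIntegral_ball_norm_inv (by positivity)]
    have := setIntegral_compl_ball_norm_pow_inv_le 1 le_rfl hss
    calc _ ≤ B ^ 2 / √s * (2 * Real.pi * √s) +
          4 * E * B * √s * (2 ^ (1 + 2) * (2 * Real.pi) * (√s ^ 1)⁻¹) +
          2 * B ^ 2 / r * (2 * Real.pi * (2 * r)) := by gcongr
      _ = _ := by field_simp; ring

/-- The Duhamel integral at a fixed time of the source, compared with its profile. -/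
theorem exists_abs_integral_sub_profile_le (B E : ℝ) (hE : 0 ≤ E) : ∃ Q > 0,
    ∀ {a : Plane → Plane} {u : ℝ → Plane → Plane}, IsXField 1 B u → IsDatum B a →
    (∀ s, 0 < s → ∀ y, y ≠ 0 → ‖u s y - a y‖ ≤ E * (s / ‖y‖ ^ 3 + √s / ‖y‖ ^ 2)) →
    ∀ (j h k : Fin 2) {s t : ℝ} {x : Plane}, 0 < s → s < t → √t ≤ ‖x‖ →
    Integrable (fun y => oseenKernel j h k (t - s) (x - y) * tensorEntry u u h k s y) →
    |(∫ y, oseenKernel j h k (t - s) (x - y) * tensorEntry u u h k s y) -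
      profileTensor x j h k * ∫ y in {y : Plane | √s ≤ ‖y‖ ∧ ‖y‖ ≤ ‖x‖}, a y h * a y k| ≤
        Q / ‖x‖ ^ 3 * (1 + √t * (√s)⁻¹) := by
  obtain ⟨C, hC, hK⟩ := exists_isXField_oseenKernel
  obtain ⟨C₁, hC₁, hKF⟩ := exists_abs_oseenKernel_sub_profileTensor_le
  obtain ⟨C₂, hC₂, hF⟩ := exists_abs_profileTensor_le
  obtain ⟨Cm, hCm, hm⟩ := exists_abs_moment_le
  have hpi := Real.pi_pos
  set B' := |B| with hB'
  have hB'0 : 0 ≤ B' := abs_nonneg B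
  set A := 4 * B' * B' with hA
  refine ⟨Real.pi * A * (16 * C + C₁) + (16 * Real.pi * C + 2 * Cm) * A +
    128 * Real.pi * C * A + C₂ * (10 * Real.pi * B' ^ 2 + 64 * Real.pi * E * B') + 1,
    by positivity, ?_⟩
  intro a u hu ha hua j h k s t x hs hst hx hint
  have hBB : B' = B := abs_of_nonneg hu.nonneg
  have ht := hs.trans hst
  have hst0 : 0 < √t := Real.sqrt_pos.2 ht
  have hss : 0 < √s := Real.sqrt_pos.2 hs
  have ht2 : √t ^ 2 = t := Real.sq_sqrt ht.le
  have hr0 : 0 < ‖x‖ := hst0.trans_le hx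
  have hx0 : x ≠ 0 := norm_pos_iff.1 hr0
  have hτ : 0 < t - s := sub_pos.2 hst
  rw [← hBB] at hu ha
  have hw := hu.tensorEntry hu h k
  rw [← hA] at hw
  have b1 := abs_setIntegral_near_origin_le (hK j h k) (hKF j h k _ hτ x hx0) hw hτ hs hx0
  have b2 := abs_setIntegral_near_target_le (hK j h k) (oseenKernel_neg j h k _)
    (fun l => hm j h k l _ hτ _) hw hτ hs hx0
  have b3 := abs_setIntegral_far_le (hK j h k) hw hτ hs hx0
  have b4 := abs_setIntegral_tensorEntry_sub_le hE hu ha hua h k hs hr0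
  have b5 := hF j h k x hx0
  set r := ‖x‖ with hr
  have hwi : IntegrableOn (tensorEntry u u h k s) (Metric.ball 0 (r / 2)) :=
    ((hw.contDiff s hs).continuous.continuousOn.integrableOn_compact
      (isCompact_closedBall 0 (r / 2))).mono_set Metric.ball_subset_closedBall
  have hdisj : Metric.ball x (r / 2) ⊆ (Metric.ball (0 : Plane) (r / 2))ᶜ := fun y hy => by
    have := half_norm_lt_of_mem_ball hy
    simpa using this.le
  have hsplit : ∫ y, oseenKernel j h k (t - s) (x - y) * tensorEntry u u h k s y =
      (∫ y in Metric.ball 0 (r / 2),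
        (oseenKernel j h k (t - s) (x - y) - profileTensor x j h k) * tensorEntry u u h k s y) +
      profileTensor x j h k * (∫ y in Metric.ball 0 (r / 2), tensorEntry u u h k s y) +
      ((∫ y in Metric.ball x (r / 2), oseenKernel j h k (t - s) (x - y) * tensorEntry u u h k s y) +
      ∫ y in (Metric.ball 0 (r / 2))ᶜ ∩ (Metric.ball x (r / 2))ᶜ,
        oseenKernel j h k (t - s) (x - y) * tensorEntry u u h k s y) := by
    rw [← integral_add_compl (measurableSet_ball (x := (0 : Plane)) (ε := r / 2)) hint]
    congr 1
    · rw [← integral_const_mul, ← integral_add]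
      · congr 1
        funext y
        ring
      · have : (fun y => (oseenKernel j h k (t - s) (x - y) - profileTensor x j h k) *
            tensorEntry u u h k s y) = fun y => oseenKernel j h k (t - s) (x - y) *
            tensorEntry u u h k s y - profileTensor x j h k * tensorEntry u u h k s y := by
          funext y; ring
        rw [this]
        exact hint.integrableOn.sub (hwi.const_mul _)
      · exact hwi.const_mul _
    · have e := integral_inter_add_sdiff (μ := volume) (s := (Metric.ball (0 : Plane) (r / 2))ᶜ)
        (measurableSet_ball (x := x) (ε := r / 2)) hint.integrableOn
      rw [inter_eq_right.2 hdisj] at e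
      rw [← e]
      rfl
  have b1' : Real.pi * A * (16 * C / r ^ 3 + C₁ * (t - s) / (√s * r ^ 4)) ≤
      Real.pi * A * (16 * C + C₁) / r ^ 3 * (1 + √t * (√s)⁻¹) := by
    have h1 : C₁ * (t - s) / (√s * r ^ 4) ≤ C₁ / r ^ 3 * (√t * (√s)⁻¹) := by
      calc _ ≤ C₁ * (√t * r) / (√s * r ^ 4) := by
            gcongr
            nlinarith
        _ = _ := by field_simp
    have h2 : 0 ≤ √t * (√s)⁻¹ := by positivity
    calc _ ≤ Real.pi * A * (16 * C / r ^ 3 + C₁ / r ^ 3 * (√t * (√s)⁻¹)) := by gcongr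
      _ ≤ Real.pi * A * (16 * C / r ^ 3 * (1 + √t * (√s)⁻¹) +
          C₁ / r ^ 3 * (1 + √t * (√s)⁻¹)) := by
          gcongr
          · exact le_mul_of_one_le_right (by positivity) (by linarith)
          · linarith
      _ = _ := by ring
  have b6 : |profileTensor x j h k * ((∫ y in Metric.ball 0 (r / 2), tensorEntry u u h k s y) -
      ∫ y in {y : Plane | √s ≤ ‖y‖ ∧ ‖y‖ ≤ r}, a y h * a y k)| ≤
      C₂ / r ^ 3 * (10 * Real.pi * B' ^ 2 + 64 * Real.pi * E * B') := by
    rw [abs_mul]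
    gcongr
  have hone : 1 ≤ 1 + √t * (√s)⁻¹ := by
    have : 0 ≤ √t * (√s)⁻¹ := by positivity
    linarith
  have hsum : ((16 * Real.pi * C + 2 * Cm) * A / r ^ 3 + 128 * Real.pi * C * A / r ^ 3 +
      C₂ / r ^ 3 * (10 * Real.pi * B' ^ 2 + 64 * Real.pi * E * B') + 1 / r ^ 3) ≤
      ((16 * Real.pi * C + 2 * Cm) * A / r ^ 3 + 128 * Real.pi * C * A / r ^ 3 +
      C₂ / r ^ 3 * (10 * Real.pi * B' ^ 2 + 64 * Real.pi * E * B') + 1 / r ^ 3) *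
      (1 + √t * (√s)⁻¹) := le_mul_of_one_le_right (by positivity) hone
  have h1r : 0 < 1 / r ^ 3 := by positivity
  rw [hsplit]
  have e : (Real.pi * A * (16 * C + C₁) + (16 * Real.pi * C + 2 * Cm) * A +
      128 * Real.pi * C * A + C₂ * (10 * Real.pi * B' ^ 2 + 64 * Real.pi * E * B') + 1) / r ^ 3 *
      (1 + √t * (√s)⁻¹) = Real.pi * A * (16 * C + C₁) / r ^ 3 * (1 + √t * (√s)⁻¹) +
      ((16 * Real.pi * C + 2 * Cm) * A / r ^ 3 + 128 * Real.pi * C * A / r ^ 3 +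
      C₂ / r ^ 3 * (10 * Real.pi * B' ^ 2 + 64 * Real.pi * E * B') + 1 / r ^ 3) *
      (1 + √t * (√s)⁻¹) := by ring
  rw [e]
  rw [mul_sub] at b6
  have c1 := abs_le.1 b1
  have c2 := abs_le.1 b2
  have c3 := abs_le.1 b3
  have c6 := abs_le.1 b6
  rw [abs_le]
  constructor <;> linarith [c1.1, c1.2, c2.1, c2.2, c3.1, c3.2, c6.1, c6.2]

/-- The Duhamel integral of `u_h u_k` is described by `𝔽` and the second moments of `a`. -/
theorem exists_abs_duhamel_sub_profile_le (B E : ℝ) (hE : 0 ≤ E) : ∃ Q > 0,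
    ∀ {a : Plane → Plane} {u : ℝ → Plane → Plane}, IsXField 1 B u → IsDatum B a →
    (∀ s, 0 < s → ∀ y, y ≠ 0 → ‖u s y - a y‖ ≤ E * (s / ‖y‖ ^ 3 + √s / ‖y‖ ^ 2)) →
    ∀ (j h k : Fin 2) {t : ℝ} {x : Plane}, 0 < t → √t ≤ ‖x‖ →
    |duhamel (oseenKernel j h k) (tensorEntry u u h k) t x -
      profileTensor x j h k * annulusMatrix a t ‖x‖ h k| ≤ Q * (t / ‖x‖ ^ 3) := by
  obtain ⟨Q, hQ, hin⟩ := exists_abs_integral_sub_profile_le B E hE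
  obtain ⟨D, -, hD⟩ := exists_bilinearDuhamel_bounds
  refine ⟨3 * Q, by positivity, ?_⟩
  intro a u hu ha hua j h k t x ht hx
  have hst0 : 0 < √t := Real.sqrt_pos.2 ht
  have hr0 : 0 < ‖x‖ := hst0.trans_le hx
  have hint := (hD hu.isXBounded hu.isXBounded t ht x).1 j h k
  set r := ‖x‖ with hr
  let S : Set (ℝ × Plane) := {p | √p.1 ≤ ‖p.2‖ ∧ ‖p.2‖ ≤ r}
  have hS : MeasurableSet S :=
    (measurableSet_le (f := fun p : ℝ × Plane => √p.1) (g := fun p => ‖p.2‖) (by fun_prop)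
      (by fun_prop)).inter
      (measurableSet_le (f := fun p : ℝ × Plane => ‖p.2‖) (by fun_prop) measurable_const)
  have hVm : Measurable (S.indicator fun p : ℝ × Plane => a p.2 h * a p.2 k) :=
    ((ha.measurable_mul h k).comp measurable_snd).indicator hS
  have hVi : Integrable (S.indicator fun p : ℝ × Plane => a p.2 h * a p.2 k) (slab t) := by
    refine ((integrable_slab_source t (2 * r)).const_mul (B ^ 2)).mono' hVm.aestronglyMeasurable
      (ae_slab_ne_zero fun s hs y hy => ?_)
    have hss : 0 < √s := Real.sqrt_pos.2 hs.1
    have hy0 : 0 < ‖y‖ := norm_pos_iff.2 hy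
    have hn : 0 ≤ (Metric.ball (0 : Plane) (2 * r)).indicator (fun y => ‖y‖⁻¹) y :=
      indicator_nonneg (fun _ _ => by positivity) y
    by_cases hm : (s, y) ∈ S
    · have hm' : √s ≤ ‖y‖ ∧ ‖y‖ ≤ r := hm
      have hyb : y ∈ Metric.ball (0 : Plane) (2 * r) := mem_ball_zero_iff.2 (by linarith [hm'.2])
      rw [indicator_of_mem hm, indicator_of_mem hyb]
      refine (ha.abs_mul_le h k hy).trans ?_
      calc _ = B ^ 2 * (‖y‖⁻¹ * ‖y‖⁻¹) := by field_simp
        _ ≤ _ := by gcongr; exact hm'.1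
    · rw [indicator_of_notMem hm, norm_zero]
      positivity
  have hsec : ∀ s, ∫ y, S.indicator (fun p : ℝ × Plane => a p.2 h * a p.2 k) (s, y) =
      ∫ y in {y : Plane | √s ≤ ‖y‖ ∧ ‖y‖ ≤ r}, a y h * a y k := by
    intro s
    rw [← integral_indicator (measurableSet_annulus s r)]
    rfl
  have hM : annulusMatrix a t r h k = ∫ s in Ioo 0 t,
      ∫ y, S.indicator (fun p : ℝ × Plane => a p.2 h * a p.2 k) (s, y) := by
    simp only [hsec]
    rw [annulusMatrix, Matrix.of_apply, intervalIntegral.integral_of_le ht.le,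
      integral_Ioc_eq_integral_Ioo]
  have hpr := hint.integral_prod_left
  have hVpr := hVi.integral_prod_left
  rw [hM, duhamel, integral_prod _ hint, ← integral_const_mul,
    ← integral_sub hpr (hVpr.const_mul _), ← Real.norm_eq_abs]
  have hg : IntegrableOn (fun s => Q / r ^ 3 * (1 + √t * (√s)⁻¹)) (Ioo 0 t) :=
    ((integrable_const _).add
      (Integrable.const_mul (integrableOn_Ioo_sqrt_inv t) _)).const_mul _
  refine (norm_integral_le_of_norm_le hg ?_).trans (le_of_eq ?_)
  · filter_upwards [hint.prod_right_ae, ae_restrict_mem measurableSet_Ioo] with s h1 h2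
    rw [hsec]
    exact hin hu ha hua j h k h2.1 h2.2 hx h1
  · rw [integral_const_mul, integral_add (integrable_const _)
      (Integrable.const_mul (integrableOn_Ioo_sqrt_inv t) _), integral_const_mul,
      setIntegral_Ioo_sqrt_inv ht]
    have : √t * (2 * √t) = 2 * t := by
      rw [show √t * (2 * √t) = 2 * √t ^ 2 by ring, Real.sq_sqrt ht.le]
    rw [this]
    simp [ht.le]
    ring


/-- For a solution, `|u - a| ≤ E (t |x|^{-3} + √t |x|^{-2})`. -/
theorem exists_norm_sub_datum_le (B : ℝ) (hB : 0 ≤ B) : ∃ E > 0,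
    ∀ {a : Plane → Plane} {u : ℝ → Plane → Plane}, IsXField 1 B u → IsDatum B a →
    (∀ t, 0 < t → ∀ x, u t x = heatFlow t a x - bilinearDuhamel u u t x) →
    ∀ s, 0 < s → ∀ y, y ≠ 0 → ‖u s y - a y‖ ≤ E * (s / ‖y‖ ^ 3 + √s / ‖y‖ ^ 2) := by
  obtain ⟨C, hC, hheat⟩ := exists_norm_heatFlow_sub_le
  obtain ⟨D, hD, hb⟩ := exists_bilinearDuhamel_bounds
  refine ⟨C * B + D * B * B + 1, by positivity, ?_⟩
  intro a u hu ha hm s hs y hy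
  have hy0 : 0 < ‖y‖ := norm_pos_iff.2 hy
  have h1 := hheat ha s hs y hy
  have h2 := (hb hu.isXBounded hu.isXBounded s hs y).2
  have h3 : D * B * B * √s / (√s + ‖y‖) ^ 2 ≤ D * B * B * √s / ‖y‖ ^ 2 := by
    gcongr
    linarith [Real.sqrt_nonneg s]
  have e : u s y - a y = (heatFlow s a y - a y) - bilinearDuhamel u u s y := by
    rw [hm s hs y]; abel
  rw [e]
  refine (norm_sub_le _ _).trans ((add_le_add h1 (h2.trans h3)).trans ?_)
  have p1 : 0 ≤ s / ‖y‖ ^ 3 := by positivity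
  have p2 : 0 ≤ √s / ‖y‖ ^ 2 := by positivity
  have p3 : 0 ≤ C * B := by positivity
  have p4 : 0 ≤ D * B * B := by positivity
  calc _ = C * B * (s / ‖y‖ ^ 3) + D * B * B * (√s / ‖y‖ ^ 2) := by ring
    _ ≤ (C * B + D * B * B + 1) * (s / ‖y‖ ^ 3) + (C * B + D * B * B + 1) * (√s / ‖y‖ ^ 2) := by
        gcongr <;> linarith
    _ = _ := by ring

theorem profileContract_apply (x : Plane) (M : Matrix (Fin 2) (Fin 2) ℝ) (j : Fin 2) :
    profileContract x M j = ∑ h, ∑ k, profileTensor x j h k * M h k := rfl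

/-- The pointwise asymptotic profile of a solution outside a parabola. -/
theorem exists_norm_sub_profile_le (B : ℝ) (hB : 0 ≤ B) : ∃ Q > 0,
    ∀ {a : Plane → Plane} {u : ℝ → Plane → Plane}, IsXField 1 B u → IsDatum B a →
    (∀ t, 0 < t → ∀ x, u t x = heatFlow t a x - bilinearDuhamel u u t x) →
    ∀ t, 0 < t → ∀ x : Plane, √t ≤ ‖x‖ →
      ‖u t x - (a x - profileContract x (annulusMatrix a t ‖x‖))‖ ≤ Q * (t / ‖x‖ ^ 3) := by
  obtain ⟨C, hC, hheat⟩ := exists_norm_heatFlow_sub_le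
  obtain ⟨E, hE, hua⟩ := exists_norm_sub_datum_le B hB
  obtain ⟨Q, hQ, hd⟩ := exists_abs_duhamel_sub_profile_le B E hE.le
  refine ⟨C * B + 8 * Q, by positivity, ?_⟩
  intro a u hu ha hm t ht x hx
  have hst0 : 0 < √t := Real.sqrt_pos.2 ht
  have hr0 : 0 < ‖x‖ := hst0.trans_le hx
  have h1 := hheat ha t ht x (norm_pos_iff.1 hr0)
  have h2 := fun j h k => hd hu ha (hua hu ha hm) j h k ht hx
  set P := profileContract x (annulusMatrix a t ‖x‖) with hP
  have hj : ∀ j, |(bilinearDuhamel u u t x - P) j| ≤ 4 * (Q * (t / ‖x‖ ^ 3)) := by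
    intro j
    have e := fun h k => abs_le.1 (h2 j h k)
    rw [PiLp.sub_apply, bilinearDuhamel_apply, hP, profileContract_apply]
    simp only [Fin.sum_univ_two]
    rw [abs_le]
    constructor <;> linarith [(e 0 0).1, (e 0 1).1, (e 1 0).1, (e 1 1).1, (e 0 0).2, (e 0 1).2,
      (e 1 0).2, (e 1 1).2]
  have h3 : ‖bilinearDuhamel u u t x - P‖ ≤ 8 * (Q * (t / ‖x‖ ^ 3)) :=
    (norm_le_sum_coord _).trans ((add_le_add (hj 0) (hj 1)).trans (le_of_eq (by ring)))
  have e : u t x - (a x - P) = (heatFlow t a x - a x) - (bilinearDuhamel u u t x - P) := by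
    rw [hm t ht x]; abel
  rw [e]
  exact (norm_sub_le _ _).trans ((add_le_add h1 h3).trans (le_of_eq (by ring)))

/-! ### Scaling and self-similarity -/

theorem heatKernel_scale {c : ℝ} (hc : 0 < c) (s : ℝ) (x : Plane) :
    heatKernel (c ^ 2 * s) (c • x) = (c ^ 2)⁻¹ * heatKernel s x := by
  rw [heatKernel, heatKernel, norm_smul, Real.norm_of_nonneg hc.le, mul_pow]
  rw [show -(c ^ 2 * ‖x‖ ^ 2) / (4 * (c ^ 2 * s)) = -‖x‖ ^ 2 / (4 * s) by
    rw [← mul_neg, show 4 * (c ^ 2 * s) = c ^ 2 * (4 * s) by ring,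
      mul_div_mul_left _ _ (by positivity)]]
  rw [show 4 * Real.pi * (c ^ 2 * s) = c ^ 2 * (4 * Real.pi * s) by ring, mul_inv]
  ring

theorem heatThird_scale (j h k : Fin 2) {c : ℝ} (hc : 0 < c) (s : ℝ) (x : Plane) :
    heatThird j h k (c ^ 2 * s) (c • x) = (c ^ 5)⁻¹ * heatThird j h k s x := by
  have e1 : (4 * (c ^ 2 * s) ^ 2)⁻¹ = (c ^ 4)⁻¹ * (4 * s ^ 2)⁻¹ := by
    rw [← mul_inv]; ring_nf
  have e2 : (8 * (c ^ 2 * s) ^ 3)⁻¹ = (c ^ 6)⁻¹ * (8 * s ^ 3)⁻¹ := by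
    rw [← mul_inv]; ring_nf
  simp only [heatThird, heatKernel_scale hc, PiLp.smul_apply, smul_eq_mul, ← mul_ite_zero, e1, e2]
  generalize (4 * s ^ 2)⁻¹ = p
  generalize (8 * s ^ 3)⁻¹ = q
  generalize (if j = h then x k else 0) = d₁
  generalize (if h = k then x j else 0) = d₂
  generalize (if k = j then x h else 0) = d₃
  field_simp

theorem oseenKernel_scale (j h k : Fin 2) {c : ℝ} (hc : 0 < c) (t : ℝ) (x : Plane) :
    oseenKernel j h k (c ^ 2 * t) (c • x) = (c ^ 3)⁻¹ * oseenKernel j h k t x := by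
  have h1 : ∫ s in Ioi (c ^ 2 * t), heatThird j h k s (c • x) =
      (c ^ 3)⁻¹ * ∫ s in Ioi t, heatThird j h k s x := by
    have h2 := integral_comp_mul_left_Ioi (fun s => heatThird j h k s (c • x)) t
      (b := c ^ 2) (by positivity)
    simp only [heatThird_scale j h k hc, smul_eq_mul] at h2
    rw [integral_const_mul] at h2
    rw [← mul_right_inj' (a := (c ^ 2)⁻¹) (by positivity), ← h2]
    field_simp
  rw [oseenKernel, oseenKernel, h1, dirDeriv_heatKernel, dirDeriv_heatKernel]
  simp only [heatKernel_scale hc, PiLp.smul_apply, smul_eq_mul]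
  rw [mul_add]
  congr 1
  split_ifs
  · rw [show 2 * (c ^ 2 * t) = c ^ 2 * (2 * t) by ring, mul_inv]
    generalize (2 * t)⁻¹ = p
    field_simp
  · simp

theorem integral_comp_smul_plane {F : Type*} [NormedAddCommGroup F] [NormedSpace ℝ F]
    (f : Plane → F) {c : ℝ} (hc : 0 < c) : ∫ y, f (c • y) = (c ^ 2)⁻¹ • ∫ y, f y := by
  rw [Measure.integral_comp_smul, finrank_euclideanSpace_fin, abs_of_pos (by positivity)]

/-- The parabolic rescaling `c u(c² t, c x)`. -/
noncomputable def rescale (c : ℝ) (u : ℝ → Plane → Plane) (t : ℝ) (x : Plane) : Plane :=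
  c • u (c ^ 2 * t) (c • x)

theorem IsXField.rescale {A : ℝ} {u : ℝ → Plane → Plane} (hu : IsXField 1 A u) {c : ℝ}
    (hc : 0 < c) : IsXBounded A (NSProfile.rescale c u) := by
  refine ⟨?_, ae_spaceTime fun s hs y => ?_, hu.nonneg⟩
  · exact ((hu.stronglyMeasurable.comp_measurable (by fun_prop : Measurable fun p : ℝ × Plane =>
      (c ^ 2 * p.1, c • p.2))).const_smul c).aestronglyMeasurable
  · have h := hu.norm_le (t := c ^ 2 * s) (by positivity) (c • y)
    have hss : 0 < √s := Real.sqrt_pos.2 hs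
    rw [pow_one, Real.sqrt_mul (by positivity), Real.sqrt_sq hc.le, norm_smul,
      Real.norm_of_nonneg hc.le, ← mul_add] at h
    simp only [NSProfile.rescale]
    rw [norm_smul, Real.norm_of_nonneg hc.le]
    calc _ ≤ c * (A / (c * (√s + ‖y‖))) := by gcongr
      _ = _ := by field_simp

theorem heatFlow_scale {a : Plane → Plane} (ha : IsHomogeneousNegOne a) {c : ℝ} (hc : 0 < c)
    (t : ℝ) (x : Plane) : c • heatFlow (c ^ 2 * t) a (c • x) = heatFlow t a x := by
  have h := integral_comp_smul_plane (fun y => heatKernel (c ^ 2 * t) (c • x - y) • a y) hc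
  have e : ∫ y, heatKernel (c ^ 2 * t) (c • x - c • y) • a (c • y) =
      (c ^ 3)⁻¹ • ∫ y, heatKernel t (x - y) • a y := by
    rw [← integral_smul]
    refine integral_congr_ae ?_
    have hne : ∀ᵐ y : Plane, y ≠ 0 := by simp [ae_iff, measure_singleton]
    filter_upwards [hne] with y hy
    rw [← smul_sub, heatKernel_scale hc, ha c hc y hy, smul_smul, smul_smul]
    congr 1
    field_simp
  rw [e] at h
  rw [heatFlow, heatFlow]
  have h2 : ∫ y, heatKernel (c ^ 2 * t) (c • x - y) • a y =
      c⁻¹ • ∫ y, heatKernel t (x - y) • a y := by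
    have h3 := congrArg (fun v => c ^ 2 • v) h
    simp only [smul_smul] at h3
    rw [mul_inv_cancel₀ (by positivity), one_smul] at h3
    rw [← h3]
    congr 1
    field_simp
  rw [h2, smul_smul, mul_inv_cancel₀ hc.ne', one_smul]

theorem bilinearDuhamel_rescale {A : ℝ} {u : ℝ → Plane → Plane} (hu : IsXField 1 A u) {c : ℝ}
    (hc : 0 < c) {t : ℝ} (ht : 0 < t) (x : Plane) :
    bilinearDuhamel (rescale c u) (rescale c u) t x =
      rescale c (bilinearDuhamel u u) t x := by
  obtain ⟨D, -, hD⟩ := exists_bilinearDuhamel_bounds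
  have hr := hu.rescale hc
  have hct : 0 < c ^ 2 * t := by positivity
  have i1 := (hD hr hr t ht x).1
  have i2 := (hD hu.isXBounded hu.isXBounded _ hct (c • x)).1
  ext j
  rw [rescale, PiLp.smul_apply, bilinearDuhamel_apply, bilinearDuhamel_apply, smul_eq_mul,
    Finset.mul_sum]
  refine Finset.sum_congr rfl fun h _ => ?_
  rw [Finset.mul_sum]
  refine Finset.sum_congr rfl fun k _ => ?_
  rw [duhamel, duhamel, integral_prod _ (i1 j h k), integral_prod _ (i2 j h k)]
  have e : ∀ s, ∫ y, oseenKernel j h k (t - s) (x - y) *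
      tensorEntry (rescale c u) (rescale c u) h k s y = c ^ 3 *
        ∫ y, oseenKernel j h k (c ^ 2 * t - c ^ 2 * s) (c • x - y) *
          tensorEntry u u h k (c ^ 2 * s) y := by
    intro s
    have h1 := integral_comp_smul_plane (fun y => oseenKernel j h k (c ^ 2 * t - c ^ 2 * s)
      (c • x - y) * tensorEntry u u h k (c ^ 2 * s) y) hc
    rw [smul_eq_mul, eq_comm, inv_mul_eq_iff_eq_mul₀ (by positivity)] at h1
    rw [h1, ← integral_const_mul, ← integral_const_mul]
    congr 1
    funext y
    rw [← mul_sub, ← smul_sub, oseenKernel_scale j h k hc]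
    simp only [tensorEntry, rescale, PiLp.smul_apply, smul_eq_mul]
    field_simp
  simp only [e]
  rw [integral_const_mul, ← integral_Ioc_eq_integral_Ioo, ← integral_Ioc_eq_integral_Ioo,
    ← intervalIntegral.integral_of_le ht.le, ← intervalIntegral.integral_of_le hct.le,
    intervalIntegral.integral_comp_mul_left (fun s => ∫ y, oseenKernel j h k (c ^ 2 * t - s)
      (c • x - y) * tensorEntry u u h k s y) (by positivity), mul_zero, smul_eq_mul]
  field_simp

/-- A small solution with homogeneous datum is self-similar. -/
theorem exists_rescale_eq : ∃ A₀ > 0, ∀ {A : ℝ} {a : Plane → Plane} {u : ℝ → Plane → Plane},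
    IsXField 1 A u → A ≤ A₀ → IsHomogeneousNegOne a →
    (∀ t, 0 < t → ∀ x, u t x = heatFlow t a x - bilinearDuhamel u u t x) →
    ∀ c, 0 < c → ∀ t, 0 < t → ∀ x, rescale c u t x = u t x := by
  obtain ⟨A₀, hA₀, huniq⟩ := exists_mild_unique
  refine ⟨A₀, hA₀, fun {A a u} hu hA ha hm c hc => ?_⟩
  refine huniq (H := fun t x => heatFlow t a x) (hu.rescale hc) hu.isXBounded hA
    (fun t ht x => ?_) hm
  rw [bilinearDuhamel_rescale hu hc ht, rescale, rescale, hm _ (by positivity), smul_sub,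
    heatFlow_scale ha hc]

/-! ### Homogeneous data in polar coordinates -/

theorem setIntegral_annulus_of_homogeneous {a : Plane → Plane} (ha : IsHomogeneousNegOne a)
    (h k : Fin 2) {s r : ℝ} (hs : 0 < s) (hsr : √s ≤ r) :
    ∫ y in {y : Plane | √s ≤ ‖y‖ ∧ ‖y‖ ≤ r}, a y h * a y k =
      Real.log (r / √s) * circleMatrix a h k := by
  have hss : 0 < √s := Real.sqrt_pos.2 hs
  let g : ℝ → ℝ := (Icc √s r).indicator fun ρ => (ρ ^ 2)⁻¹
  have hd : Module.finrank ℝ Plane - 1 = 1 := by simp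
  have hpolar := (volume : Measure Plane).measurePreserving_homeomorphUnitSphereProd.integral_comp
    (Homeomorph.measurableEmbedding _)
    (fun z : Metric.sphere (0 : Plane) 1 × Ioi (0 : ℝ) => a z.1 h * a z.1 k * g z.2)
  rw [integral_prod_mul (fun z : Metric.sphere (0 : Plane) 1 => a z h * a z k)
    (fun ρ : Ioi (0 : ℝ) => g ρ), hd] at hpolar
  have hrad : ∫ ρ : Ioi (0 : ℝ), g ρ ∂Measure.volumeIoiPow 1 = Real.log (r / √s) := by
    simp only [Measure.volumeIoiPow, ENNReal.ofReal]
    rw [integral_withDensity_eq_integral_smul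
      ((measurable_subtype_coe.pow_const _).real_toNNReal),
      integral_subtype_comap measurableSet_Ioi fun ρ => Real.toNNReal (ρ ^ 1) • g ρ]
    have e1 : ∫ ρ in Ioi (0 : ℝ), Real.toNNReal (ρ ^ 1) • g ρ =
        ∫ ρ in Ioi (0 : ℝ), (Icc √s r).indicator (fun ρ => ρ⁻¹) ρ := by
      refine setIntegral_congr_fun measurableSet_Ioi fun ρ (hρ : 0 < ρ) => ?_
      simp only [g, NNReal.smul_def, pow_one, Real.coe_toNNReal _ hρ.le, smul_eq_mul, indicator]
      split_ifs
      · field_simp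
      · simp
    rw [e1, setIntegral_indicator measurableSet_Icc,
      inter_eq_right.2 (show Icc √s r ⊆ Ioi 0 from fun ρ hρ => hss.trans_le hρ.1), integral_Icc_eq_integral_Ioc,
      ← intervalIntegral.integral_of_le hsr, integral_inv_of_pos hss (hss.trans_le hsr)]
  have hlhs : ∫ y in {y : Plane | √s ≤ ‖y‖ ∧ ‖y‖ ≤ r}, a y h * a y k =
      ∫ y : ({0}ᶜ : Set Plane), {y : Plane | √s ≤ ‖y‖ ∧ ‖y‖ ≤ r}.indicator
        (fun y => a y h * a y k) y ∂(volume : Measure Plane).comap (↑) := by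
    rw [integral_subtype_comap (measurableSet_singleton _).compl
      ({y : Plane | √s ≤ ‖y‖ ∧ ‖y‖ ≤ r}.indicator fun y => a y h * a y k),
      restrict_compl_singleton, integral_indicator (measurableSet_annulus s r)]
  rw [hlhs, circleMatrix, Matrix.of_apply, mul_comm, ← hrad, ← hpolar]
  congr 1
  funext y
  have hy : (y : Plane) ≠ 0 := y.2
  have hy0 : 0 < ‖(y : Plane)‖ := norm_pos_iff.2 hy
  simp only [homeomorphUnitSphereProd_apply_fst_coe, homeomorphUnitSphereProd_apply_snd_coe, g]
  by_cases hm : √s ≤ ‖(y : Plane)‖ ∧ ‖(y : Plane)‖ ≤ r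
  · rw [indicator_of_mem (show (y : Plane) ∈ {y : Plane | √s ≤ ‖y‖ ∧ ‖y‖ ≤ r} from hm),
      indicator_of_mem (show ‖(y : Plane)‖ ∈ Icc √s r from hm), ha _ (by positivity) _ hy]
    simp only [PiLp.smul_apply, smul_eq_mul]
    field_simp
  · rw [indicator_of_notMem (show (y : Plane) ∉ {y : Plane | √s ≤ ‖y‖ ∧ ‖y‖ ≤ r} from hm),
      indicator_of_notMem (show ‖(y : Plane)‖ ∉ Icc √s r from hm), mul_zero]

theorem annulusMatrix_of_homogeneous {a : Plane → Plane} (ha : IsHomogeneousNegOne a) {r : ℝ}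
    (hr : 1 ≤ r) : annulusMatrix a 1 r = (Real.log r + 1 / 2) • circleMatrix a := by
  ext h k
  have hr0 : 0 < r := one_pos.trans_le hr
  rw [annulusMatrix, Matrix.of_apply, Matrix.smul_apply, smul_eq_mul,
    intervalIntegral.integral_of_le zero_le_one]
  have e : ∀ s ∈ Ioc (0 : ℝ) 1, ∫ y in {y : Plane | √s ≤ ‖y‖ ∧ ‖y‖ ≤ r}, a y h * a y k =
      (Real.log r - Real.log s / 2) * circleMatrix a h k := by
    intro s hs
    have hss : 0 < √s := Real.sqrt_pos.2 hs.1
    rw [setIntegral_annulus_of_homogeneous ha h k hs.1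
      ((Real.sqrt_le_one.2 hs.2).trans hr), Real.log_div hr0.ne' hss.ne', Real.log_sqrt hs.1.le]
  rw [setIntegral_congr_fun measurableSet_Ioc e, ← intervalIntegral.integral_of_le zero_le_one,
    intervalIntegral.integral_mul_const, intervalIntegral.integral_sub
      intervalIntegrable_const (intervalIntegral.intervalIntegrable_log'.div_const 2),
    intervalIntegral.integral_div, integral_log_from_zero]
  simp
  ring_nf
  simp

theorem profileContract_smul (x : Plane) (c : ℝ) (M : Matrix (Fin 2) (Fin 2) ℝ) :
    profileContract x (c • M) = c • profileContract x M := by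
  ext j
  simp only [profileContract_apply, PiLp.smul_apply, Matrix.smul_apply, smul_eq_mul,
    Fin.sum_univ_two]
  ring

theorem exists_norm_profileContract_le (M : Matrix (Fin 2) (Fin 2) ℝ) : ∃ C > 0, ∀ x : Plane,
    x ≠ 0 → ‖profileContract x M‖ ≤ C * (‖x‖ ^ 3)⁻¹ := by
  obtain ⟨C, hC, hF⟩ := exists_abs_profileTensor_le
  let N := ∑ h, ∑ k, |M h k|
  have hN : 0 ≤ N := by positivity
  refine ⟨2 * (C * N) + 1, by positivity, fun x hx => ?_⟩
  have hx0 : 0 < ‖x‖ := norm_pos_iff.2 hx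
  have hj : ∀ j, |profileContract x M j| ≤ C * N * (‖x‖ ^ 3)⁻¹ := by
    intro j
    rw [profileContract_apply]
    have e : C * N * (‖x‖ ^ 3)⁻¹ = ∑ h, ∑ k, C / ‖x‖ ^ 3 * |M h k| := by
      simp only [N, Fin.sum_univ_two]
      ring
    rw [e]
    refine (Finset.abs_sum_le_sum_abs _ _).trans (Finset.sum_le_sum fun h _ => ?_)
    refine (Finset.abs_sum_le_sum_abs _ _).trans (Finset.sum_le_sum fun k _ => ?_)
    rw [abs_mul]
    gcongr
    exact hF j h k x hx
  refine (norm_le_sum_coord _).trans ((add_le_add (hj 0) (hj 1)).trans ?_)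
  have : 0 ≤ (‖x‖ ^ 3)⁻¹ := by positivity
  linarith


/-! ### Comparison with the norms of `Ė^m_1` and `X^m_1` -/

theorem rpow_one_add_natCast (r : ℝ) (k : ℕ) : r ^ ((1 : ℝ) + (k : ℝ)) = r ^ (1 + k) := by
  rw [← Real.rpow_natCast]
  push_cast
  rfl

/-- A multilinear map is controlled by its values on the vectors of the standard basis. -/
theorem norm_multilinear_le_of_basis {k : ℕ}
    (f : ContinuousMultilinearMap ℝ (fun _ : Fin k => Plane) Plane) {M : ℝ}
    (hf : ∀ i : Fin k → Fin 2, ‖f fun l => basisVec (i l)‖ ≤ M) (hM : 0 ≤ M) :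
    ‖f‖ ≤ 2 ^ k * M := by
  refine ContinuousMultilinearMap.opNorm_le_bound (by positivity) fun m => ?_
  have e : m = fun l => ∑ i : Fin 2, m l i • basisVec i := by
    funext l
    ext j
    fin_cases j <;> simp [Fin.sum_univ_two]
  have e2 : f m = ∑ i : Fin k → Fin 2, (∏ l, m l (i l)) • f fun l => basisVec (i l) := by
    conv_lhs => rw [e]
    rw [f.map_sum]
    exact Finset.sum_congr rfl fun i _ => f.map_smul_univ _ _
  rw [e2]
  refine (norm_sum_le _ _).trans ?_
  have h : ∀ i ∈ (Finset.univ : Finset (Fin k → Fin 2)),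
      ‖(∏ l, m l (i l)) • f fun l => basisVec (i l)‖ ≤ (∏ l, ‖m l‖) * M := by
    intro i _
    rw [norm_smul, norm_prod]
    refine mul_le_mul (Finset.prod_le_prod (fun _ _ => norm_nonneg _) fun l _ => ?_) (hf i)
      (norm_nonneg _) (by positivity)
    exact abs_coord_le _ _
  refine (Finset.sum_le_sum h).trans (le_of_eq ?_)
  rw [Finset.sum_const, Finset.card_univ, Fintype.card_fun, Fintype.card_fin, Fintype.card_fin,
    nsmul_eq_mul]
  push_cast
  ring

theorem isDatum_of_eDotNorm_lt {a : Plane → Plane} {ε : ℝ} (hε : 0 ≤ ε) (ha : MemEDot 2 1 a)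
    (hn : eDotNorm 2 1 a < ENNReal.ofReal ε) : IsDatum (4 * ε) a := by
  refine ⟨ha.1, fun k hk x hx => ?_⟩
  have hx0 : 0 < ‖x‖ := norm_pos_iff.2 hx
  have h1 : ∀ i : Fin k → Fin 2, ‖partialDeriv i a x‖ ≤ ε / ‖x‖ ^ (1 + k) := by
    intro i
    have h2 : ENNReal.ofReal (‖x‖ ^ ((1 : ℝ) + (k : ℝ)) * ‖partialDeriv i a x‖) ≤
        ENNReal.ofReal ε := by
      refine le_trans ?_ hn.le
      exact le_iSup_of_le k (le_iSup_of_le hk (le_iSup_of_le i (le_iSup_of_le x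
        (le_iSup_of_le hx le_rfl))))
    rw [ENNReal.ofReal_le_ofReal_iff hε, rpow_one_add_natCast] at h2
    rwa [le_div_iff₀' (by positivity)]
  have h3 := norm_multilinear_le_of_basis (iteratedFDeriv ℝ k a x) (M := ε / ‖x‖ ^ (1 + k)) h1
    (by positivity)
  have h4 : (2 : ℝ) ^ k ≤ 2 ^ 2 := pow_le_pow_right₀ (by norm_num) hk
  calc _ ≤ 2 ^ k * (ε / ‖x‖ ^ (1 + k)) := h3
    _ ≤ 2 ^ 2 * (ε / ‖x‖ ^ (1 + k)) := by gcongr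
    _ = _ := by ring

theorem IsDatum.mono {A B : ℝ} {a : Plane → Plane} (ha : IsDatum A a) (h : A ≤ B) : IsDatum B a :=
  ⟨ha.contDiffOn, fun k hk x hx => (ha.bound k hk x hx).trans (by gcongr)⟩

theorem norm_partialDeriv_le {k : ℕ} (i : Fin k → Fin 2) (f : Plane → Plane) (x : Plane) :
    ‖partialDeriv i f x‖ ≤ ‖iteratedFDeriv ℝ k f x‖ := by
  refine (ContinuousMultilinearMap.le_opNorm _ _).trans (le_of_eq ?_)
  simp

theorem IsXField.xNorm_le {B : ℝ} {u : ℝ → Plane → Plane} (hu : IsXField 1 B u) :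
    xNorm 2 1 u ≤ ENNReal.ofReal B := by
  refine iSup_le fun k => iSup_le fun hk => iSup_le fun i => ?_
  refine essSup_le_of_ae_le _ (ae_spaceTime fun t ht x => ?_)
  have hst : 0 < √t := Real.sqrt_pos.2 ht
  refine ENNReal.ofReal_le_ofReal ?_
  simp only
  rw [rpow_one_add_natCast, ← le_div_iff₀' (by positivity)]
  exact (norm_partialDeriv_le i _ _).trans (hu.bound t ht k hk x)

theorem IsXField.memX {B : ℝ} {u : ℝ → Plane → Plane} (hu : IsXField 1 B u) : MemX 2 1 u :=
  ⟨hu.stronglyMeasurable.aestronglyMeasurable,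
    (ae_restrict_iff' measurableSet_Ioi).2 (.of_forall fun t ht => hu.contDiff t ht),
    hu.xNorm_le.trans_lt ENNReal.ofReal_lt_top⟩

theorem isXBounded_of_xNorm_le {B : ℝ} (hB : 0 ≤ B) {v : ℝ → Plane → Plane} (hv : MemX 2 1 v)
    (hn : xNorm 2 1 v ≤ ENNReal.ofReal B) : IsXBounded B v := by
  refine ⟨hv.aestronglyMeasurable, ?_, hB⟩
  have h1 : essSup (fun p : ℝ × Plane => ENNReal.ofReal ((√p.1 + ‖p.2‖) ^ ((1 : ℝ) + ((0 : ℕ) : ℝ)) *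
      ‖partialDeriv (k := 0) Fin.elim0 (v p.1) p.2‖)) spaceTime ≤ ENNReal.ofReal B := by
    refine le_trans ?_ hn
    exact le_iSup_of_le 0 (le_iSup_of_le (by omega) (le_iSup_of_le Fin.elim0 le_rfl))
  have h2 : ∀ᵐ p ∂spaceTime, ENNReal.ofReal ((√p.1 + ‖p.2‖) ^ ((1 : ℝ) + ((0 : ℕ) : ℝ)) *
      ‖partialDeriv (k := 0) Fin.elim0 (v p.1) p.2‖) ≤ ENNReal.ofReal B := by
    filter_upwards [ENNReal.ae_le_essSup (μ := spaceTime) (fun p : ℝ × Plane =>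
      ENNReal.ofReal ((√p.1 + ‖p.2‖) ^ ((1 : ℝ) + ((0 : ℕ) : ℝ)) *
        ‖partialDeriv (k := 0) Fin.elim0 (v p.1) p.2‖))] with p hp using hp.trans h1
  have h3 : ∀ᵐ p ∂spaceTime, 0 < √p.1 + ‖p.2‖ := ae_spaceTime fun t ht x => by
    have := Real.sqrt_pos.2 ht
    positivity
  filter_upwards [h2, h3] with p hp hp0
  rw [ENNReal.ofReal_le_ofReal_iff hB, rpow_one_add_natCast] at hp
  rw [le_div_iff₀' hp0]
  simpa [partialDeriv] using hp

/-! ### The initial condition -/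

theorem integrable_schwartz_mul_norm_inv (φ : SchwartzMap Plane ℝ) :
    Integrable fun x : Plane => |φ x| * ‖x‖⁻¹ := by
  obtain ⟨C, hC0, hC⟩ := φ.decay 0 0
  simp only [pow_zero, norm_iteratedFDeriv_zero, one_mul] at hC
  have h1 : Integrable ((Metric.ball (0 : Plane) 1).indicator fun x => C * ‖x‖⁻¹) :=
    IntegrableOn.integrable_indicator (Integrable.const_mul (integrableOn_ball_norm_inv 1) _)
      measurableSet_ball
  refine (h1.add φ.integrable.norm).mono' ?_ (.of_forall fun x => ?_)
  · exact (φ.continuous.abs.measurable.mul measurable_norm.inv).aestronglyMeasurable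
  · rw [Pi.add_apply, Real.norm_of_nonneg (by positivity)]
    by_cases hx : x ∈ Metric.ball (0 : Plane) 1
    · rw [indicator_of_mem hx]
      have := mul_le_mul_of_nonneg_right (hC x) (by positivity : 0 ≤ ‖x‖⁻¹)
      rw [Real.norm_eq_abs] at this
      linarith [norm_nonneg (φ x)]
    · rw [indicator_of_notMem hx, zero_add, Real.norm_eq_abs]
      have hx' : 1 ≤ ‖x‖ := by simpa using hx
      exact mul_le_of_le_one_right (abs_nonneg _) (inv_le_one_of_one_le₀ hx')

theorem tendsto_integral_schwartz_smul {B E : ℝ} {a : Plane → Plane} {u : ℝ → Plane → Plane}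
    (hu : IsXField 1 B u)
    (hua : ∀ s, 0 < s → ∀ y, y ≠ 0 → ‖u s y - a y‖ ≤ E * (s / ‖y‖ ^ 3 + √s / ‖y‖ ^ 2))
    (φ : SchwartzMap Plane ℝ) :
    Tendsto (fun t : ℝ => ∫ x, φ x • u t x) (𝓝[>] 0) (𝓝 (∫ x, φ x • a x)) := by
  have hne : ∀ᵐ x : Plane, x ≠ 0 := by simp [ae_iff, measure_singleton]
  refine tendsto_integral_filter_of_dominated_convergence (fun x => B * (|φ x| * ‖x‖⁻¹)) ?_ ?_
    ((integrable_schwartz_mul_norm_inv φ).const_mul B) ?_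
  · filter_upwards [self_mem_nhdsWithin] with t ht
    exact (φ.continuous.smul (hu.contDiff t ht).continuous).aestronglyMeasurable
  · filter_upwards [self_mem_nhdsWithin] with t ht
    filter_upwards [hne] with x hx
    have hx0 : 0 < ‖x‖ := norm_pos_iff.2 hx
    have hB := hu.nonneg
    have h := hu.norm_le ht x
    rw [norm_smul, Real.norm_eq_abs]
    calc _ ≤ |φ x| * (B / ‖x‖) := by
          gcongr
          refine h.trans ?_
          rw [pow_one]
          gcongr
          linarith [Real.sqrt_nonneg t]
      _ = _ := by ring
  · filter_upwards [hne] with x hx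
    refine Tendsto.const_smul ?_ _
    rw [tendsto_iff_norm_sub_tendsto_zero]
    have hlim : Tendsto (fun t : ℝ => E * (t / ‖x‖ ^ 3 + √t / ‖x‖ ^ 2)) (𝓝[>] 0) (𝓝 0) := by
      have hc : Continuous fun t : ℝ => E * (t / ‖x‖ ^ 3 + √t / ‖x‖ ^ 2) := by fun_prop
      have := (hc.tendsto 0).mono_left (nhdsWithin_le_nhds (s := Ioi 0))
      simpa using this
    refine squeeze_zero' (.of_forall fun t => norm_nonneg _) ?_ hlim
    filter_upwards [self_mem_nhdsWithin] with t ht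
    exact hua t ht x hx

end NSProfile

theorem theorem7 :
    ∃ ε > (0 : ℝ), ∃ M > (0 : ℝ), ∀ a : Plane → Plane,
      MemEDot 2 1 a → IsDivFree a → eDotNorm 2 1 a < ENNReal.ofReal ε →
      ∃ u : ℝ → Plane → Plane,
        -- `u` is the small global solution with datum `a`
        (MemX 2 1 u ∧ IsNSSolution a u ∧ xNorm 2 1 u ≤ ENNReal.ofReal (ε * M)) ∧
        (∀ v : ℝ → Plane → Plane,
          MemX 2 1 v → IsNSSolution a v → xNorm 2 1 v ≤ ENNReal.ofReal (ε * M) →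
          ∀ t : ℝ, 0 < t → v t = u t) ∧
        -- its profile, uniformly in the region `|x| ≥ e √t`
        (∃ C : ℝ, ∀ t : ℝ, 0 < t → ∀ x : Plane, Real.exp 1 * √t ≤ ‖x‖ →
          ‖u t x - (a x - profileContract x (annulusMatrix a t ‖x‖))‖ ≤ C * (t / ‖x‖ ^ 3)) ∧
        -- the self-similar case
        (IsHomogeneousNegOne a →
          ∃ U : Plane → Plane,
            (∀ t : ℝ, 0 < t → ∀ x : Plane, u t x = (√t)⁻¹ • U ((√t)⁻¹ • x)) ∧
            (fun x : Plane =>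
              U x - (a x - Real.log ‖x‖ • profileContract x (circleMatrix a)))
              =O[Bornology.cobounded Plane] fun x : Plane => (‖x‖ ^ 3)⁻¹) := by
  obtain ⟨D, hD, hheat⟩ := exists_isXField_heatField
  obtain ⟨A₁, hA₁, hex⟩ := exists_mild_solution
  obtain ⟨A₂, hA₂, huniq⟩ := exists_mild_unique
  obtain ⟨A₃, hA₃, hself⟩ := exists_rescale_eq
  -- the heat flow of the datum has norm at most `4 D ε`, and the solution twice as much
  set m := min A₁ (min A₂ A₃) with hm
  have hm0 : 0 < m := lt_min hA₁ (lt_min hA₂ hA₃)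
  have hm1 : m ≤ A₁ := min_le_left _ _
  have hm2 : m ≤ A₂ := (min_le_right _ _).trans (min_le_left _ _)
  have hm3 : m ≤ A₃ := (min_le_right _ _).trans (min_le_right _ _)
  refine ⟨m / (8 * D), by positivity, 8 * D, by positivity, ?_⟩
  intro a ha _ hn
  have hεM : m / (8 * D) * (8 * D) = m := by field_simp
  rw [hεM]
  have had := isDatum_of_eDotNorm_lt (by positivity) ha hn
  have hH : IsXField 1 (m / 2) (heatField a) := (hheat had).mono (le_of_eq (by field_simp; norm_num))
  obtain ⟨u, hu, hmild⟩ := hex hH (by linarith)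
  rw [mul_div_cancel₀ m two_ne_zero] at hu
  have hmild' : ∀ t, 0 < t → ∀ x, u t x = heatFlow t a x - bilinearDuhamel u u t x := by
    intro t ht x
    rw [hmild t ht x, heatField, if_pos ht]
  obtain ⟨B, hB, huB, haB⟩ : ∃ B : ℝ, 0 ≤ B ∧ IsXField 1 B u ∧ IsDatum B a :=
    ⟨m + 4 * (m / (8 * D)), by positivity, hu.mono (le_add_of_nonneg_right (by positivity)),
      had.mono (le_add_of_nonneg_left hm0.le)⟩
  obtain ⟨E, hE, hua⟩ := exists_norm_sub_datum_le B hB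
  obtain ⟨Q, hQ, hprof⟩ := exists_norm_sub_profile_le B hB
  have hprof' := hprof huB haB hmild'
  refine ⟨u, ⟨hu.memX, ⟨fun t ht x => ?_, fun φ => ?_⟩, hu.xNorm_le⟩, ?_, ⟨Q, ?_⟩, ?_⟩
  · rw [nsBilinear_eq_bilinearDuhamel hu.isXBounded hu.isXBounded ht x]
    exact hmild' t ht x
  · exact tendsto_integral_schwartz_smul huB (hua huB haB hmild') φ
  · intro v hv hvs hvn t ht
    have hvb := isXBounded_of_xNorm_le hm0.le hv hvn
    funext x
    refine huniq (H := fun t x => heatFlow t a x) hvb hu.isXBounded hm2 (fun t ht x => ?_) hmild'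
      t ht x
    rw [← nsBilinear_eq_bilinearDuhamel hvb hvb ht x]
    exact hvs.mild t ht x
  · intro t ht x hx
    refine hprof' t ht x (le_trans ?_ hx)
    exact le_mul_of_one_le_left (Real.sqrt_nonneg t) (Real.one_le_exp zero_le_one)
  · intro hhom
    refine ⟨u 1, fun t ht x => ?_, ?_⟩
    · have hst : 0 < √t := Real.sqrt_pos.2 ht
      have h := hself hu hm3 hhom hmild' √t hst 1 one_pos ((√t)⁻¹ • x)
      rw [← h, rescale, Real.sq_sqrt ht.le, mul_one, smul_smul, smul_smul,
        inv_mul_cancel₀ hst.ne', mul_inv_cancel₀ hst.ne', one_smul, one_smul]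
    · obtain ⟨C, hC, hpc⟩ := exists_norm_profileContract_le (circleMatrix a)
      refine Asymptotics.IsBigO.of_bound (Q + C) ?_
      filter_upwards [eventually_cobounded_le_norm (E := Plane) 1] with x hx
      have hx0 : 0 < ‖x‖ := one_pos.trans_le hx
      have h1 := hprof' 1 one_pos x (by rwa [Real.sqrt_one])
      have h2 := hpc x (norm_pos_iff.1 hx0)
      rw [annulusMatrix_of_homogeneous hhom hx, profileContract_smul, one_div (‖x‖ ^ 3)] at h1
      -- the parabolic cut-off of the annulus contributes `∫_0^1 log s^{-1/2} ds = 1/2`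
      set P := profileContract x (circleMatrix a) with hP
      have e : u 1 x - (a x - Real.log ‖x‖ • P) =
          (u 1 x - (a x - (Real.log ‖x‖ + 1 / 2) • P)) - (1 / 2 : ℝ) • P := by
        rw [add_smul]; abel
      have h3 : ‖(1 / 2 : ℝ) • P‖ ≤ C * (‖x‖ ^ 3)⁻¹ := by
        rw [norm_smul]
        refine le_trans ?_ h2
        exact mul_le_of_le_one_left (norm_nonneg _) (by norm_num)
      rw [e, Real.norm_of_nonneg (by positivity), add_mul]
      exact (norm_sub_le _ _).trans (add_le_add h1 h3)
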